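/- **Threshold theorem for a surface-code memory on a defective qubit array (phenomenological noise).** *Array.* Consider the planar surface code of distance $d$ on a $d\times d$ array of unit cells: qubits on the edges of a square lattice, star operators (products of Pauli $X$) at the vertices, plaquette operators (products of Pauli $Z$) at the faces, each unit cell holding one vertex, one face, one horizontal and one vertical edge; the left and right boundaries are rough and the bottom and top boundaries are smooth. Let $Q>15$ be an integer. The fabrication defects are a set of unit cells decomposed into clusters, each with a level $j\ge 0$. Each cluster is quarantined in a smallest square of unit cells of the array containing it; for a cluster of level $j$ this square has linear size $s\le Q^j$, and its distance in the infinity norm from the square of any other cluster of level $k\ge j$ is at least $Q^{j+1}/3$. The array is *operable* if $Q^j\le d/5-3$ for every level $j$ that occurs (equivalently, for the highest level $m$). *Protocol.* The $(s+1)\times(s+1)$ vertices on a quarantined square form a puncture. Faces that touch no puncture are measured in every round. While the puncture is *rough*, all faces that touch it but do not have all four corners in it (the ring) are measured, with the edges having both ends in the puncture removed. While it is *smooth*, every edge and face that touches it is removed. A star is measured in every round at each vertex outside the punctures, on those of its edges that are present. When a rough puncture turns smooth, the edges with exactly one end in it are measured in the Pauli-$X$ basis; when it turns rough again they are prepared in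 $|+\rangle$. Around a cluster of level $j$ the boundary type alternates every $Q^j$ rounds, starting with either type. Punctures too close to the boundary of the array to be enclosed by a loop of $4(s+2)$ edges of the lattice are walled off permanently as an extension of an adjacent boundary, with its type (for a rough one, the missing vertices just beyond the array count as vertices of the puncture). The memory starts in a known code state (all stabilizers and super-stabilizers fixed), is run for $d$ rounds, and is then read out. *Noise.* Independently and with probability $\varepsilon$ each: a bit flip and a phase flip of every qubit in use before each round and before the readout, and a wrong outcome of every plaquette, star or single-qubit gauge measurement in the $d$ rounds. *Detection events.* A plaquette or star has an event when two consecutive outcomes differ (a star that loses edges being completed by the single-qubit $X$ outcomes on them). Each maximal period of constant type of an alternating puncture is a *shell* and carries one further event: for a smooth shell, the change of the plaquette super-stabilizer (the product of the ring plaquettes) between the round just before and the round just after the shell, the initial and final values being those of the initial state and of the readout; for a rough shell, the product of the single-qubit $X$ measurements at its end (or at the readout). A minimum-weight decoder returns an error with the observed events of least cardinality, with ties broken arbitrarily. It *fails* if the product of error and correction flips a logical operator, i.e. a Pauli-$Z$ (or Pauli-$X$) operator supported on qubits in use in all rounds that commutes with all measured star (or plaquette) operators. *Theorem.* Put $$\rho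 = 2\cdot 5\cdot 40^{2Q/(Q-15)}\,Q^{60Q/(Q-15)^2},\qquad \varepsilon_0=\frac1{\rho^2}>0,\qquad \eta=1-\log_Q 15>0 .$$ For every $0\le\varepsilon<\varepsilon_0$ there are $c>0$ and $d_0$, depending only on $Q$ and $\varepsilon$, such that for all $d\ge d_0$, every operable $d\times d$ array and every minimum-weight decoder, the logical failure probability is at most $\exp(-c\,d^{\eta})$. -/

import Mathlib

noncomputable section

namespace ShellMemory

/-! ## The planar surface code on a `d × d` array of unit cells

Unit cells, vertices and faces are all labelled by integer points.  The unit cell `(x, y)` holds the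
vertex (star operator) `(x, y)`, the face (plaquette operator) with lower left corner `(x, y)`, the
horizontal edge from `(x, y)` to `(x + 1, y)` and the vertical edge from `(x, y)` to `(x, y + 1)`.
The array has rough boundaries on the left and on the right (the vertices with `x ≤ 0` or `d ≤ x`
are missing) and smooth boundaries at the bottom and at the top. -/

abbrev Site := ℤ × ℤ

/-- Data qubits live on the edges of the square lattice. -/
inductive Qubit
  | hor (p : Site)
  | ver (p : Site)
  deriving DecidableEq

/-- The two end points of an edge. -/
def Qubit.ends : Qubit → Finset Site
  | .hor p => {p, (p.1 + 1, p.2)}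
  | .ver p => {p, (p.1, p.2 + 1)}

/-- The four corners of the face `w`. -/
def faceCorners (w : Site) : Finset Site :=
  {w, (w.1 + 1, w.2), (w.1, w.2 + 1), (w.1 + 1, w.2 + 1)}

/-- The four edges around the face `w` (the support of a plaquette operator in the bulk). -/
def faceEdges (w : Site) : Finset Qubit :=
  {.hor w, .hor (w.1, w.2 + 1), .ver w, .ver (w.1 + 1, w.2)}

/-- The four edges at the vertex `v` (the support of a star operator in the bulk). -/
def starEdges (v : Site) : Finset Qubit :=
  {.hor v, .hor (v.1 - 1, v.2), .ver v, .ver (v.1, v.2 - 1)}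

/-- The `s × s` square of integer points with lower left point `p`. -/
def square (p : Site) (s : ℕ) : Finset Site :=
  Finset.Ico p.1 (p.1 + s) ×ˢ Finset.Ico p.2 (p.2 + s)

/-- The distance of two unit cells in the infinity norm. -/
def cellDist (p q : Site) : ℤ := max |p.1 - q.1| |p.2 - q.2|

/-- The data qubits of the defect-free code of distance `d`. -/
def idealQubits (d : ℕ) : Finset Qubit :=
  (Finset.Ico (0 : ℤ) d ×ˢ Finset.Ico (0 : ℤ) d).image Qubit.hor ∪
    (Finset.Ico (1 : ℤ) d ×ˢ Finset.Ico (0 : ℤ) (d - 1)).image Qubit.ver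

/-- The vertices of the defect-free code of distance `d`. -/
def idealVertices (d : ℕ) : Finset Site := Finset.Ico (1 : ℤ) d ×ˢ Finset.Ico (0 : ℤ) d

/-- The faces of the defect-free code of distance `d`. -/
def idealFaces (d : ℕ) : Finset Site := Finset.Ico (0 : ℤ) d ×ˢ Finset.Ico (0 : ℤ) (d - 1)

/-- The two types of boundary of a puncture. -/
inductive Boundary
  | rough
  | smooth
  deriving DecidableEq

/-- The opposite boundary type. -/
def Boundary.flip : Boundary → Boundary
  | .rough => .smooth
  | .smooth => .rough

/-! ## Defective arrays -/

/-- A `d × d` array of unit cells whose fabrication defects are decomposed into clusters with levels.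
Every cluster is quarantined in a smallest square of unit cells of the array that contains it. -/
structure DefectArray (Q d : ℕ) where
  /-- the number of clusters -/
  n : ℕ
  /-- the defective unit cells of each cluster -/
  cluster : Fin n → Finset Site
  /-- the level of each cluster -/
  level : Fin n → ℕ
  /-- the lower left unit cell of the quarantined square -/
  corner : Fin n → Site
  /-- the linear size of the quarantined square -/
  side : Fin n → ℕ
  /-- the boundary type with which the puncture starts -/
  first : Fin n → Boundary
  cluster_nonempty : ∀ i, (cluster i).Nonempty
  cluster_subset : ∀ i, cluster i ⊆ square (corner i) (side i)
  square_subset : ∀ i, square (corner i) (side i) ⊆ square (0, 0) d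
  side_minimal : ∀ i p s, cluster i ⊆ square p s → side i ≤ s
  /-- a cluster of level `j` has linear size at most `Q ^ j` -/
  side_le : ∀ i, side i ≤ Q ^ level i
  /-- the square of a cluster of level `j` is at distance at least `Q ^ (j + 1) / 3` from the square
  of every other cluster of level at least `j` -/
  separated : ∀ i k, i ≠ k → level i ≤ level k →
    ∀ p ∈ square (corner i) (side i), ∀ q ∈ square (corner k) (side k),
      ((Q : ℝ) ^ (level i + 1)) / 3 ≤ (cellDist p q : ℝ)

namespace DefectArray

variable {Q d : ℕ} (A : DefectArray Q d)

/-- The array is operable: all cluster levels `j`, hence the highest one, have `Q ^ j ≤ d / 5 - 3`. -/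
def Operable : Prop := ∀ i, (Q : ℝ) ^ A.level i ≤ (d : ℝ) / 5 - 3

/-! ## Punctures and their boundaries -/

/-- The vertices on the quarantined unit cells and on their rim.  None of them is used. -/
def hole (i : Fin A.n) : Finset Site := square (A.corner i) (A.side i + 1)

/-- The faces that surround the hole: those with some, but not all, corners in the hole. -/
def ring (i : Fin A.n) : Finset Site :=
  (square ((A.corner i).1 - 1, (A.corner i).2 - 1) (A.side i + 2)).filter
    fun w => ¬ faceCorners w ⊆ A.hole i

/-- The boundary qubits of the puncture, with exactly one end in the hole.  The super-stabilizer
of star type is the product of Pauli-X over them. -/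
def radial (i : Fin A.n) : Finset Qubit :=
  (idealQubits d).filter fun q => (q.ends ∩ A.hole i).card = 1

/-- The closed loop of `4 * (side + 2)` edges just outside the ring.  The super-stabilizer of
plaquette type is the product of Pauli-Z over it; it is also the product of the plaquettes of
the ring. -/
def perimeter (i : Fin A.n) : Finset Qubit :=
  (idealQubits d).filter fun q => Disjoint q.ends (A.hole i) ∧ ∃ w ∈ A.ring i, q ∈ faceEdges w

/-- The puncture is too close to the left or right boundary to be enclosed by its perimeter. -/
def NearRough (i : Fin A.n) : Prop :=
  (A.corner i).1 ≤ 1 ∨ (d : ℤ) - 1 ≤ (A.corner i).1 + A.side i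

/-- The puncture is too close to the bottom or top boundary to be enclosed by its perimeter. -/
def NearSmooth (i : Fin A.n) : Prop :=
  (A.corner i).2 ≤ 0 ∨ (d : ℤ) - 1 ≤ (A.corner i).2 + A.side i

/-- The puncture can be enclosed by super-stabilizers. -/
def Enclosable (i : Fin A.n) : Prop := ¬ A.NearRough i ∧ ¬ A.NearSmooth i

open Classical in
/-- The boundary type of puncture `i` in round `t`.  Rounds are numbered `0, …, d - 1`, and the final
readout at time `d` is in the configuration of the last round.  The type alternates every `Q ^ j`
rounds.  A puncture that cannot be enclosed is walled off once and for all as an extension of the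
boundary of the array next to it (of either of them, next to a corner of the array). -/
def mode (i : Fin A.n) (t : ℕ) : Boundary :=
  if A.NearSmooth i then
    if A.NearRough i then A.first i else .smooth
  else if A.NearRough i then .rough
  else if Even (min t (d - 1) / Q ^ A.level i) then A.first i
  else (A.first i).flip

/-- Vertices missing beyond the rough boundaries of the array, or in a hole that is rough. -/
def RoughRemoved (t : ℕ) (p : Site) : Prop :=
  p.1 ≤ 0 ∨ (d : ℤ) ≤ p.1 ∨ ∃ i, A.mode i t = .rough ∧ p ∈ A.hole i

/-- Vertices in a hole that is smooth. -/
def SmoothRemoved (t : ℕ) (p : Site) : Prop :=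
  ∃ i, A.mode i t = .smooth ∧ p ∈ A.hole i

open Classical in
/-- The qubits of the code in round `t`.  A rough hole removes the edges with both ends removed, a
smooth hole removes all the edges that touch it. -/
def active (t : ℕ) : Finset Qubit :=
  (idealQubits d).filter fun q =>
    (¬ ∀ p ∈ q.ends, A.RoughRemoved t p) ∧ ∀ p ∈ q.ends, ¬ A.SmoothRemoved t p

open Classical in
/-- The faces whose plaquette operators are measured in round `t`. -/
def faces (t : ℕ) : Finset Site :=
  (idealFaces d).filter fun w =>
    (¬ ∀ p ∈ faceCorners w, A.RoughRemoved t p) ∧ ∀ p ∈ faceCorners w, ¬ A.SmoothRemoved t p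

/-- The vertices whose star operators are measured (in every round). -/
def stars : Finset Site := (idealVertices d).filter fun v => ∀ i, v ∉ A.hole i

/-- The qubits that are measured out in the Pauli-X basis in round `t`, when rough holes turn
smooth. -/
def decoupled (t : ℕ) : Finset Qubit := if t = 0 then ∅ else A.active (t - 1) \ A.active t

/-- The qubits exposed to noise just before round `t` (just before the readout, for `t = d`): those of
the code in round `t`, where qubits new in the code have just been prepared in the `+` state, and
those that are measured out in round `t`. -/
def present (t : ℕ) : Finset Qubit := A.active t ∪ A.decoupled t

end DefectArray

/-! ## Errors, measurement outcomes and detection events -/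

/-- The elementary errors: a bit flip or a phase flip of a qubit just before round `t`, or a wrong
outcome in round `t` of a plaquette, of a star, or of a single-qubit Pauli-X gauge measurement. -/
inductive Fault
  | bit (q : Qubit) (t : ℕ)
  | phase (q : Qubit) (t : ℕ)
  | plaq (w : Site) (t : ℕ)
  | star (v : Site) (t : ℕ)
  | gauge (q : Qubit) (t : ℕ)
  deriving DecidableEq

/-- The places where detection events may occur: a face or a vertex at time `t`, and the `k`-th
shell of puncture `i`. -/
inductive Detector (n : ℕ)
  | face (w : Site) (t : ℕ)
  | vertex (v : Site) (t : ℕ)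
  | shell (i : Fin n) (k : ℕ)

/-- `1` if the elementary error `f` occurs in `E`, and `0` otherwise. -/
def occurs (E : Finset Fault) (f : Fault) : ZMod 2 := if f ∈ E then 1 else 0

namespace DefectArray

variable {Q d : ℕ} (A : DefectArray Q d)

/-- All elementary errors that are possible in `d` rounds of noisy measurements followed by a final
readout of the stabilizers at time `d`. -/
def faults : Finset Fault :=
  (Finset.range (d + 1)).biUnion (fun t =>
    (A.present t).image (fun q => Fault.bit q t) ∪
    (A.present t).image (fun q => Fault.phase q t)) ∪
  (Finset.range d).biUnion (fun t =>
    (A.faces t).image (fun w => Fault.plaq w t) ∪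
    A.stars.image (fun v => Fault.star v t) ∪
    (A.decoupled t).image (fun q => Fault.gauge q t))

/-- The parity of the errors of one kind (`err` is `Fault.bit` or `Fault.phase`) on the qubit `q` at
time `t`, accumulated since the qubit was last prepared. -/
def frame (err : Qubit → ℕ → Fault) (E : Finset Fault) (q : Qubit) : ℕ → ZMod 2
  | 0 => occurs E (err q 0)
  | t + 1 => (if q ∈ A.active t then frame err E q t else 0) + occurs E (err q (t + 1))

/-- Whether the errors flip the outcome of the plaquette `w` in round `t`.  (Flips are relative to a
noiseless run with the same random gauge outcomes.) -/
def plaqFlip (E : Finset Fault) (w : Site) (t : ℕ) : ZMod 2 :=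
  occurs E (.plaq w t) + ∑ q ∈ faceEdges w ∩ A.active t, A.frame .bit E q t

/-- Whether the errors flip the outcome of the star `v` in round `t`. -/
def starFlip (E : Finset Fault) (v : Site) (t : ℕ) : ZMod 2 :=
  occurs E (.star v t) + ∑ q ∈ starEdges v ∩ A.active t, A.frame .phase E q t

/-- Whether the errors flip the outcome of a Pauli-X measurement of the qubit `q` in round `t`. -/
def gaugeFlip (E : Finset Fault) (q : Qubit) (t : ℕ) : ZMod 2 :=
  occurs E (.gauge q t) + A.frame .phase E q t

/-- The round after the last one of the `k`-th shell of puncture `i`. -/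
def shellEnd (i : Fin A.n) (k : ℕ) : ℕ := min ((k + 1) * Q ^ A.level i) d

/-- The event at a smooth shell: the super-stabilizer of plaquette type just after the shell is
compared with its value just before the shell.  The value is the product of the ring plaquettes, or
is read out at time `d`; initially the system is in a known eigenstate. -/
def smoothShellEvent (E : Finset Fault) (i : Fin A.n) (k : ℕ) : ZMod 2 :=
  (if k = 0 then 0 else ∑ w ∈ A.ring i, A.plaqFlip E w (k * Q ^ A.level i - 1)) +
  (if A.shellEnd i k < d then ∑ w ∈ A.ring i, A.plaqFlip E w (A.shellEnd i k)
    else ∑ q ∈ A.perimeter i, A.frame .bit E q d)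

/-- The event at a rough shell: the product of the Pauli-X measurements of the boundary qubits at the
end of the shell (or at the final readout). -/
def roughShellEvent (E : Finset Fault) (i : Fin A.n) (k : ℕ) : ZMod 2 :=
  ∑ q ∈ A.radial i, A.gaugeFlip E q (A.shellEnd i k)

open Classical in
/-- The error syndrome: the configuration of all detection events.  A face or a vertex has an event at
time `t` if its outcomes in rounds `t - 1` and `t` differ, where the outcome of a star that loses
qubits in round `t` is completed with the Pauli-X measurements of these qubits, and where the
outcomes at time `0` are compared with the known initial code state.  The measurements at time `d`
are those of the readout. -/
def syndrome (E : Finset Fault) : Detector A.n → ZMod 2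
  | .face w t =>
      if t ≤ d ∧ w ∈ A.faces t ∧ (t = 0 ∨ w ∈ A.faces (t - 1)) then
        A.plaqFlip E w t + (if t = 0 then 0 else A.plaqFlip E w (t - 1))
      else 0
  | .vertex v t =>
      if t ≤ d ∧ v ∈ A.stars then
        A.starFlip E v t + ∑ q ∈ starEdges v ∩ A.decoupled t, A.gaugeFlip E q t +
          (if t = 0 then 0 else A.starFlip E v (t - 1))
      else 0
  | .shell i k =>
      if A.Enclosable i ∧ k * Q ^ A.level i < d then
        match A.mode i (k * Q ^ A.level i) with
        | .smooth => A.smoothShellEvent E i k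
        | .rough => A.roughShellEvent E i k
      else 0

/-! ## Decoding and logical failure -/

/-- A minimum-weight decoder: it maps the syndrome of any error to an error of least weight with the
same syndrome (ties are broken arbitrarily). -/
def IsMinWeightDecoder (dec : (Detector A.n → ZMod 2) → Finset Fault) : Prop :=
  ∀ E ⊆ A.faults,
    dec (A.syndrome E) ⊆ A.faults ∧ A.syndrome (dec (A.syndrome E)) = A.syndrome E ∧
    ∀ E' ⊆ A.faults, A.syndrome E' = A.syndrome E → (dec (A.syndrome E)).card ≤ E'.card

open Classical in
/-- The qubits that belong to the code in all rounds. -/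
def permanent : Finset Qubit := (idealQubits d).filter fun q => ∀ t, q ∈ A.active t

/-- The residual error `C` flips a logical operator of Pauli-Z type: an operator on permanent qubits
that commutes with all star operators (and with all Pauli-X gauge operators). -/
def BitFlipFailure (C : Finset Fault) : Prop :=
  ∃ L ⊆ A.permanent, (∀ v ∈ A.stars, Even (starEdges v ∩ L).card) ∧
    ∑ q ∈ L, A.frame .bit C q d = 1

/-- The residual error `C` flips a logical operator of Pauli-X type: an operator on permanent qubits
that commutes with all plaquette operators measured in any round. -/
def PhaseFlipFailure (C : Finset Fault) : Prop :=
  ∃ L ⊆ A.permanent, (∀ t, ∀ w ∈ A.faces t, Even (faceEdges w ∩ L).card) ∧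
    ∑ q ∈ L, A.frame .phase C q d = 1

/-- The error `E`, together with its correction, acts non-trivially on the encoded qubit. -/
def LogicalFailure (dec : (Detector A.n → ZMod 2) → Finset Fault) (E : Finset Fault) : Prop :=
  A.BitFlipFailure (symmDiff E (dec (A.syndrome E))) ∨
    A.PhaseFlipFailure (symmDiff E (dec (A.syndrome E)))

open Classical in
/-- The logical failure probability when the elementary errors occur independently, each with
probability `ε`. -/
def failureProb (dec : (Detector A.n → ZMod 2) → Finset Fault) (ε : ℝ) : ℝ :=
  ∑ E ∈ A.faults.powerset.filter (fun E => A.LogicalFailure dec E),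
    ε ^ E.card * (1 - ε) ^ (A.faults.card - E.card)

end DefectArray

/-- The constant `ρ` that bounds the growth of the number of error configurations. -/
def rho (Q : ℕ) : ℝ :=
  2 * 5 * (40 : ℝ) ^ (2 * (Q : ℝ) / ((Q : ℝ) - 15)) *
    (Q : ℝ) ^ (60 * (Q : ℝ) / ((Q : ℝ) - 15) ^ 2)

/-- The threshold error rate `ε₀ = 1 / ρ²`. -/
def threshold (Q : ℕ) : ℝ := 1 / rho Q ^ 2

/-- The exponent `η = 1 - log_Q 15`. -/
def eta (Q : ℕ) : ℝ := 1 - Real.logb Q 15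

end ShellMemory

end

/-! Bit flips and phase flips are decoded in two separate space-time graphs. An elementary error is
an edge joining the two cells (faces or vertices at a time) whose events it changes. All cells of an
alternating puncture during one period of the relevant type, a shell, are contracted to a single
node; the array boundaries, with the permanently walled-off punctures next to them, become two
further nodes `lo` and `hi`. Every detection event is then the degree modulo 2 of an inner node
(`syndrome_eq_nodeDeg`), the shell event replacing the checks that are missing in the shell.

Error plus correction has no events, hence even degree at all inner nodes. A logical operator is, on
the qubits in use, the coboundary of a labelling that is constant on every shell and on both
boundaries (`exists_labels_of_bitFlipFailure`, `exists_labels_of_phaseFlipFailure`). If it is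
flipped, the labels summed over the edge ends do not vanish, and `exists_trail` yields a simple
trail from `lo` to `hi` in the residual error. Toggling this trail in the correction preserves all
events, so minimality of the weight puts at least half of the trail in the actual error
(`exists_trail_of_failure`).

Two metric facts finish the proof. Length: passing through a shell is free, but a shell of level `j`
has diameter at most `Q^j + 1`, and distinct shells of the same type and of level at least `j` are
`Q^j` apart. Induction on the level shows that progress costs at least one step per `3^j` units of
distance, up to a bounded slack (`JumpWalk.dist_le`). With highest level `m` the trail has at least
`d / (5 * 3^(m+1))` edges, which is at least `d^η / 15`. Entropy: a shell of level `j` has of the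
order of `Q^(3j)` exits, but large shells are rare along a trail, and the total level met in `l`
steps is at most `m + 6 l / (Q - 2)` (`JumpWalk.sum_level_le`). So the number of choices is at most
a polynomial in `d` times `K^l` with `K = 360 Q^(18/(Q-2))`.

A given trail of length `l` is at least half filled by errors with probability at most `(2√ε)^l`.
Since `2K ≤ rho Q` and `ε < 1 / rho Q ^ 2`, the union bound over trails decays geometrically in the
length and beats the polynomial factors. -/

noncomputable section

namespace ShellMemory

/-! ## Walks that jump through shells -/

/-- A walk from `a` to `b` with steps of length at most one and jumps between points that represent
the same node, together with the list of its intermediate nodes and its number of steps. -/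
inductive JumpWalk {X ν : Type*} (dist : X → X → ℤ) (nd : X → ν) : X → X → List ν → ℕ → Prop
  | step {a b : X} : dist a b ≤ 1 → JumpWalk dist nd a b [] 1
  | cons {a b c e : X} {ns : List ν} {l : ℕ} : dist a b ≤ 1 → nd b = nd c →
      JumpWalk dist nd c e ns l → JumpWalk dist nd a e (nd c :: ns) (l + 1)

/-- The inner nodes of rank `0` are single points; those of rank `j + 1` have diameter at most
`Q ^ j + 1`, and distinct inner nodes of rank at least `j + 1` have distance at least `Q ^ j`. -/
structure ShellGeometry {X ν : Type*} (Q : ℕ) (dist : X → X → ℤ) (nd : X → ν) (rank : ν → ℕ)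
    (inner : ν → Prop) : Prop where
  triangle : ∀ a b c, dist a c ≤ dist a b + dist b c
  point : ∀ a b, inner (nd a) → rank (nd a) = 0 → nd a = nd b → dist a b ≤ 0
  diam : ∀ a b j, inner (nd a) → rank (nd a) = j + 1 → nd a = nd b → dist a b ≤ (Q : ℤ) ^ j + 1
  sep : ∀ a b j, inner (nd a) → inner (nd b) → j + 1 ≤ rank (nd a) → j + 1 ≤ rank (nd b) →
    nd a ≠ nd b → (Q : ℤ) ^ j ≤ dist a b

/-- The distance that is gained for free by jumps through nodes of rank at most `j`. -/
def slack (Q : ℕ) : ℕ → ℤ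
  | 0 => 0
  | j + 1 => 2 * (Q : ℤ) ^ j

/-- This drives `JumpWalk.dist_le`. A segment between distinct nodes of rank `j + 1` covers at least
`Q^j`, so its steps account for at least `Q^j - slack Q j`. Twice that amount pays for the next
jump, of length at most `Q^j + 1`, and for the slack of one more segment. -/
lemma slack_lt {Q : ℕ} (hQ : 15 < Q) (j : ℕ) : 3 * slack Q j + 1 ≤ (Q : ℤ) ^ j := by
  cases j with
  | zero => simp [slack]
  | succ j =>
    have h : (1 : ℤ) ≤ (Q : ℤ) ^ j := one_le_pow₀ (by omega)
    have hQ' : (16 : ℤ) ≤ Q := by omega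
    simp only [slack, pow_succ]
    nlinarith

lemma slack_nonneg (Q j : ℕ) : 0 ≤ slack Q j := by
  cases j <;> simp [slack]

section JumpWalk

variable {X ν : Type*} {dist : X → X → ℤ} {nd : X → ν}

lemma JumpWalk.split {n : ν} {ns₂ : List ν} {b : X} : ∀ {ns₁ : List ν} {a : X} {l : ℕ},
    JumpWalk dist nd a b (ns₁ ++ n :: ns₂) l →
      ∃ c c' l₁ l₂, JumpWalk dist nd a c ns₁ l₁ ∧ nd c = n ∧ nd c' = n ∧
        JumpWalk dist nd c' b ns₂ l₂ ∧ l = l₁ + l₂ := by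
  intro ns₁
  induction ns₁ with
  | nil =>
    intro a l h
    cases h with
    | cons h₁ h₂ h₃ => exact ⟨_, _, 1, _, .step h₁, h₂, rfl, h₃, by omega⟩
  | cons x ns₁ ih =>
    intro a l h
    cases h with
    | cons h₁ h₂ h₃ =>
      obtain ⟨c, c', l₁, l₂, k₁, k₂, k₃, k₄, rfl⟩ := ih h₃
      exact ⟨c, c', l₁ + 1, l₂, .cons h₁ h₂ k₁, k₂, k₃, k₄, by omega⟩

lemma list_forall_not_or_split {α : Type*} (p : α → Prop) (l : List α) :
    (∀ x ∈ l, ¬ p x) ∨ ∃ l₁ x l₂, l = l₁ ++ x :: l₂ ∧ (∀ y ∈ l₁, ¬ p y) ∧ p x := by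
  induction l with
  | nil => simp
  | cons a l ih =>
    by_cases ha : p a
    · exact .inr ⟨[], a, l, rfl, by simp, ha⟩
    · rcases ih with h | ⟨l₁, x, l₂, rfl, h, hx⟩
      · exact .inl (by simpa [ha] using h)
      · exact .inr ⟨a :: l₁, x, l₂, rfl, by simpa [ha] using h, hx⟩

variable {Q : ℕ} {rank : ν → ℕ} {inner : ν → Prop}

/-- Progress along a walk through nodes of bounded rank takes a proportional number of steps. -/
theorem JumpWalk.dist_le (hQ : 15 < Q) (G : ShellGeometry Q dist nd rank inner) (j : ℕ) :
    ∀ {a b : X} {ns : List ν} {l : ℕ}, JumpWalk dist nd a b ns l →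
      (∀ n ∈ ns, inner n ∧ rank n ≤ j) → ns.Nodup → dist a b ≤ 3 ^ j * l + slack Q j := by
  induction j with
  | zero =>
    intro a b ns l h
    induction h with
    | step h => intro _ _; simpa [slack] using h
    | @cons a b c e ns l h₁ h₂ h₃ ih =>
      intro hr hn
      have h4 := ih (fun n hn => hr n (by simp [hn])) (by simp at hn; exact hn.2)
      have h5 := hr (nd c) (by simp)
      have h6 := G.point b c (h₂ ▸ h5.1) (by rw [h₂]; omega) h₂
      have h7 := G.triangle a b e
      have h8 := G.triangle b c e
      push_cast
      simp only [pow_zero, slack] at *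
      omega
  | succ j ih =>
    have hs := slack_lt hQ j
    -- For a walk that starts on a node of rank `j + 1`, each further jump of this rank is paid by
    -- the segment before it, through the passage from `3^j` to `3^(j+1)`. The slack thus stays that
    -- of rank `j`, however many jumps follow. The auxiliary `k` allows induction on the remainder
    -- after a cut.
    have key : ∀ (k : ℕ) {a b : X} {ns : List ν} {l : ℕ}, ns.length ≤ k →
        JumpWalk dist nd a b ns l → (∀ n ∈ ns, inner n ∧ rank n ≤ j + 1) → ns.Nodup →
        inner (nd a) → rank (nd a) = j + 1 → nd a ∉ ns →
        dist a b ≤ 3 ^ (j + 1) * l + slack Q j := by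
      intro k
      induction k with
      | zero =>
        intro a b ns l hk h hr hn _ _ _
        obtain rfl : ns = [] := List.eq_nil_of_length_eq_zero (by omega)
        have h1 := ih h (by simp) (by simp)
        have h2 : (3 : ℤ) ^ j * l ≤ 3 ^ (j + 1) * l := by
          rw [pow_succ]; nlinarith [show (0 : ℤ) ≤ 3 ^ j * l by positivity]
        omega
      | succ k ihk =>
        intro a b ns l hk h hr hn hia hra hna
        have h2 : ∀ l : ℕ, (3 : ℤ) ^ (j + 1) * l = 3 * (3 ^ j * l) := fun l => by ring
        have h3 : ∀ l : ℕ, (0 : ℤ) ≤ 3 ^ j * l := fun l => by positivity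
        rcases list_forall_not_or_split (fun n => rank n = j + 1) ns with
          h' | ⟨ns₁, n, ns₂, rfl, h', hx⟩
        · have h1 := ih h (fun n hn => ⟨(hr n hn).1, by
            have := (hr n hn).2; have := h' n hn; omega⟩) hn
          have := h2 l
          have := h3 l
          omega
        · obtain ⟨c, c', l₁, l₂, k₁, k₂, k₃, k₄, rfl⟩ := h.split
          rw [List.nodup_append] at hn
          obtain ⟨hn₁, hn₂, hn₃⟩ := hn
          rw [List.nodup_cons] at hn₂
          simp only [List.length_append, List.length_cons] at hk
          have hin : inner n := (hr n (by simp)).1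
          have h1 := ih k₁ (fun y hy => ⟨(hr y (by simp [hy])).1, by
            have := (hr y (by simp [hy])).2; have := h' y hy; omega⟩) hn₁
          have h4 := ihk (by omega) k₄ (fun y hy => hr y (by simp [hy])) hn₂.2
            (k₃ ▸ hin) (k₃ ▸ hx) (k₃ ▸ hn₂.1)
          -- The visited nodes are distinct, so separation applies and forces `l₁` to be large.
          have h5 := G.sep a c j hia (k₂ ▸ hin) hra.ge (k₂ ▸ hx.ge) (by
            rw [k₂]; rintro rfl; simp at hna)
          have h6 := G.diam c c' j (k₂ ▸ hin) (k₂ ▸ hx) (k₂.trans k₃.symm)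
          have h7 := G.triangle a c b
          have h8 := G.triangle c c' b
          have e1 := h2 l₁
          have e2 : (3 : ℤ) ^ (j + 1) * ((l₁ + l₂ : ℕ) : ℤ) =
            3 ^ (j + 1) * l₁ + 3 ^ (j + 1) * l₂ := by push_cast; ring
          omega
    intro a b ns l h hr hn
    have h2 : ∀ l : ℕ, (3 : ℤ) ^ (j + 1) * l = 3 * (3 ^ j * l) := fun l => by ring
    have h3 : ∀ l : ℕ, (0 : ℤ) ≤ 3 ^ j * l := fun l => by positivity
    have hs' : slack Q (j + 1) = 2 * (Q : ℤ) ^ j := rfl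
    -- The first jump of rank `j + 1` has no segment that pays for it; it is the reason why the
    -- slack grows to `2 * Q^j`.
    rcases list_forall_not_or_split (fun n => rank n = j + 1) ns with
      h' | ⟨ns₁, n, ns₂, rfl, h', hx⟩
    · have h1 := ih h (fun n hn => ⟨(hr n hn).1, by
        have := (hr n hn).2; have := h' n hn; omega⟩) hn
      have := h2 l
      have := h3 l
      have := slack_nonneg Q j
      omega
    · obtain ⟨c, c', l₁, l₂, k₁, k₂, k₃, k₄, rfl⟩ := h.split
      rw [List.nodup_append] at hn
      obtain ⟨hn₁, hn₂, hn₃⟩ := hn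
      rw [List.nodup_cons] at hn₂
      have hin : inner n := (hr n (by simp)).1
      have h1 := ih k₁ (fun y hy => ⟨(hr y (by simp [hy])).1, by
        have := (hr y (by simp [hy])).2; have := h' y hy; omega⟩) hn₁
      have h4 := key _ le_rfl k₄ (fun y hy => hr y (by simp [hy])) hn₂.2
        (k₃ ▸ hin) (k₃ ▸ hx) (k₃ ▸ hn₂.1)
      have h6 := G.diam c c' j (k₂ ▸ hin) (k₂ ▸ hx) (k₂.trans k₃.symm)
      have h7 := G.triangle a c b
      have h8 := G.triangle c c' b
      have e1 := h2 l₁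
      have e3 := h3 l₁
      have e2 : (3 : ℤ) ^ (j + 1) * ((l₁ + l₂ : ℕ) : ℤ) =
        3 ^ (j + 1) * l₁ + 3 ^ (j + 1) * l₂ := by push_cast; ring
      have := slack_nonneg Q j
      omega

/-- The number of nodes of large rank on a walk is small compared with the number of steps. -/
theorem JumpWalk.countP_le (hQ : 15 < Q) (G : ShellGeometry Q dist nd rank inner) (j : ℕ)
    {a b : X} {ns : List ν} {l : ℕ} (h : JumpWalk dist nd a b ns l)
    (hi : ∀ n ∈ ns, inner n) (hn : ns.Nodup) :
    ((ns.countP fun n => j + 1 ≤ rank n : ℕ) : ℤ) * ((Q : ℤ) ^ j - slack Q j) ≤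
      3 ^ j * l + ((Q : ℤ) ^ j - slack Q j) := by
  have hs := slack_lt hQ j
  have hs0 := slack_nonneg Q j
  -- Behind a node of large rank, each further one costs a segment with `3^j * l₁ ≥ Q^j - slack Q
  -- j`. The first one on the walk is free and becomes the additive term of the claim.
  have key : ∀ (k : ℕ) {a b : X} {ns : List ν} {l : ℕ}, ns.length ≤ k →
      JumpWalk dist nd a b ns l → (∀ n ∈ ns, inner n) → ns.Nodup →
      inner (nd a) → j + 1 ≤ rank (nd a) → nd a ∉ ns →
      ((ns.countP fun n => j + 1 ≤ rank n : ℕ) : ℤ) * ((Q : ℤ) ^ j - slack Q j) ≤ 3 ^ j * l := by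
    intro k
    induction k with
    | zero =>
      intro a b ns l hk h hr hn _ _ _
      obtain rfl : ns = [] := List.eq_nil_of_length_eq_zero (by omega)
      simp only [List.countP_nil, Nat.cast_zero, zero_mul]
      positivity
    | succ k ihk =>
      intro a b ns l hk h hr hn hia hra hna
      rcases list_forall_not_or_split (fun n => j + 1 ≤ rank n) ns with
        h' | ⟨ns₁, n, ns₂, rfl, h', hx⟩
      · rw [List.countP_eq_zero.2 (by simpa using h')]
        simp only [Nat.cast_zero, zero_mul]
        positivity
      · obtain ⟨c, c', l₁, l₂, k₁, k₂, k₃, k₄, rfl⟩ := h.split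
        rw [List.nodup_append] at hn
        obtain ⟨hn₁, hn₂, hn₃⟩ := hn
        rw [List.nodup_cons] at hn₂
        simp only [List.length_append, List.length_cons] at hk
        have hin : inner n := hr n (by simp)
        have h1 := JumpWalk.dist_le hQ G j k₁ (fun y hy => ⟨hr y (by simp [hy]), by
          have := h' y hy; omega⟩) hn₁
        have h4 := ihk (by omega) k₄ (fun y hy => hr y (by simp [hy])) hn₂.2
          (k₃ ▸ hin) (k₃ ▸ hx) (k₃ ▸ hn₂.1)
        have h5 := G.sep a c j hia (k₂ ▸ hin) hra (k₂ ▸ hx) (by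
          rw [k₂]; rintro rfl; simp at hna)
        rw [List.countP_append, List.countP_cons_of_pos (by simpa using hx),
          List.countP_eq_zero.2 (by simpa using h')]
        push_cast
        linarith
  rcases list_forall_not_or_split (fun n => j + 1 ≤ rank n) ns with
    h' | ⟨ns₁, n, ns₂, rfl, h', hx⟩
  · rw [List.countP_eq_zero.2 (by simpa using h')]
    have : (0 : ℤ) ≤ 3 ^ j * l := by positivity
    simp only [Nat.cast_zero, zero_mul]
    omega
  · obtain ⟨c, c', l₁, l₂, k₁, k₂, k₃, k₄, rfl⟩ := h.split
    rw [List.nodup_append] at hn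
    obtain ⟨hn₁, hn₂, hn₃⟩ := hn
    rw [List.nodup_cons] at hn₂
    have hin : inner n := hi n (by simp)
    have h4 := key _ le_rfl k₄ (fun y hy => hi y (by simp [hy])) hn₂.2
      (k₃ ▸ hin) (k₃ ▸ hx) (k₃ ▸ hn₂.1)
    rw [List.countP_append, List.countP_cons_of_pos (by simpa using hx),
      List.countP_eq_zero.2 (by simpa using h')]
    have : (0 : ℤ) ≤ 3 ^ j * l₁ := by positivity
    push_cast
    linarith

end JumpWalk

/-! ## Trails in a multigraph with edge set `C` and end points `s` -/

section Trail

variable {β ν : Type*} (s : β → Bool → ν)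

open Classical in
/-- The parity of the degree of a node. -/
def nodeDeg (C : Finset β) (n : ν) : ZMod 2 :=
  ∑ f ∈ C, ((if s f false = n then 1 else 0) + (if s f true = n then 1 else 0))

/-- A list of directed edges leads from `a` to `b`. -/
def IsTrail : ν → List (β × Bool) → ν → Prop
  | a, [], b => a = b
  | a, δ :: γ, b => s δ.1 δ.2 = a ∧ IsTrail (s δ.1 (!δ.2)) γ b

/-- The node where a directed edge starts. -/
def dartSrc (δ : β × Bool) : ν := s δ.1 δ.2

variable {s}

/-- Handshake identity: after exchanging the sums over edges and nodes, each label is multiplied by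
the degree of its node, and only `lo` and `hi` survive. -/
lemma sum_ends_eq {C : Finset β} {lo hi : ν} (hne : lo ≠ hi)
    (hdeg : ∀ n, n ≠ lo → n ≠ hi → nodeDeg s C n = 0) (u : ν → ZMod 2) :
    ∑ f ∈ C, (u (s f false) + u (s f true)) = u lo * nodeDeg s C lo + u hi * nodeDeg s C hi := by
  classical
  set N : Finset ν := C.image (fun f => s f false) ∪ C.image (fun f => s f true) ∪ {lo, hi} with hN
  have h1 : ∑ f ∈ C, (u (s f false) + u (s f true)) = ∑ n ∈ N, u n * nodeDeg s C n := by
    simp only [nodeDeg, Finset.mul_sum]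
    rw [Finset.sum_comm]
    refine Finset.sum_congr rfl fun f hf => ?_
    have m1 : s f false ∈ N := by
      simp only [hN, Finset.mem_union, Finset.mem_image]
      exact .inl (.inl ⟨f, hf, rfl⟩)
    have m2 : s f true ∈ N := by
      simp only [hN, Finset.mem_union, Finset.mem_image]
      exact .inl (.inr ⟨f, hf, rfl⟩)
    simp only [mul_add, Finset.sum_add_distrib, mul_ite, mul_one, mul_zero, Finset.sum_ite_eq,
      m1, m2, if_true]
  rw [h1, ← Finset.sum_subset (show ({lo, hi} : Finset ν) ⊆ N from Finset.subset_union_right)]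
  · rw [Finset.sum_pair hne]
  · intro n _ hn
    simp only [Finset.mem_insert, Finset.mem_singleton, not_or] at hn
    rw [hdeg n hn.1 hn.2, mul_zero]

/-- An edge set whose boundary separates two nodes contains a simple trail that joins them. -/
theorem exists_trail {C : Finset β} {lo hi : ν} (hne : lo ≠ hi)
    (hdeg : ∀ n, n ≠ lo → n ≠ hi → nodeDeg s C n = 0) (u : ν → ZMod 2)
    (hu : ∑ f ∈ C, (u (s f false) + u (s f true)) ≠ 0) :
    ∃ γ, IsTrail s lo γ hi ∧ (γ.map (dartSrc s) ++ [hi]).Nodup ∧ ∀ δ ∈ γ, δ.1 ∈ C := by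
  classical
  let G : SimpleGraph ν := SimpleGraph.fromRel fun a b => ∃ f ∈ C, s f false = a ∧ s f true = b
  have hG : ∀ f ∈ C, G.Reachable (s f false) (s f true) := by
    intro f hf
    by_cases h : s f false = s f true
    · rw [h]
    · exact SimpleGraph.Adj.reachable (by
        rw [SimpleGraph.fromRel_adj]; exact ⟨h, .inl ⟨f, hf, rfl, rfl⟩⟩)
  have hreach : G.Reachable lo hi := by
    by_contra hcon
    apply hu
    -- Labels that are constant along edges give zero in the handshake identity. If `hi` were
    -- unreachable, the indicator of the component of `lo` would make the degree of `lo` even, then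
    -- the constant label 1 that of `hi`, and the sum in `hu` would vanish.
    have key : ∀ v : ν → ZMod 2, (∀ f ∈ C, v (s f false) = v (s f true)) →
        v lo * nodeDeg s C lo + v hi * nodeDeg s C hi = 0 := by
      intro v hv
      rw [← sum_ends_eq hne hdeg v]
      exact Finset.sum_eq_zero fun f hf => by rw [hv f hf]; exact CharTwo.add_self_eq_zero _
    have h1 := key (fun n => if G.Reachable lo n then 1 else 0) (fun f hf => by
      have : G.Reachable lo (s f false) ↔ G.Reachable lo (s f true) :=
        ⟨fun h => h.trans (hG f hf), fun h => h.trans (hG f hf).symm⟩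
      simp only [this])
    have h2 := key (fun _ => 1) (fun _ _ => rfl)
    simp only [hcon, if_false, zero_mul, add_zero, SimpleGraph.Reachable.refl, if_true,
      one_mul] at h1 h2
    rw [h1, zero_add] at h2
    rw [sum_ends_eq hne hdeg u, h1, h2]
    simp
  have hwalk : ∀ {a b : ν} (p : G.Walk a b), ∃ γ, IsTrail s a γ b ∧
      γ.map (dartSrc s) ++ [b] = p.support ∧ ∀ δ ∈ γ, δ.1 ∈ C := by
    intro a b p
    induction p with
    | nil => exact ⟨[], rfl, by simp, by simp⟩
    | @cons a c b h p ih =>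
      obtain ⟨γ, h1, h2, h3⟩ := ih
      rw [SimpleGraph.fromRel_adj] at h
      obtain ⟨-, ⟨f, hf, h4, h5⟩ | ⟨f, hf, h4, h5⟩⟩ := h
      · exact ⟨(f, false) :: γ, ⟨h4, by simpa [h5] using h1⟩, by simp [dartSrc, h4, ← h2],
          by simpa [hf] using h3⟩
      · exact ⟨(f, true) :: γ, ⟨h5, by simpa [h4] using h1⟩, by simp [dartSrc, h5, ← h2],
          by simpa [hf] using h3⟩
  obtain ⟨γ, h1, h2, h3⟩ := hwalk hreach.some.toPath.1
  exact ⟨γ, h1, by rw [h2]; exact hreach.some.toPath.2.support_nodup, h3⟩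

/-- Needed for `IsTrail.nodup_fst`: if an edge recurred, the node where its first use starts would
be visited again. -/
lemma IsTrail.ends_mem : ∀ {γ : List (β × Bool)} {a b : ν}, IsTrail s a γ b → ∀ δ ∈ γ, ∀ c : Bool,
    s δ.1 c ∈ γ.map (dartSrc s) ++ [b]
  | δ :: γ, a, b, h, δ', hδ, c => by
    have h0 : s δ.1 (!δ.2) ∈ γ.map (dartSrc s) ++ [b] := by
      cases γ with
      | nil => have h' := h.2; simp only [IsTrail] at h'; simp [h']
      | cons δ₁ γ => have h' := h.2.1; simp [dartSrc, h']
    rcases List.mem_cons.1 hδ with rfl | hδ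
    · by_cases hc : c = δ'.2
      · subst hc; simp [dartSrc]
      · obtain rfl : c = !δ'.2 := by revert hc; cases c <;> cases δ'.2 <;> simp
        rw [List.map_cons, List.cons_append]
        exact List.mem_cons_of_mem _ h0
    · rw [List.map_cons, List.cons_append]
      exact List.mem_cons_of_mem _ (IsTrail.ends_mem h.2 δ' hδ c)

/-- A simple trail uses every edge at most once. -/
lemma IsTrail.nodup_fst : ∀ {γ : List (β × Bool)} {a b : ν}, IsTrail s a γ b →
    (γ.map (dartSrc s) ++ [b]).Nodup → (γ.map Prod.fst).Nodup
  | [], _, _, _, _ => by simp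
  | δ :: γ, a, b, h, hn => by
    rw [List.map_cons, List.cons_append, List.nodup_cons] at hn
    rw [List.map_cons, List.nodup_cons]
    refine ⟨fun hmem => hn.1 ?_, IsTrail.nodup_fst h.2 hn.2⟩
    obtain ⟨δ', h1, h2⟩ := List.mem_map.1 hmem
    have := IsTrail.ends_mem h.2 δ' h1 δ.2
    rwa [h2] at this

/-- The boundary of a simple trail consists of its two end points. -/
lemma IsTrail.nodeDeg_eq_zero [DecidableEq β] {γ : List (β × Bool)} {a b : ν} (h : IsTrail s a γ b)
    (hn : (γ.map (dartSrc s) ++ [b]).Nodup) {n : ν} (ha : n ≠ a) (hb : n ≠ b) :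
    nodeDeg s (γ.map Prod.fst).toFinset n = 0 := by
  classical
  rw [nodeDeg, List.sum_toFinset _ (h.nodup_fst hn), List.map_map]
  have key : ∀ (γ : List (β × Bool)) (a b : ν), IsTrail s a γ b →
      (γ.map ((fun f => ((if s f false = n then 1 else 0) + (if s f true = n then 1 else 0) :
        ZMod 2)) ∘ Prod.fst)).sum = (if a = n then 1 else 0) + (if b = n then 1 else 0) := by
    intro γ
    induction γ with
    | nil =>
      intro a b h
      obtain rfl : a = b := h
      simp [CharTwo.add_self_eq_zero]
    | cons δ γ ih =>
      intro a b h
      rw [List.map_cons, List.sum_cons, ih _ _ h.2, ← h.1]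
      obtain ⟨f, c⟩ := δ
      cases c <;> simp only [Function.comp, Bool.not_false, Bool.not_true]
      · generalize (if s f false = n then (1 : ZMod 2) else 0) = x
        generalize (if s f true = n then (1 : ZMod 2) else 0) = y
        rw [add_assoc, ← add_assoc y y, CharTwo.add_self_eq_zero, zero_add]
      · generalize (if s f false = n then (1 : ZMod 2) else 0) = x
        generalize (if s f true = n then (1 : ZMod 2) else 0) = y
        rw [add_comm x y, add_assoc, ← add_assoc x x, CharTwo.add_self_eq_zero, zero_add]
  rw [key γ a b h, if_neg ha.symm, if_neg hb.symm, add_zero]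

/-- Trails in a multigraph whose nodes are represented by points of a space are walks there. -/
lemma IsTrail.jumpWalk {X : Type*} {dist : X → X → ℤ} {nd : X → ν} {p : β → Bool → X}
    (hs : ∀ f c, s f c = nd (p f c)) (hp : ∀ f c, dist (p f c) (p f (!c)) ≤ 1) :
    ∀ {γ : List (β × Bool)} {δ : β × Bool} {a b : ν}, IsTrail s a (δ :: γ) b →
      ∃ y, nd y = b ∧ JumpWalk dist nd (p δ.1 δ.2) y (γ.map (dartSrc s)) (γ.length + 1)
  | [], δ, a, b, h => ⟨p δ.1 (!δ.2), (hs _ _).symm.trans h.2, .step (hp _ _)⟩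
  | δ' :: γ, δ, a, b, h => by
    obtain ⟨y, hy, hw⟩ := IsTrail.jumpWalk hs hp h.2
    refine ⟨y, hy, ?_⟩
    have h1 : nd (p δ.1 (!δ.2)) = nd (p δ'.1 δ'.2) := by
      rw [← hs, ← hs]; exact h.2.1.symm
    have := JumpWalk.cons (hp δ.1 δ.2) h1 hw
    rwa [List.map_cons, dartSrc, hs]

/-! ## Counting trails -/

open Classical in
/-- The trails of given length that start at a node and use edges of `C`. -/
def trailsFrom (s : β → Bool → ν) (C : Finset β) : ℕ → ν → Finset (List (β × Bool))
  | 0, _ => {[]}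
  | l + 1, n => ((C ×ˢ Finset.univ).filter fun δ => dartSrc s δ = n).biUnion
      fun δ => (trailsFrom s C l (s δ.1 (!δ.2))).image (List.cons δ)

lemma mem_trailsFrom {C : Finset β} : ∀ {γ : List (β × Bool)} {a b : ν}, IsTrail s a γ b →
    (∀ δ ∈ γ, δ.1 ∈ C) → γ ∈ trailsFrom s C γ.length a
  | [], _, _, _, _ => by simp [trailsFrom]
  | δ :: γ, a, b, h, hC => by
    simp only [List.length_cons, trailsFrom, Finset.mem_biUnion, Finset.mem_filter,
      Finset.mem_product, Finset.mem_univ, and_true, Finset.mem_image]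
    exact ⟨δ, ⟨hC δ (by simp), h.1⟩, γ, mem_trailsFrom h.2 (fun δ' h' => hC δ' (by simp [h'])), rfl⟩

open Classical in
/-- The random walk that leaves a node along one of at most `w n` directed edges, chosen uniformly,
has total probability at most one. -/
lemma sum_trailsFrom_le {C : Finset β} {w : ν → ℝ} (hw : ∀ n, 0 < w n)
    (hcard : ∀ n, ((((C ×ˢ Finset.univ).filter fun δ => dartSrc s δ = n).card : ℕ) : ℝ) ≤ w n)
    (l : ℕ) : ∀ n : ν, ∑ γ ∈ trailsFrom s C l n, (γ.map fun δ => (w (dartSrc s δ))⁻¹).prod ≤ 1 := by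
  induction l with
  | zero => intro n; simp [trailsFrom]
  | succ l ih =>
    intro n
    rw [trailsFrom, Finset.sum_biUnion]
    · calc _ ≤ ∑ δ ∈ (C ×ˢ Finset.univ).filter fun δ => dartSrc s δ = n, (w n)⁻¹ := by
            refine Finset.sum_le_sum fun δ hδ => ?_
            rw [Finset.sum_image (fun a _ b _ h => List.cons_injective h)]
            simp only [List.map_cons, List.prod_cons]
            rw [← Finset.mul_sum, (Finset.mem_filter.1 hδ).2]
            exact mul_le_of_le_one_right (inv_nonneg.2 (hw n).le) (ih _)
        _ ≤ 1 := by
            rw [Finset.sum_const, nsmul_eq_mul, ← div_eq_mul_inv]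
            exact (div_le_one (hw n)).2 (hcard n)
    · intro δ _ δ' _ hne
      rw [Function.onFun, Finset.disjoint_left]
      rintro _ h h'
      obtain ⟨γ, -, rfl⟩ := Finset.mem_image.1 h
      obtain ⟨γ', -, h''⟩ := Finset.mem_image.1 h'
      exact hne (List.cons.inj h'').1.symm

end Trail

/-! ## Probabilities of error patterns -/

section Probability

variable {β : Type*}

/-- The probability that exactly the errors in `E` occur, among `N` possible ones. -/
def patternProb (ε : ℝ) (N : ℕ) (E : Finset β) : ℝ := ε ^ E.card * (1 - ε) ^ (N - E.card)

lemma patternProb_nonneg {ε : ℝ} (h0 : 0 ≤ ε) (h1 : ε ≤ 1) (N : ℕ) (E : Finset β) :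
    0 ≤ patternProb ε N E :=
  mul_nonneg (pow_nonneg h0 _) (pow_nonneg (sub_nonneg.2 h1) _)

variable [DecidableEq β]

/-- The errors outside `S` are unconstrained, and by the binomial theorem their probabilities add up
to one. -/
lemma sum_patternProb_superset (ε : ℝ) {Φ S : Finset β} (hS : S ⊆ Φ) :
    ∑ E ∈ Φ.powerset.filter (S ⊆ ·), patternProb ε Φ.card E = ε ^ S.card := by
  have h := Finset.sum_pow_mul_eq_add_pow ε (1 - ε) (Φ \ S)
  rw [add_sub_cancel, one_pow] at h
  rw [← mul_one (ε ^ S.card), ← h, Finset.mul_sum]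
  refine Finset.sum_nbij' (fun E => E \ S) (fun T => S ∪ T) ?_ ?_ ?_ ?_ ?_
  · intro E hE
    rw [Finset.mem_filter, Finset.mem_powerset] at hE
    exact Finset.mem_powerset.2 (Finset.sdiff_subset_sdiff hE.1 subset_rfl)
  · intro T hT
    rw [Finset.mem_powerset] at hT
    rw [Finset.mem_filter, Finset.mem_powerset]
    exact ⟨Finset.union_subset hS (hT.trans Finset.sdiff_subset), Finset.subset_union_left⟩
  · intro E hE
    rw [Finset.mem_filter] at hE
    exact Finset.union_sdiff_of_subset hE.2
  · intro T hT
    rw [Finset.mem_powerset] at hT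
    rw [Finset.union_sdiff_left]
    exact Finset.sdiff_eq_self_of_disjoint (Finset.disjoint_of_subset_left hT Finset.sdiff_disjoint)
  · intro E hE
    rw [Finset.mem_filter, Finset.mem_powerset] at hE
    have h1 := Finset.card_sdiff_add_card_eq_card hE.2
    have h2 := Finset.card_sdiff_add_card_eq_card hS
    have h3 := Finset.card_le_card hE.1
    rw [patternProb, ← h1, pow_add, show Φ.card - ((E \ S).card + S.card) =
      (Φ \ S).card - (E \ S).card by omega]
    ring

/-- The probability that at least half of the errors in `P` occur. -/
lemma sum_patternProb_half_le {ε : ℝ} (h0 : 0 ≤ ε) (h1 : ε ≤ 1) {Φ P : Finset β} (hP : P ⊆ Φ) :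
    ∑ E ∈ Φ.powerset.filter (fun E => P.card ≤ 2 * (E ∩ P).card), patternProb ε Φ.card E ≤
      (2 * √ε) ^ P.card := by
  have hs0 := Real.sqrt_nonneg ε
  have hs1 : √ε ≤ 1 := Real.sqrt_le_one.2 h1
  calc _ ≤ ∑ E ∈ Φ.powerset, ∑ S ∈ P.powerset.filter (fun S => P.card ≤ 2 * S.card),
        if S ⊆ E then patternProb ε Φ.card E else 0 := by
        rw [Finset.sum_filter]
        refine Finset.sum_le_sum fun E _ => ?_
        have hnn : ∀ S : Finset β, 0 ≤ if S ⊆ E then patternProb ε Φ.card E else 0 := fun S => by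
          split_ifs
          · exact patternProb_nonneg h0 h1 _ _
          · exact le_rfl
        split_ifs with hE
        · refine le_trans (le_of_eq ?_) (Finset.single_le_sum (fun S _ => hnn S)
            (Finset.mem_filter.2 ⟨Finset.mem_powerset.2 (Finset.inter_subset_right (s₁ := E)), hE⟩))
          rw [if_pos Finset.inter_subset_left]
        · exact Finset.sum_nonneg fun S _ => hnn S
    _ = ∑ S ∈ P.powerset.filter (fun S => P.card ≤ 2 * S.card), ε ^ S.card := by
        rw [Finset.sum_comm]
        refine Finset.sum_congr rfl fun S hS => ?_
        rw [Finset.mem_filter, Finset.mem_powerset] at hS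
        rw [← sum_patternProb_superset ε (hS.1.trans hP), Finset.sum_filter]
    -- Each admissible `S` has at least half the size of `P`, hence probability at most `√ε ^
    -- P.card`; the number of subsets then supplies the factor 2 per edge.
    _ ≤ ∑ S ∈ P.powerset.filter (fun S => P.card ≤ 2 * S.card), √ε ^ P.card := by
        refine Finset.sum_le_sum fun S hS => ?_
        rw [Finset.mem_filter] at hS
        calc ε ^ S.card = √ε ^ (2 * S.card) := by rw [pow_mul, Real.sq_sqrt h0]
          _ ≤ _ := pow_le_pow_of_le_one hs0 hs1 hS.2
    _ ≤ ∑ S ∈ P.powerset, √ε ^ P.card :=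
        Finset.sum_le_sum_of_subset_of_nonneg (Finset.filter_subset _ _)
          fun _ _ _ => pow_nonneg hs0 _
    _ = _ := by
        rw [Finset.sum_const, Finset.card_powerset, nsmul_eq_mul, mul_pow]
        push_cast
        rfl

open Classical in
/-- Union bound over trails: if every error in `F` contains at least half of a long trail, and the
trails are controlled by the weights `w`, then `F` has small probability. -/
theorem sum_patternProb_le_of_trails {ν : Type*} {s : β → Bool → ν} {ε x B K : ℝ} {ℓ₀ : ℕ}
    (h0 : 0 ≤ ε) (h1 : ε ≤ 1) {Φ C : Finset β} (hC : C ⊆ Φ) {F : Finset (Finset β)}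
    (hF : F ⊆ Φ.powerset) {w : ν → ℝ} (hw : ∀ n, 0 < w n)
    (hcard : ∀ n, ((((C ×ˢ Finset.univ).filter fun δ => dartSrc s δ = n).card : ℕ) : ℝ) ≤ w n)
    (hB : 0 ≤ B) (hK : 0 ≤ K) (hx : K * (2 * √ε) ≤ x) (hx1 : x ≤ 1) {lo hi : ν}
    (h : ∀ E ∈ F, ∃ γ, IsTrail s lo γ hi ∧ (γ.map (dartSrc s) ++ [hi]).Nodup ∧
      (∀ δ ∈ γ, δ.1 ∈ C) ∧ γ.length ≤ 2 * (E ∩ (γ.map Prod.fst).toFinset).card ∧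
      ℓ₀ ≤ γ.length ∧ (γ.map fun δ => w (dartSrc s δ)).prod ≤ B * K ^ γ.length) :
    ∑ E ∈ F, patternProb ε Φ.card E ≤ (Φ.card + 1) * (B * x ^ ℓ₀) := by
  have hs0 := Real.sqrt_nonneg ε
  have hx0 : 0 ≤ x := le_trans (by positivity) hx
  let good : List (β × Bool) → Prop := fun γ =>
    (γ.map Prod.fst).Nodup ∧ (∀ δ ∈ γ, δ.1 ∈ C) ∧ ℓ₀ ≤ γ.length ∧
      (γ.map fun δ => w (dartSrc s δ)).prod ≤ B * K ^ γ.length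
  have hlen : ∀ (l : ℕ) (n : ν), ∀ γ ∈ trailsFrom s C l n, γ.length = l := by
    intro l
    induction l with
    | zero => intro n γ hγ; simp only [trailsFrom, Finset.mem_singleton] at hγ; simp [hγ]
    | succ l ih =>
      intro n γ hγ
      simp only [trailsFrom, Finset.mem_biUnion, Finset.mem_image] at hγ
      obtain ⟨δ, -, γ', h', rfl⟩ := hγ
      simp [ih _ _ h']
  have hcardP : ∀ γ : List (β × Bool), (γ.map Prod.fst).Nodup →
      (γ.map Prod.fst).toFinset.card = γ.length := fun γ hγ => by
    rw [List.toFinset_card_of_nodup hγ, List.length_map]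
  let H : List (β × Bool) → Finset β → ℝ := fun γ E =>
    if γ.length ≤ 2 * (E ∩ (γ.map Prod.fst).toFinset).card then patternProb ε Φ.card E else 0
  have hH : ∀ γ E, 0 ≤ H γ E := fun γ E => by
    simp only [H]
    split_ifs
    · exact patternProb_nonneg h0 h1 _ _
    · exact le_rfl
  -- At fixed length, the bound on the product of the weights turns `(2√ε)^l` into the random-walk
  -- probability of the trail times at most `B * x^l`. These probabilities add up to at most one, so
  -- trails need not be counted separately.
  have hsum : ∀ l, ∑ γ ∈ (trailsFrom s C l lo).filter good, ∑ E ∈ Φ.powerset, H γ E ≤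
      B * x ^ ℓ₀ := by
    intro l
    by_cases hl : ℓ₀ ≤ l
    · calc _ ≤ ∑ γ ∈ (trailsFrom s C l lo).filter good,
            (γ.map fun δ => (w (dartSrc s δ))⁻¹).prod * (B * x ^ ℓ₀) := by
            refine Finset.sum_le_sum fun γ hγ => ?_
            rw [Finset.mem_filter] at hγ
            obtain ⟨hγ, g1, g2, g3, g4⟩ := hγ
            have hl' := hlen _ _ _ hγ
            have hPsub : (γ.map Prod.fst).toFinset ⊆ Φ := by
              intro f hf
              simp only [List.mem_toFinset, List.mem_map] at hf
              obtain ⟨δ, h', rfl⟩ := hf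
              exact hC (g2 δ h')
            have h3 := sum_patternProb_half_le h0 h1 hPsub
            rw [hcardP γ g1, Finset.sum_filter] at h3
            refine h3.trans ?_
            have hwpos : 0 < (γ.map fun δ => w (dartSrc s δ)).prod := by
              apply List.prod_pos
              intro a ha
              obtain ⟨δ, -, rfl⟩ := List.mem_map.1 ha
              exact hw _
            have hinv : (γ.map fun δ => (w (dartSrc s δ))⁻¹).prod =
                ((γ.map fun δ => w (dartSrc s δ)).prod)⁻¹ := by
              rw [List.prod_inv, List.map_map]; rfl
            rw [hinv, inv_mul_eq_div, le_div_iff₀ hwpos]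
            calc (2 * √ε) ^ γ.length * (γ.map fun δ => w (dartSrc s δ)).prod
                ≤ (2 * √ε) ^ γ.length * (B * K ^ γ.length) :=
                  mul_le_mul_of_nonneg_left g4 (by positivity)
              _ = B * (K * (2 * √ε)) ^ γ.length := by rw [mul_pow]; ring
              _ ≤ B * x ^ γ.length :=
                  mul_le_mul_of_nonneg_left (pow_le_pow_left₀ (by positivity) hx _) hB
              _ ≤ B * x ^ ℓ₀ :=
                  mul_le_mul_of_nonneg_left (pow_le_pow_of_le_one hx0 hx1 g3) hB
        _ ≤ ∑ γ ∈ trailsFrom s C l lo,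
            (γ.map fun δ => (w (dartSrc s δ))⁻¹).prod * (B * x ^ ℓ₀) := by
            refine Finset.sum_le_sum_of_subset_of_nonneg (Finset.filter_subset _ _)
              fun γ _ _ => mul_nonneg (List.prod_nonneg fun a ha => ?_) (by positivity)
            obtain ⟨δ, -, rfl⟩ := List.mem_map.1 ha
            exact inv_nonneg.2 (hw _).le
        _ ≤ 1 * (B * x ^ ℓ₀) := by
            rw [← Finset.sum_mul]
            exact mul_le_mul_of_nonneg_right (sum_trailsFrom_le hw hcard l lo) (by positivity)
        _ = _ := one_mul _
    · rw [Finset.filter_eq_empty_iff.2, Finset.sum_empty]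
      · positivity
      · intro γ hγ hg
        exact hl (hlen _ _ _ hγ ▸ hg.2.2.1)
  calc ∑ E ∈ F, patternProb ε Φ.card E
      ≤ ∑ E ∈ F, ∑ l ∈ Finset.range (Φ.card + 1),
          ∑ γ ∈ (trailsFrom s C l lo).filter good, H γ E := by
        refine Finset.sum_le_sum fun E hE => ?_
        obtain ⟨γ, t1, t2, t3, t4, t5, t6⟩ := h E hE
        have hnd := t1.nodup_fst t2
        have hlΦ : γ.length ≤ Φ.card := by
          rw [← hcardP γ hnd]
          refine Finset.card_le_card fun f hf => ?_
          simp only [List.mem_toFinset, List.mem_map] at hf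
          obtain ⟨δ, h', rfl⟩ := hf
          exact hC (t3 δ h')
        refine le_trans ?_ (Finset.single_le_sum (f := fun l =>
          ∑ γ ∈ (trailsFrom s C l lo).filter good, H γ E)
          (fun l _ => Finset.sum_nonneg fun γ _ => hH γ E)
          (Finset.mem_range.2 (Nat.lt_succ_of_le hlΦ)))
        refine le_trans (le_of_eq ?_) (Finset.single_le_sum (f := fun γ => H γ E)
          (fun γ _ => hH γ E) (Finset.mem_filter.2 ⟨mem_trailsFrom t1 t3, hnd, t3, t5, t6⟩))
        simp only [H, if_pos t4]
    _ ≤ ∑ E ∈ Φ.powerset, ∑ l ∈ Finset.range (Φ.card + 1),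
          ∑ γ ∈ (trailsFrom s C l lo).filter good, H γ E :=
        Finset.sum_le_sum_of_subset_of_nonneg hF fun E _ _ =>
          Finset.sum_nonneg fun l _ => Finset.sum_nonneg fun γ _ => hH γ E
    _ = ∑ l ∈ Finset.range (Φ.card + 1), ∑ γ ∈ (trailsFrom s C l lo).filter good,
          ∑ E ∈ Φ.powerset, H γ E := by
        rw [Finset.sum_comm]
        exact Finset.sum_congr rfl fun l _ => Finset.sum_comm
    _ ≤ ∑ l ∈ Finset.range (Φ.card + 1), B * x ^ ℓ₀ := Finset.sum_le_sum fun l _ => hsum l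
    _ = _ := by
        rw [Finset.sum_const, Finset.card_range, nsmul_eq_mul]
        push_cast
        rfl

end Probability

/-! ## Space-time cells and nodes of the decoding graphs -/

/-- A face (or a vertex) at a given time. -/
abbrev Cell := Site × ℕ

/-- The distance of space-time cells in the infinity norm. -/
def cellSep (a b : Cell) : ℤ := max (cellDist a.1 b.1) |(a.2 : ℤ) - b.2|

lemma cellSep_le_iff {a b : Cell} {r : ℤ} : cellSep a b ≤ r ↔
    (|a.1.1 - b.1.1| ≤ r ∧ |a.1.2 - b.1.2| ≤ r) ∧ |(a.2 : ℤ) - b.2| ≤ r := by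
  simp [cellSep, cellDist, and_assoc]

lemma cellDist_le_cellSep (a b : Cell) : cellDist a.1 b.1 ≤ cellSep a b := le_max_left _ _

lemma time_le_cellSep (a b : Cell) : |(a.2 : ℤ) - b.2| ≤ cellSep a b := le_max_right _ _

lemma cellSep_triangle (a b c : Cell) : cellSep a c ≤ cellSep a b + cellSep b c := by
  obtain ⟨⟨h1, h2⟩, h3⟩ := cellSep_le_iff.1 (le_refl (cellSep a b))
  obtain ⟨⟨h4, h5⟩, h6⟩ := cellSep_le_iff.1 (le_refl (cellSep b c))
  rw [abs_le] at *
  refine cellSep_le_iff.2 ⟨⟨?_, ?_⟩, ?_⟩ <;> rw [abs_le] <;> omega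

/-- The end points of an edge, as a family. -/
def Qubit.endPt : Qubit → Bool → Site
  | .hor p, false => p
  | .hor p, true => (p.1 + 1, p.2)
  | .ver p, false => p
  | .ver p, true => (p.1, p.2 + 1)

/-- The two faces next to an edge. -/
def Qubit.sideFace : Qubit → Bool → Site
  | .hor p, false => p
  | .hor p, true => (p.1, p.2 - 1)
  | .ver p, false => p
  | .ver p, true => (p.1 - 1, p.2)

/-- Errors detected by plaquettes, which may end at smooth boundaries, and errors detected by stars,
which may end at rough boundaries. -/
def Fault.kind : Fault → Boundary
  | .bit _ _ => .smooth
  | .plaq _ _ => .smooth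
  | _ => .rough

/-- The two space-time cells whose detection events are changed by an elementary error. -/
def Fault.ends : Fault → Bool → Cell
  | .bit q t, c => (q.sideFace c, t)
  | .plaq w t, c => (w, bif c then t + 1 else t)
  | .phase q t, c => (q.endPt c, t)
  | .gauge q t, c => (q.endPt c, t)
  | .star v t, c => (v, bif c then t + 1 else t)

lemma Fault.cellSep_ends (f : Fault) (c : Bool) : cellSep (f.ends c) (f.ends (!c)) ≤ 1 := by
  rw [cellSep_le_iff]
  rcases f with q | q | w | v | q <;> (try rcases q with p | p) <;> cases c <;>
    simp [Fault.ends, Qubit.endPt, Qubit.sideFace]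

/-- The nodes of the decoding graphs: ordinary cells, shells, and the two opposite boundaries. -/
inductive Node (n : ℕ)
  | cell (c : Cell)
  | shell (i : Fin n) (k : ℕ)
  | lo
  | hi

/-- The nodes that are not boundaries. -/
def Node.Inner {n : ℕ} (a : Node n) : Prop := a ≠ .lo ∧ a ≠ .hi

lemma mem_square {p c : Site} {s : ℕ} : p ∈ square c s ↔
    (c.1 ≤ p.1 ∧ p.1 < c.1 + s) ∧ (c.2 ≤ p.2 ∧ p.2 < c.2 + s) := by
  simp [square]

namespace DefectArray

variable {Q d : ℕ} (A : DefectArray Q d)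

/-! ### Positions of the punctures -/

lemma one_le_side (i : Fin A.n) : 1 ≤ A.side i := by
  obtain ⟨p, hp⟩ := A.cluster_nonempty i
  have := mem_square.1 (A.cluster_subset i hp)
  omega

lemma corner_bounds (i : Fin A.n) : (0 ≤ (A.corner i).1 ∧ (A.corner i).1 + A.side i ≤ d) ∧
    (0 ≤ (A.corner i).2 ∧ (A.corner i).2 + A.side i ≤ d) := by
  have h := A.one_le_side i
  have h1 := mem_square.1 (A.square_subset i (mem_square.2
    (by simp; omega : ((A.corner i).1 ≤ (A.corner i).1 ∧ _) ∧ _)))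
  have h2 := mem_square.1 (A.square_subset i (mem_square (p := ((A.corner i).1 + A.side i - 1,
    (A.corner i).2 + A.side i - 1)).2 (by simp; omega)))
  simp only at h1 h2
  omega

lemma mem_hole {i : Fin A.n} {p : Site} : p ∈ A.hole i ↔
    ((A.corner i).1 ≤ p.1 ∧ p.1 ≤ (A.corner i).1 + A.side i) ∧
      ((A.corner i).2 ≤ p.2 ∧ p.2 ≤ (A.corner i).2 + A.side i) := by
  rw [hole, mem_square]
  push_cast
  omega

/-- The faces that touch a hole (for errors of smooth kind), or the vertices in it. -/
def region : Boundary → Fin A.n → Finset Site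
  | .smooth, i => square ((A.corner i).1 - 1, (A.corner i).2 - 1) (A.side i + 2)
  | .rough, i => A.hole i

lemma mem_region_smooth {i : Fin A.n} {p : Site} : p ∈ A.region .smooth i ↔
    ((A.corner i).1 - 1 ≤ p.1 ∧ p.1 ≤ (A.corner i).1 + A.side i) ∧
      ((A.corner i).2 - 1 ≤ p.2 ∧ p.2 ≤ (A.corner i).2 + A.side i) := by
  rw [region, mem_square]
  push_cast
  omega

lemma mem_region_rough {i : Fin A.n} {p : Site} : p ∈ A.region .rough i ↔
    ((A.corner i).1 ≤ p.1 ∧ p.1 ≤ (A.corner i).1 + A.side i) ∧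
      ((A.corner i).2 ≤ p.2 ∧ p.2 ≤ (A.corner i).2 + A.side i) := A.mem_hole

lemma region_subset (b : Boundary) (i : Fin A.n) : A.region b i ⊆ A.region .smooth i := by
  cases b
  · intro p
    rw [mem_region_smooth, mem_region_rough]
    omega
  · exact subset_rfl

lemma mem_faceCorners {w p : Site} : p ∈ faceCorners w ↔
    (p.1 = w.1 ∨ p.1 = w.1 + 1) ∧ (p.2 = w.2 ∨ p.2 = w.2 + 1) := by
  simp only [faceCorners, Finset.mem_insert, Finset.mem_singleton, Prod.ext_iff]
  omega

lemma mem_region_iff_touch {i : Fin A.n} {w : Site} :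
    w ∈ A.region .smooth i ↔ ∃ p ∈ faceCorners w, p ∈ A.hole i := by
  simp only [mem_region_smooth, mem_faceCorners, mem_hole]
  constructor
  · intro h
    refine ⟨(max w.1 (A.corner i).1, max w.2 (A.corner i).2), ?_, ?_⟩ <;> simp only <;> omega
  · rintro ⟨p, h, h'⟩
    omega

lemma card_region_le (b : Boundary) (i : Fin A.n) : (A.region b i).card ≤ (A.side i + 2) ^ 2 := by
  refine (Finset.card_le_card (A.region_subset b i)).trans (le_of_eq ?_)
  simp only [region, square, Finset.card_product, Int.card_Ico]
  rw [sq]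
  congr 1 <;> push_cast <;> omega

/-- At the smaller level `l`, `Q^(l+1) / 3 ≥ 16 Q^l / 3` because `Q ≥ 16`. Each region exceeds its
square by one unit on every side, so moving both points into the squares costs at most 2. -/
lemma cellDist_of_ne (hQ : 15 < Q) {i k : Fin A.n} (hik : i ≠ k) {j : ℕ} (hi : j ≤ A.level i)
    (hk : j ≤ A.level k) {v v' : Site} (hv : v ∈ A.region .smooth i)
    (hv' : v' ∈ A.region .smooth k) : (Q : ℤ) ^ j + 2 ≤ cellDist v v' := by
  wlog hle : A.level i ≤ A.level k generalizing i k v v'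
  · have := this hik.symm hk hi hv' hv (by omega)
    rwa [cellDist, abs_sub_comm v'.1, abs_sub_comm v'.2] at this
  have s1 := A.one_le_side i
  have s2 := A.one_le_side k
  rw [mem_region_smooth] at hv hv'
  have clamp : ∀ (c x : ℤ) (s : ℕ), 1 ≤ s → c - 1 ≤ x → x ≤ c + s →
      ∃ y, c ≤ y ∧ y < c + s ∧ |y - x| ≤ 1 := by
    intro c x s hs h1 h2
    by_cases h3 : x < c
    · exact ⟨c, by omega, by omega, by rw [abs_le]; omega⟩
    · by_cases h4 : x < c + s
      · exact ⟨x, by omega, by omega, by simp⟩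
      · exact ⟨x - 1, by omega, by omega, by simp⟩
  obtain ⟨a1, a2, a3, a4⟩ := clamp _ _ _ s1 hv.1.1 hv.1.2
  obtain ⟨b1, b2, b3, b4⟩ := clamp _ _ _ s1 hv.2.1 hv.2.2
  obtain ⟨c1, c2, c3, c4⟩ := clamp _ _ _ s2 hv'.1.1 hv'.1.2
  obtain ⟨d1, d2, d3, d4⟩ := clamp _ _ _ s2 hv'.2.1 hv'.2.2
  have h := A.separated i k hik hle (a1, b1) (mem_square.2 ⟨⟨a2, a3⟩, b2, b3⟩) (c1, d1)
    (mem_square.2 ⟨⟨c2, c3⟩, d2, d3⟩)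
  have h' : (Q : ℤ) ^ (A.level i + 1) ≤ 3 * cellDist (a1, b1) (c1, d1) := by
    have : (Q : ℝ) ^ (A.level i + 1) ≤ 3 * (cellDist (a1, b1) (c1, d1) : ℝ) := by linarith
    exact_mod_cast this
  have h2 : cellDist (a1, b1) (c1, d1) ≤ cellDist v v' + 2 := by
    have e1 : |v.1 - v'.1| ≤ cellDist v v' := le_max_left _ _
    have e2 : |v.2 - v'.2| ≤ cellDist v v' := le_max_right _ _
    rw [abs_le] at *
    refine max_le ?_ ?_ <;> rw [abs_le] <;> simp only <;> omega
  have h3 : (Q : ℤ) ^ j ≤ (Q : ℤ) ^ A.level i := pow_le_pow_right₀ (by omega) hi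
  have h4 : (1 : ℤ) ≤ (Q : ℤ) ^ A.level i := one_le_pow₀ (by omega)
  have h5 : (16 : ℤ) * (Q : ℤ) ^ A.level i ≤ (Q : ℤ) ^ (A.level i + 1) := by
    rw [pow_succ, mul_comm]
    exact mul_le_mul_of_nonneg_left (by omega) (by omega)
  omega

/-- The case `j = 0`: distinct regions are at distance at least 3, so a single edge or face never
sees two punctures. -/
lemma eq_of_near (hQ : 15 < Q) {i k : Fin A.n} {v v' : Site} (hv : v ∈ A.region .smooth i)
    (hv' : v' ∈ A.region .smooth k) (h1 : |v.1 - v'.1| ≤ 2) (h2 : |v.2 - v'.2| ≤ 2) : i = k := by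
  by_contra hik
  have := A.cellDist_of_ne hQ hik (Nat.zero_le _) (Nat.zero_le _) hv hv'
  have h3 : cellDist v v' ≤ 2 := max_le h1 h2
  simp only [pow_zero] at this
  omega

/-! ### Boundary types -/

lemma mode_of_enclosable {i : Fin A.n} (h : A.Enclosable i) (t : ℕ) : A.mode i t =
    if Even (min t (d - 1) / Q ^ A.level i) then A.first i else (A.first i).flip := by
  rw [mode, if_neg h.2, if_neg h.1]

lemma mode_of_not_enclosable {i : Fin A.n} (h : ¬ A.Enclosable i) (t t' : ℕ) :
    A.mode i t = A.mode i t' := by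
  by_cases h1 : A.NearSmooth i
  · simp only [mode, if_pos h1]
  · have h2 : A.NearRough i := by
      by_contra h2
      exact h ⟨h2, h1⟩
    simp only [mode, if_neg h1, if_pos h2]

lemma nearSmooth_of_mode {i : Fin A.n} (h : ¬ A.Enclosable i) {t : ℕ} (ht : A.mode i t = .smooth) :
    A.NearSmooth i := by
  by_contra h1
  have h2 : A.NearRough i := by
    by_contra h2
    exact h ⟨h2, h1⟩
  simp [mode, if_neg h1, if_pos h2] at ht

lemma nearRough_of_mode {i : Fin A.n} (h : ¬ A.Enclosable i) {t : ℕ} (ht : A.mode i t = .rough) :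
    A.NearRough i := by
  by_contra h2
  have h1 : A.NearSmooth i := by
    by_contra h1
    exact h ⟨h2, h1⟩
  simp [mode, if_neg h2, if_pos h1] at ht

lemma mode_eq_of_div {i : Fin A.n} (h : A.Enclosable i) {t k : ℕ}
    (h1 : k * Q ^ A.level i ≤ t) (h2 : t < (k + 1) * Q ^ A.level i) (h3 : k * Q ^ A.level i < d) :
    A.mode i t = A.mode i (k * Q ^ A.level i) := by
  have hpos : 0 < Q ^ A.level i := by
    rcases Nat.eq_zero_or_pos (Q ^ A.level i) with h0 | h0
    · simp [h0] at h2
    · exact h0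
  rw [A.mode_of_enclosable h, A.mode_of_enclosable h]
  have e1 : min t (d - 1) / Q ^ A.level i = k :=
    Nat.div_eq_of_lt_le (by omega) (by omega)
  have e2 : min (k * Q ^ A.level i) (d - 1) / Q ^ A.level i = k :=
    Nat.div_eq_of_lt_le (by omega) (by rw [add_mul] at *; omega)
  rw [e1, e2]

lemma mode_last (i : Fin A.n) {t : ℕ} (ht : d - 1 ≤ t) : A.mode i t = A.mode i (d - 1) := by
  by_cases h : A.Enclosable i
  · rw [A.mode_of_enclosable h, A.mode_of_enclosable h, min_eq_right ht, min_self]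
  · exact A.mode_of_not_enclosable h _ _

lemma mode_succ_ne (hQ : 0 < Q) {i : Fin A.n} (h : A.Enclosable i) {k : ℕ}
    (h3 : (k + 1) * Q ^ A.level i < d) :
    A.mode i (k * Q ^ A.level i) ≠ A.mode i ((k + 1) * Q ^ A.level i) := by
  have hpos : 0 < Q ^ A.level i := Nat.pow_pos hQ
  have h4 : k * Q ^ A.level i < (k + 1) * Q ^ A.level i := by rw [add_mul]; omega
  rw [A.mode_of_enclosable h, A.mode_of_enclosable h, min_eq_left (by omega),
    min_eq_left (by omega), Nat.mul_div_cancel _ hpos, Nat.mul_div_cancel _ hpos]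
  by_cases hk : Even k
  · rw [if_pos hk, if_neg (by simpa [Nat.even_add_one] using hk)]
    cases A.first i <;> simp [Boundary.flip]
  · rw [if_neg hk, if_pos (by simpa [Nat.even_add_one] using hk)]
    cases A.first i <;> simp [Boundary.flip]

/-! ### Shells -/

/-- The space-time cells that form the `k`-th shell of the puncture `i`, if it has type `b`. -/
def InShell (b : Boundary) (i : Fin A.n) (k : ℕ) (c : Cell) : Prop :=
  c.1 ∈ A.region b i ∧ A.Enclosable i ∧ k * Q ^ A.level i < d ∧
    A.mode i (k * Q ^ A.level i) = b ∧ k * Q ^ A.level i ≤ c.2 ∧ c.2 ≤ A.shellEnd i k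

lemma exists_inShell_of_mode (hQ : 0 < Q) (hd : 0 < d) {b : Boundary} {i : Fin A.n} {w : Site}
    {t : ℕ} (h : A.Enclosable i) (hw : w ∈ A.region b i) (ht : t ≤ d) (hm : A.mode i t = b) :
    ∃ k, A.InShell b i k (w, t) := by
  have hpos : 0 < Q ^ A.level i := Nat.pow_pos hQ
  have h1 : min t (d - 1) / Q ^ A.level i * Q ^ A.level i ≤ min t (d - 1) := Nat.div_mul_le_self _ _
  have h2 : min t (d - 1) < (min t (d - 1) / Q ^ A.level i + 1) * Q ^ A.level i :=
    mul_comm (Q ^ A.level i) _ ▸ Nat.lt_mul_div_succ _ hpos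
  refine ⟨min t (d - 1) / Q ^ A.level i, hw, h, by omega, ?_, ?_, ?_⟩
  · rw [← A.mode_eq_of_div h h1 h2 (by omega)]
    rcases le_total t (d - 1) with h' | h'
    · rwa [min_eq_left h']
    · rwa [min_eq_right h', ← A.mode_last i h']
  · simp only; omega
  · simp only [shellEnd]; omega

/-- The event at time `t + 1` also uses the outcome of round `t`. Hence a shell must contain the
time slice just after its last round, which is why `InShell` is closed at its end. -/
lemma exists_inShell_of_mode_pred (hQ : 0 < Q) {b : Boundary} {i : Fin A.n} {w : Site} {t : ℕ}
    (h : A.Enclosable i) (hw : w ∈ A.region b i) (ht : t + 1 ≤ d) (hm : A.mode i t = b) :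
    ∃ k, A.InShell b i k (w, t + 1) := by
  have hpos : 0 < Q ^ A.level i := Nat.pow_pos hQ
  have h1 : t / Q ^ A.level i * Q ^ A.level i ≤ t := Nat.div_mul_le_self _ _
  have h2 : t < (t / Q ^ A.level i + 1) * Q ^ A.level i :=
    mul_comm (Q ^ A.level i) _ ▸ Nat.lt_mul_div_succ _ hpos
  refine ⟨t / Q ^ A.level i, hw, h, by omega, ?_, ?_, ?_⟩
  · rwa [← A.mode_eq_of_div h h1 h2 (by omega)]
  · simp only; omega
  · simp only [shellEnd]; omega

/-- Two shells of the same type at one puncture have a complete shell of the other type between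
them, whose `Q ^ level` rounds separate them in time. Shells of different punctures are separated in
space. -/
lemma cellSep_of_shell_ne (hQ : 15 < Q) {b : Boundary} {i i' : Fin A.n} {k k' : ℕ} {c c' : Cell}
    (h : A.InShell b i k c) (h' : A.InShell b i' k' c') (hne : ¬ (i = i' ∧ k = k')) {j : ℕ}
    (hj : j ≤ A.level i) (hj' : j ≤ A.level i') : (Q : ℤ) ^ j ≤ cellSep c c' := by
  by_cases hi : i = i'
  · subst hi
    have hk : k ≠ k' := fun h => hne ⟨rfl, h⟩
    wlog hlt : k < k' generalizing k k' c c'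
    · have := this h' h (fun h => hk h.2.symm) hk.symm (by omega)
      rwa [cellSep, cellDist, abs_sub_comm c'.1.1, abs_sub_comm c'.1.2, abs_sub_comm (c'.2 : ℤ)]
        at this
    have hpos : 0 < Q ^ A.level i := Nat.pow_pos (by omega)
    have hk2 : k + 2 ≤ k' := by
      by_contra hcon
      obtain rfl : k' = k + 1 := by omega
      exact A.mode_succ_ne (by omega) h.2.1 h'.2.2.1 (h.2.2.2.1.trans h'.2.2.2.1.symm)
    have h1 : c.2 ≤ (k + 1) * Q ^ A.level i := h.2.2.2.2.2.trans (min_le_left _ _)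
    have h2 : (k + 2) * Q ^ A.level i ≤ c'.2 :=
      (Nat.mul_le_mul_right _ hk2).trans h'.2.2.2.2.1
    have h3 : Q ^ j ≤ Q ^ A.level i := Nat.pow_le_pow_right (by omega) hj
    have h4 : c.2 + Q ^ j ≤ c'.2 := by
      rw [add_mul] at h1 h2
      omega
    have h5 : (c.2 : ℤ) + (Q : ℤ) ^ j ≤ c'.2 := by exact_mod_cast h4
    refine le_trans ?_ (time_le_cellSep c c')
    rw [abs_sub_comm]
    exact le_trans (by omega) (le_abs_self _)
  · have := A.cellDist_of_ne hQ hi hj hj' (A.region_subset b i h.1) (A.region_subset b i' h'.1)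
    have := cellDist_le_cellSep c c'
    omega

/-! ### Nodes -/

/-- The lower (or left) boundary of the array with the permanent punctures next to it. -/
def Low : Boundary → Site → Prop
  | .smooth, w => w.2 < 0 ∨ ∃ i, ¬ A.Enclosable i ∧ A.mode i 0 = .smooth ∧
      w ∈ A.region .smooth i ∧ (A.corner i).2 ≤ 0
  | .rough, v => v.1 ≤ 0 ∨ ∃ i, ¬ A.Enclosable i ∧ A.mode i 0 = .rough ∧
      v ∈ A.region .rough i ∧ (A.corner i).1 ≤ 1

/-- The upper (or right) boundary of the array with the permanent punctures next to it. -/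
def High : Boundary → Site → Prop
  | .smooth, w => (d : ℤ) - 1 ≤ w.2 ∨ ∃ i, ¬ A.Enclosable i ∧ A.mode i 0 = .smooth ∧
      w ∈ A.region .smooth i ∧ (d : ℤ) - 1 ≤ (A.corner i).2 + A.side i
  | .rough, v => (d : ℤ) ≤ v.1 ∨ ∃ i, ¬ A.Enclosable i ∧ A.mode i 0 = .rough ∧
      v ∈ A.region .rough i ∧ (d : ℤ) - 1 ≤ (A.corner i).1 + A.side i

open Classical in
/-- The node of the decoding graph that contains a space-time cell. -/
def node (b : Boundary) (c : Cell) : Node A.n :=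
  if h : ∃ i k, A.InShell b i k c then .shell h.choose h.choose_spec.choose
  else if A.Low b c.1 then .lo else if A.High b c.1 then .hi else .cell c

/-- Distinct shells are at distance at least one, so no cell lies in two of them and the choice made
in `node` is immaterial. -/
lemma node_eq_shell_iff (hQ : 15 < Q) {b : Boundary} {c : Cell} {i : Fin A.n} {k : ℕ} :
    A.node b c = .shell i k ↔ A.InShell b i k c := by
  constructor
  · intro h
    rw [node] at h
    split_ifs at h with h1
    · obtain ⟨rfl, rfl⟩ := Node.shell.inj h
      exact h1.choose_spec.choose_spec
  · intro h
    have h1 : ∃ i k, A.InShell b i k c := ⟨i, k, h⟩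
    rw [node, dif_pos h1]
    by_contra hne
    have h2 := A.cellSep_of_shell_ne hQ h h1.choose_spec.choose_spec (j := 0)
      (fun h => hne ((Node.shell.injEq _ _ _ _).mpr ⟨h.1.symm, h.2.symm⟩)) (Nat.zero_le _) (Nat.zero_le _)
    simp [cellSep, cellDist] at h2

lemma node_eq_cell {b : Boundary} {c c' : Cell} (h : A.node b c = .cell c') :
    c = c' ∧ (∀ i k, ¬ A.InShell b i k c) ∧ ¬ A.Low b c.1 ∧ ¬ A.High b c.1 := by
  rw [node] at h
  split_ifs at h with h1 h2 h3
  exact ⟨Node.cell.inj h, fun i k h => h1 ⟨i, k, h⟩, h2, h3⟩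

lemma node_eq_cell_iff {b : Boundary} {c c' : Cell} (hc : A.node b c = .cell c) :
    A.node b c' = .cell c ↔ c' = c :=
  ⟨fun h => (A.node_eq_cell h).1, fun h => h ▸ hc⟩

lemma low_of_node_eq {b : Boundary} {c : Cell} (h : A.node b c = .lo) : A.Low b c.1 := by
  rw [node] at h
  split_ifs at h with h1 h2
  exact h2

lemma high_of_node_eq {b : Boundary} {c : Cell} (h : A.node b c = .hi) : A.High b c.1 := by
  rw [node] at h
  split_ifs at h with h1 h2 h3
  exact h3

/-- The rank of a node: one plus the level for shells. -/
def rank : Node A.n → ℕ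
  | .shell i _ => A.level i + 1
  | _ => 0

/-- A shell of level `l` has rank `l + 1`. Its spatial extent is at most `side + 1 ≤ Q^l + 1`, and
it lasts at most `Q^l` in time. -/
theorem shellGeometry (hQ : 15 < Q) (b : Boundary) :
    ShellGeometry Q cellSep (A.node b) A.rank Node.Inner where
  triangle := cellSep_triangle
  point a c hi hr h := by
    cases ha : A.node b a with
    | cell x =>
      have h1 := (A.node_eq_cell ha).1
      have h2 := (A.node_eq_cell (h.symm.trans ha)).1
      subst h1
      subst h2
      simp [cellSep, cellDist]
    | shell i k => rw [ha] at hr; simp [rank] at hr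
    | lo => exact absurd ha hi.1
    | hi => exact absurd ha hi.2
  diam a c j hi hr h := by
    cases ha : A.node b a with
    | cell x => rw [ha] at hr; simp [rank] at hr
    | shell i k =>
      rw [ha] at hr
      simp only [rank, Nat.add_right_cancel_iff] at hr
      subst hr
      have h1 := (A.node_eq_shell_iff hQ).1 ha
      have h2 := (A.node_eq_shell_iff hQ).1 (h.symm.trans ha)
      have r1 := A.mem_region_smooth.1 (A.region_subset b i h1.1)
      have r2 := A.mem_region_smooth.1 (A.region_subset b i h2.1)
      have hs : (A.side i : ℤ) ≤ (Q : ℤ) ^ A.level i := by exact_mod_cast A.side_le i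
      have t1 : a.2 ≤ k * Q ^ A.level i + Q ^ A.level i := by
        have := h1.2.2.2.2.2.trans (min_le_left _ _); rwa [add_mul, one_mul] at this
      have t2 : c.2 ≤ k * Q ^ A.level i + Q ^ A.level i := by
        have := h2.2.2.2.2.2.trans (min_le_left _ _); rwa [add_mul, one_mul] at this
      have t3 := h1.2.2.2.2.1
      have t4 := h2.2.2.2.2.1
      have hc : ((Q ^ A.level i : ℕ) : ℤ) = (Q : ℤ) ^ A.level i := by push_cast; rfl
      rw [← hc] at hs ⊢
      refine cellSep_le_iff.2 ⟨⟨?_, ?_⟩, ?_⟩ <;> rw [abs_le] <;> omega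
    | lo => exact absurd ha hi.1
    | hi => exact absurd ha hi.2
  sep a c j hi hi' hr hr' hne := by
    cases ha : A.node b a with
    | cell x => rw [ha] at hr; simp [rank] at hr
    | lo => exact absurd ha hi.1
    | hi => exact absurd ha hi.2
    | shell i k =>
      cases hc : A.node b c with
      | cell x => rw [hc] at hr'; simp [rank] at hr'
      | lo => exact absurd hc hi'.1
      | hi => exact absurd hc hi'.2
      | shell i' k' =>
        rw [ha] at hr
        rw [hc] at hr'
        simp only [rank, Nat.add_le_add_iff_right] at hr hr'
        refine A.cellSep_of_shell_ne hQ ((A.node_eq_shell_iff hQ).1 ha)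
          ((A.node_eq_shell_iff hQ).1 hc) (fun h => hne ?_) hr hr'
        rw [ha, hc, h.1, h.2]

/-- Opposite boundaries are far apart. -/
lemma le_cellSep_of_low_high (hQ : 0 < Q) {b : Boundary} {a c : Cell} {m : ℕ}
    (hm : ∀ i, A.level i ≤ m) (ha : A.Low b a.1) (hc : A.High b c.1) :
    (d : ℤ) - 2 - 2 * (Q : ℤ) ^ m ≤ cellSep a c := by
  have hside : ∀ i, (A.side i : ℤ) ≤ (Q : ℤ) ^ m := fun i => by
    have h1 := A.side_le i
    have h2 : Q ^ A.level i ≤ Q ^ m := Nat.pow_le_pow_right hQ (hm i)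
    exact_mod_cast h1.trans h2
  have hQm : (0 : ℤ) < (Q : ℤ) ^ m := by positivity
  refine le_trans ?_ (cellDist_le_cellSep a c)
  cases b
  · refine le_trans ?_ (le_max_left _ _)
    rw [abs_sub_comm]
    refine le_trans ?_ (le_abs_self _)
    have h1 : a.1.1 ≤ 1 + (Q : ℤ) ^ m := by
      rcases ha with ha | ⟨i, -, -, hr, hi⟩
      · omega
      · rw [mem_region_rough] at hr
        have := hside i
        omega
    have h2 : (d : ℤ) - 1 - (Q : ℤ) ^ m ≤ c.1.1 := by
      rcases hc with hc | ⟨i, -, -, hr, hi⟩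
      · omega
      · rw [mem_region_rough] at hr
        have := hside i
        omega
    omega
  · refine le_trans ?_ (le_max_right _ _)
    rw [abs_sub_comm]
    refine le_trans ?_ (le_abs_self _)
    have h1 : a.1.2 ≤ (Q : ℤ) ^ m := by
      rcases ha with ha | ⟨i, -, -, hr, hi⟩
      · omega
      · rw [mem_region_smooth] at hr
        have := hside i
        omega
    have h2 : (d : ℤ) - 2 - (Q : ℤ) ^ m ≤ c.1.2 := by
      rcases hc with hc | ⟨i, -, -, hr, hi⟩
      · omega
      · rw [mem_region_smooth] at hr
        have := hside i
        omega
    omega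

end DefectArray

/-! ### Incidence of qubits, cells and elementary errors -/

lemma Qubit.mem_ends {q : Qubit} {p : Site} :
    p ∈ q.ends ↔ p = q.endPt false ∨ p = q.endPt true := by
  cases q <;> simp [Qubit.ends, Qubit.endPt]

lemma Qubit.endPt_ne (q : Qubit) : q.endPt false ≠ q.endPt true := by
  cases q <;> simp [Qubit.endPt, Prod.ext_iff]

lemma Qubit.sideFace_ne (q : Qubit) : q.sideFace false ≠ q.sideFace true := by
  cases q <;> simp only [Qubit.sideFace, ne_eq, Prod.ext_iff] <;> omega

lemma mem_faceEdges {q : Qubit} {w : Site} :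
    q ∈ faceEdges w ↔ q.sideFace false = w ∨ q.sideFace true = w := by
  rcases q with p | p <;> simp [faceEdges, Qubit.sideFace, Prod.ext_iff] <;> omega

lemma mem_starEdges {q : Qubit} {v : Site} :
    q ∈ starEdges v ↔ q.endPt false = v ∨ q.endPt true = v := by
  rcases q with p | p <;> simp [starEdges, Qubit.endPt, Prod.ext_iff] <;> omega

lemma mem_faceCorners_of_mem_ends {q : Qubit} {w p : Site} (hq : q ∈ faceEdges w)
    (hp : p ∈ q.ends) : p ∈ faceCorners w := by
  rw [mem_faceEdges] at hq
  rw [Qubit.mem_ends] at hp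
  rw [DefectArray.mem_faceCorners]
  rcases q with x | x <;> simp only [Qubit.sideFace, Qubit.endPt] at hq hp <;>
    rcases hq with rfl | rfl <;> rcases hp with rfl | rfl <;> simp

lemma mem_idealQubits_hor {d : ℕ} {p : Site} : Qubit.hor p ∈ idealQubits d ↔
    (0 ≤ p.1 ∧ p.1 < d) ∧ 0 ≤ p.2 ∧ p.2 < d := by
  simp [idealQubits]

lemma mem_idealQubits_ver {d : ℕ} {p : Site} : Qubit.ver p ∈ idealQubits d ↔
    (1 ≤ p.1 ∧ p.1 < d) ∧ 0 ≤ p.2 ∧ p.2 < (d : ℤ) - 1 := by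
  simp [idealQubits]

lemma mem_idealFaces {d : ℕ} {w : Site} : w ∈ idealFaces d ↔
    (0 ≤ w.1 ∧ w.1 < d) ∧ 0 ≤ w.2 ∧ w.2 < (d : ℤ) - 1 := by
  simp [idealFaces]

lemma mem_idealVertices {d : ℕ} {v : Site} : v ∈ idealVertices d ↔
    (1 ≤ v.1 ∧ v.1 < d) ∧ 0 ≤ v.2 ∧ v.2 < d := by
  simp [idealVertices]

/-- The errors of one kind in a set of errors. -/
def partOf (b : Boundary) (E : Finset Fault) : Finset Fault := E.filter fun f => f.kind = b

/-- The errors at a space-time cell. -/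
def incident : Boundary → Cell → Finset Fault
  | .smooth, (w, t) => (faceEdges w).image (Fault.bit · t) ∪
      ({Fault.plaq w t} ∪ if t = 0 then ∅ else {Fault.plaq w (t - 1)})
  | .rough, (v, t) => (starEdges v).image (Fault.phase · t) ∪
      ((starEdges v).image (Fault.gauge · t) ∪
        ({Fault.star v t} ∪ if t = 0 then ∅ else {Fault.star v (t - 1)}))

lemma mem_incident_iff {b : Boundary} {f : Fault} (hf : f.kind = b) {c : Cell} :
    f ∈ incident b c ↔ f.ends false = c ∨ f.ends true = c := by
  obtain ⟨w, t⟩ := c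
  subst hf
  rcases f with ⟨q, t'⟩ | ⟨q, t'⟩ | ⟨w', t'⟩ | ⟨v, t'⟩ | ⟨q, t'⟩ <;>
    simp only [Fault.kind, incident, Finset.mem_union, Finset.mem_image, Finset.mem_singleton,
      Fault.ends, Prod.ext_iff, Fault.bit.injEq, Fault.plaq.injEq, Fault.phase.injEq,
      Fault.gauge.injEq, Fault.star.injEq, reduceCtorEq, and_false, exists_false,
      false_or, cond_true, cond_false]
  · have : (Fault.bit q t' ∈ if t = 0 then (∅ : Finset Fault) else {Fault.plaq w (t - 1)}) ↔
        False := by split_ifs <;> simp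
    rw [this, or_false, ← Prod.ext_iff, ← Prod.ext_iff, ← or_and_right, ← mem_faceEdges]
    exact ⟨fun ⟨q', h, h1, h2⟩ => ⟨h1 ▸ h, h2.symm⟩, fun h => ⟨q, h.1, rfl, h.2.symm⟩⟩
  · have : (Fault.phase q t' ∈ if t = 0 then (∅ : Finset Fault) else {Fault.star w (t - 1)}) ↔
        False := by split_ifs <;> simp
    rw [this, or_false, ← Prod.ext_iff, ← Prod.ext_iff, ← or_and_right, ← mem_starEdges]
    exact ⟨fun ⟨q', h, h1, h2⟩ => ⟨h1 ▸ h, h2.symm⟩, fun h => ⟨q, h.1, rfl, h.2.symm⟩⟩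
  · have : (Fault.plaq w' t' ∈ if t = 0 then (∅ : Finset Fault) else {Fault.plaq w (t - 1)}) ↔
        w' = w ∧ t' + 1 = t := by
      split_ifs
      · simp only [Finset.notMem_empty, false_iff]; rintro ⟨-, h⟩; omega
      · rw [Finset.mem_singleton, Fault.plaq.injEq]; exact and_congr_right fun _ => by omega
    rw [this, ← Prod.ext_iff]
  · have : (Fault.star v t' ∈ if t = 0 then (∅ : Finset Fault) else {Fault.star w (t - 1)}) ↔
        v = w ∧ t' + 1 = t := by
      split_ifs
      · simp only [Finset.notMem_empty, false_iff]; rintro ⟨-, h⟩; omega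
      · rw [Finset.mem_singleton, Fault.star.injEq]; exact and_congr_right fun _ => by omega
    rw [this, ← Prod.ext_iff]
  · have : (Fault.gauge q t' ∈ if t = 0 then (∅ : Finset Fault) else {Fault.star w (t - 1)}) ↔
        False := by split_ifs <;> simp
    rw [this, or_false, ← Prod.ext_iff, ← Prod.ext_iff, ← or_and_right, ← mem_starEdges]
    exact ⟨fun ⟨q', h, h1, h2⟩ => ⟨h1 ▸ h, h2.symm⟩, fun h => ⟨q, h.1, rfl, h.2.symm⟩⟩

lemma Fault.ends_ne (f : Fault) : f.ends false ≠ f.ends true := by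
  rcases f with ⟨q, t⟩ | ⟨q, t⟩ | ⟨w, t⟩ | ⟨v, t⟩ | ⟨q, t⟩ <;>
    simp [Fault.ends, Qubit.sideFace_ne, Qubit.endPt_ne]

lemma kind_of_mem_incident {b : Boundary} {c : Cell} {f : Fault} (h : f ∈ incident b c) :
    f.kind = b := by
  obtain ⟨w, t⟩ := c
  rcases f with f | f | f | f | f <;> cases b <;> first
    | rfl
    | (exfalso; simp [incident] at h; split_ifs at h <;> simp at h)

lemma card_faceEdges_le (w : Site) : (faceEdges w).card ≤ 4 := Finset.card_le_four

lemma card_starEdges_le (v : Site) : (starEdges v).card ≤ 4 := Finset.card_le_four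

/-- The largest case is a vertex: four phase flips, four gauge outcomes and two outcomes of the star
itself. -/
lemma card_incident_le (b : Boundary) (c : Cell) : (incident b c).card ≤ 10 := by
  obtain ⟨w, t⟩ := c
  have h0 : ∀ f : Fault, (if t = 0 then (∅ : Finset Fault) else {f}).card ≤ 1 := fun f => by
    split_ifs <;> simp
  cases b
  · have h1 := (Finset.card_image_le (s := starEdges w) (f := (Fault.phase · t))).trans
      (card_starEdges_le w)
    have h2 := (Finset.card_image_le (s := starEdges w) (f := (Fault.gauge · t))).trans
      (card_starEdges_le w)
    have h3 := h0 (Fault.star w (t - 1))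
    refine (Finset.card_union_le _ _).trans ?_
    have h4 := Finset.card_union_le ((starEdges w).image (Fault.gauge · t))
      ({Fault.star w t} ∪ if t = 0 then ∅ else {Fault.star w (t - 1)})
    have h5 := Finset.card_union_le {Fault.star w t} (if t = 0 then ∅ else {Fault.star w (t - 1)})
    rw [Finset.card_singleton] at h5
    omega
  · have h1 := (Finset.card_image_le (s := faceEdges w) (f := (Fault.bit · t))).trans
      (card_faceEdges_le w)
    have h3 := h0 (Fault.plaq w (t - 1))
    refine (Finset.card_union_le _ _).trans ?_
    have h5 := Finset.card_union_le {Fault.plaq w t} (if t = 0 then ∅ else {Fault.plaq w (t - 1)})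
    rw [Finset.card_singleton] at h5
    omega

/-- A degree is the parity of the errors in a set of errors that change the node once. -/
lemma nodeDeg_eq_sum_occurs {ν : Type*} {s : Fault → Bool → ν} {b : Boundary} {E T : Finset Fault}
    {n : ν} (hT : ∀ f ∈ T, f.kind = b)
    (h : ∀ f ∈ E, f.kind = b → (s f false = n ↔ s f true = n) ∧ f ∉ T ∨
      ¬ (s f false = n ↔ s f true = n) ∧ f ∈ T) :
    nodeDeg s (partOf b E) n = ∑ f ∈ T, occurs E f := by
  classical
  have h1 : nodeDeg s (partOf b E) n = ∑ f ∈ partOf b E, if f ∈ T then 1 else 0 := by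
    refine Finset.sum_congr rfl fun f hf => ?_
    rw [partOf, Finset.mem_filter] at hf
    rcases h f hf.1 hf.2 with ⟨h1, h2⟩ | ⟨h1, h2⟩
    · by_cases h3 : s f true = n
      · simp [h2, h3, h1.2 h3]; rfl
      · simp [h2, h3, mt h1.1 h3]
    · by_cases h3 : s f true = n <;> by_cases h4 : s f false = n <;> simp_all
  rw [h1, Finset.sum_ite_mem]
  simp only [occurs]
  rw [Finset.sum_ite_mem]
  congr 1
  ext f
  simp only [partOf, Finset.mem_inter, Finset.mem_filter]
  exact ⟨fun h => ⟨h.2, h.1.1⟩, fun h => ⟨⟨h.2, hT f h.1⟩, h.1⟩⟩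

/-! ### Degrees of ordinary cells -/

namespace DefectArray

variable {Q d : ℕ} (A : DefectArray Q d)

/-- The two nodes joined by an elementary error. -/
def joins (b : Boundary) (f : Fault) (c : Bool) : Node A.n := A.node b (f.ends c)

variable {A}

lemma mem_active {t : ℕ} {q : Qubit} : q ∈ A.active t ↔ q ∈ idealQubits d ∧
    (¬ ∀ p ∈ q.ends, A.RoughRemoved t p) ∧ ∀ p ∈ q.ends, ¬ A.SmoothRemoved t p := by
  simp [active]

lemma mem_faces {t : ℕ} {w : Site} : w ∈ A.faces t ↔ w ∈ idealFaces d ∧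
    (¬ ∀ p ∈ faceCorners w, A.RoughRemoved t p) ∧ ∀ p ∈ faceCorners w, ¬ A.SmoothRemoved t p := by
  simp [faces]

lemma mem_stars {v : Site} : v ∈ A.stars ↔ v ∈ idealVertices d ∧ ∀ i, v ∉ A.hole i := by
  simp [stars]

lemma removed_congr {t t' : ℕ} {p : Site} (h : ∀ i, p ∈ A.hole i → A.mode i t = A.mode i t') :
    (A.RoughRemoved t p ↔ A.RoughRemoved t' p) ∧ (A.SmoothRemoved t p ↔ A.SmoothRemoved t' p) := by
  constructor
  · refine or_congr Iff.rfl (or_congr Iff.rfl (exists_congr fun i => ?_))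
    exact and_congr_left fun hp => by rw [h i hp]
  · exact exists_congr fun i => and_congr_left fun hp => by rw [h i hp]

lemma active_congr {t t' : ℕ} {q : Qubit}
    (h : ∀ p ∈ q.ends, ∀ i, p ∈ A.hole i → A.mode i t = A.mode i t') :
    q ∈ A.active t ↔ q ∈ A.active t' := by
  rw [mem_active, mem_active]
  refine and_congr Iff.rfl (and_congr (not_congr ?_) ?_)
  · exact forall₂_congr fun p hp => (removed_congr (h p hp)).1
  · exact forall₂_congr fun p hp => not_congr (removed_congr (h p hp)).2

lemma faces_congr {t t' : ℕ} {w : Site}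
    (h : ∀ i, w ∈ A.region .smooth i → A.mode i t = A.mode i t') :
    w ∈ A.faces t ↔ w ∈ A.faces t' := by
  rw [mem_faces, mem_faces]
  have h' : ∀ p ∈ faceCorners w, ∀ i, p ∈ A.hole i → A.mode i t = A.mode i t' :=
    fun p hp i hi => h i (A.mem_region_iff_touch.2 ⟨p, hp, hi⟩)
  refine and_congr Iff.rfl (and_congr (not_congr ?_) ?_)
  · exact forall₂_congr fun p hp => (removed_congr (h' p hp)).1
  · exact forall₂_congr fun p hp => not_congr (removed_congr (h' p hp)).2

lemma mode_of_mem_faces {t : ℕ} {w : Site} (hw : w ∈ A.faces t) {i : Fin A.n}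
    (hi : w ∈ A.region .smooth i) : A.mode i t = .rough := by
  obtain ⟨p, hp, hi⟩ := A.mem_region_iff_touch.1 hi
  cases h : A.mode i t
  · rfl
  · exact absurd ⟨i, h, hi⟩ ((mem_faces.1 hw).2.2 p hp)

lemma mode_of_mem_active {t : ℕ} {q : Qubit} (hq : q ∈ A.active t) {p : Site} (hp : p ∈ q.ends)
    {i : Fin A.n} (hi : p ∈ A.hole i) : A.mode i t = .rough := by
  cases h : A.mode i t
  · rfl
  · exact absurd ⟨i, h, hi⟩ ((mem_active.1 hq).2.2 p hp)

lemma present_zero : A.present 0 = A.active 0 := by simp [present, decoupled]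

lemma decoupled_succ (t : ℕ) : A.decoupled (t + 1) = A.active t \ A.active (t + 1) := by
  simp [decoupled]

lemma mem_present_succ {t : ℕ} {q : Qubit} :
    q ∈ A.present (t + 1) ↔ q ∈ A.active (t + 1) ∨ q ∈ A.active t := by
  rw [present, decoupled_succ, Finset.mem_union, Finset.mem_sdiff]
  tauto

lemma mem_idealQubits_of_present {t : ℕ} {q : Qubit} (h : q ∈ A.present t) :
    q ∈ idealQubits d := by
  rcases t with _ | t
  · rw [present_zero] at h
    exact (mem_active.1 h).1
  · rw [mem_present_succ] at h
    rcases h with h | h <;> exact (mem_active.1 h).1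

lemma bit_mem_faults {q : Qubit} {t : ℕ} :
    Fault.bit q t ∈ A.faults ↔ t ≤ d ∧ q ∈ A.present t := by
  simp [faults]

lemma phase_mem_faults {q : Qubit} {t : ℕ} :
    Fault.phase q t ∈ A.faults ↔ t ≤ d ∧ q ∈ A.present t := by
  simp [faults]

lemma plaq_mem_faults {w : Site} {t : ℕ} :
    Fault.plaq w t ∈ A.faults ↔ t < d ∧ w ∈ A.faces t := by
  simp [faults, -Prod.exists]

lemma star_mem_faults {v : Site} {t : ℕ} :
    Fault.star v t ∈ A.faults ↔ t < d ∧ v ∈ A.stars := by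
  simp [faults, -Prod.exists]

lemma gauge_mem_faults {q : Qubit} {t : ℕ} :
    Fault.gauge q t ∈ A.faults ↔ t < d ∧ q ∈ A.decoupled t := by
  simp [faults, -Prod.exists]

lemma occurs_eq_zero {E : Finset Fault} (hE : E ⊆ A.faults) {f : Fault} (hf : f ∉ A.faults) :
    occurs E f = 0 := if_neg fun h => hf (hE h)

/-- The degree of an ordinary cell. -/
lemma nodeDeg_cell {b : Boundary} {c : Cell} (hc : A.node b c = .cell c) (E : Finset Fault) :
    nodeDeg (A.joins b) (partOf b E) (.cell c) = ∑ f ∈ incident b c, occurs E f := by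
  refine nodeDeg_eq_sum_occurs (fun f => kind_of_mem_incident) fun f _ hf => ?_
  rw [mem_incident_iff hf, joins, joins, A.node_eq_cell_iff hc, A.node_eq_cell_iff hc]
  by_cases h1 : f.ends false = c <;> by_cases h2 : f.ends true = c
  · exact absurd (h1.trans h2.symm) f.ends_ne
  all_goals simp [h1, h2]

lemma sum_incident_smooth (E : Finset Fault) (w : Site) (t : ℕ) :
    ∑ f ∈ incident .smooth (w, t), occurs E f = ∑ q ∈ faceEdges w, occurs E (.bit q t) +
      (occurs E (.plaq w t) + if t = 0 then 0 else occurs E (.plaq w (t - 1))) := by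
  rw [incident, Finset.sum_union, Finset.sum_union, Finset.sum_image, Finset.sum_singleton]
  · congr 2
    split_ifs <;> simp
  · intro a _ b _ h; simpa using h
  · split_ifs <;> simp; omega
  · rw [Finset.disjoint_left]
    intro f hf
    obtain ⟨q, -, rfl⟩ := Finset.mem_image.1 hf
    split_ifs <;> simp

lemma sum_incident_rough (E : Finset Fault) (v : Site) (t : ℕ) :
    ∑ f ∈ incident .rough (v, t), occurs E f =
      ∑ q ∈ starEdges v, (occurs E (.phase q t) + occurs E (.gauge q t)) +
      (occurs E (.star v t) + if t = 0 then 0 else occurs E (.star v (t - 1))) := by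
  rw [incident, Finset.sum_union, Finset.sum_union, Finset.sum_union, Finset.sum_image,
    Finset.sum_image, Finset.sum_singleton, Finset.sum_add_distrib, add_assoc]
  · congr 3
    split_ifs <;> simp
  · intro a _ b _ h; simpa using h
  · intro a _ b _ h; simpa using h
  · split_ifs <;> simp; omega
  · rw [Finset.disjoint_left]
    intro f hf
    obtain ⟨q, -, rfl⟩ := Finset.mem_image.1 hf
    split_ifs <;> simp
  · rw [Finset.disjoint_left]
    intro f hf
    obtain ⟨q, -, rfl⟩ := Finset.mem_image.1 hf
    split_ifs <;> simp

/-- Detection events at faces are degrees. -/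
lemma face_event_eq {E : Finset Fault} (hE : E ⊆ A.faults) {w : Site} {t : ℕ}
    (h1 : w ∈ A.faces t) (h2 : t = 0 ∨ w ∈ A.faces (t - 1)) :
    A.plaqFlip E w t + (if t = 0 then 0 else A.plaqFlip E w (t - 1)) =
      ∑ f ∈ incident .smooth (w, t), occurs E f := by
  rw [sum_incident_smooth]
  rcases t with _ | t
  · simp only [plaqFlip, if_true, add_zero, frame]
    rw [add_comm]
    congr 1
    rw [← Finset.sum_ite_mem]
    refine Finset.sum_congr rfl fun q _ => ?_
    split_ifs with h
    · rfl
    · exact (occurs_eq_zero hE (by rw [bit_mem_faults, present_zero]; tauto)).symm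
  · rw [if_neg (by omega), if_neg (by omega)]
    simp only [Nat.add_sub_cancel, plaqFlip, Nat.add_eq_zero_iff, one_ne_zero, and_false,
      false_or] at h2 ⊢
    -- A face that is measured in both rounds meets only punctures that are rough in both, so its
    -- set of active qubits does not change.
    have hact : ∀ q ∈ faceEdges w, (q ∈ A.active (t + 1) ↔ q ∈ A.active t) := fun q hq =>
      active_congr fun p hp i hi => by
        have hw : w ∈ A.region .smooth i :=
          A.mem_region_iff_touch.2 ⟨p, mem_faceCorners_of_mem_ends hq hp, hi⟩
        rw [mode_of_mem_faces h1 hw, mode_of_mem_faces h2 hw]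
    have key : ∑ q ∈ faceEdges w ∩ A.active (t + 1), A.frame .bit E q (t + 1) =
        ∑ q ∈ faceEdges w ∩ A.active t, A.frame .bit E q t +
          ∑ q ∈ faceEdges w, occurs E (.bit q (t + 1)) := by
      rw [← Finset.sum_ite_mem, ← Finset.sum_ite_mem, ← Finset.sum_add_distrib]
      refine Finset.sum_congr rfl fun q hq => ?_
      have ha := hact q hq
      by_cases h : q ∈ A.active t
      · simp [ha, h, frame]
      · simp only [ha, h, if_false, zero_add]
        exact (occurs_eq_zero hE (by rw [bit_mem_faults, mem_present_succ]; tauto)).symm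
    rw [key]
    have h2 : (2 : ZMod 2) = 0 := rfl
    linear_combination (∑ q ∈ faceEdges w ∩ A.active t, A.frame .bit E q t) * h2

/-- Detection events at vertices are degrees. -/
lemma vertex_event_eq {E : Finset Fault} (hE : E ⊆ A.faults) (v : Site) (t : ℕ) :
    A.starFlip E v t + ∑ q ∈ starEdges v ∩ A.decoupled t, A.gaugeFlip E q t +
      (if t = 0 then 0 else A.starFlip E v (t - 1)) =
      ∑ f ∈ incident .rough (v, t), occurs E f := by
  rw [sum_incident_rough]
  rcases t with _ | t
  · have hg : ∀ q, occurs E (.gauge q 0) = 0 := fun q =>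
      occurs_eq_zero hE (by rw [gauge_mem_faults]; simp [decoupled])
    simp only [starFlip, if_true, add_zero, frame, decoupled, Finset.inter_empty,
      Finset.sum_empty, hg]
    rw [add_comm]
    congr 1
    rw [← Finset.sum_ite_mem]
    refine Finset.sum_congr rfl fun q _ => ?_
    split_ifs with h
    · rfl
    · exact (occurs_eq_zero hE (by rw [phase_mem_faults, present_zero]; tauto)).symm
  · rw [if_neg (by omega), if_neg (by omega)]
    simp only [Nat.add_sub_cancel, starFlip, gaugeFlip]
    -- The identity holds qubit by qubit: a retained qubit carries its frame forward, one that is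
    -- measured out enters through its gauge outcome, and a freshly prepared one has no past.
    have key : ∑ q ∈ starEdges v ∩ A.active (t + 1), A.frame .phase E q (t + 1) +
        ∑ q ∈ starEdges v ∩ A.decoupled (t + 1),
          (occurs E (.gauge q (t + 1)) + A.frame .phase E q (t + 1)) +
        ∑ q ∈ starEdges v ∩ A.active t, A.frame .phase E q t =
          ∑ q ∈ starEdges v, (occurs E (.phase q (t + 1)) + occurs E (.gauge q (t + 1))) := by
      rw [← Finset.sum_ite_mem, ← Finset.sum_ite_mem, ← Finset.sum_ite_mem,
        ← Finset.sum_add_distrib, ← Finset.sum_add_distrib]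
      refine Finset.sum_congr rfl fun q hq => ?_
      have e1 : ¬ (q ∈ A.active (t + 1) ∨ q ∈ A.active t) → occurs E (.phase q (t + 1)) = 0 :=
        fun h => occurs_eq_zero hE (by rw [phase_mem_faults, mem_present_succ]; tauto)
      have e2 : q ∉ A.decoupled (t + 1) → occurs E (.gauge q (t + 1)) = 0 :=
        fun h => occurs_eq_zero hE (by rw [gauge_mem_faults]; tauto)
      simp only [decoupled_succ, Finset.mem_sdiff] at e2 ⊢
      have h2 : (2 : ZMod 2) = 0 := rfl
      by_cases h : q ∈ A.active t <;> by_cases h' : q ∈ A.active (t + 1) <;>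
        simp only [h, h', frame, if_true, if_false, not_true, not_false_iff, and_true, and_false,
          add_zero, zero_add, or_true, or_false, forall_const,
          IsEmpty.forall_iff] at e1 e2 ⊢
      · rw [e2]
        linear_combination (A.frame .phase E q t) * h2
      · linear_combination (A.frame .phase E q t) * h2
      · rw [e2, add_zero]
      · rw [e1, e2, add_zero]
    linear_combination key

end DefectArray

namespace DefectArray

variable {Q d : ℕ} {A : DefectArray Q d}

/-! ## Shell events are degrees -/

lemma mem_ring {i : Fin A.n} {w : Site} : w ∈ A.ring i ↔
    w ∈ A.region .smooth i ∧ ¬ faceCorners w ⊆ A.hole i := Finset.mem_filter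

lemma faceCorners_subset_hole_iff {i : Fin A.n} {w : Site} : faceCorners w ⊆ A.hole i ↔
    ((A.corner i).1 ≤ w.1 ∧ w.1 + 1 ≤ (A.corner i).1 + A.side i) ∧
      ((A.corner i).2 ≤ w.2 ∧ w.2 + 1 ≤ (A.corner i).2 + A.side i) := by
  constructor
  · intro h
    have h1 := A.mem_hole.1 (h (mem_faceCorners.2 (by simp : (w.1 = w.1 ∨ _) ∧ (w.2 = w.2 ∨ _))))
    have h2 := A.mem_hole.1 (h (mem_faceCorners (p := (w.1 + 1, w.2 + 1)).2 (by simp)))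
    simp only at h2
    omega
  · intro h p hp
    rw [mem_faceCorners] at hp
    rw [mem_hole]
    omega

lemma mem_perimeter {i : Fin A.n} {q : Qubit} : q ∈ A.perimeter i ↔ q ∈ idealQubits d ∧
    (q.endPt false ∉ A.hole i ∧ q.endPt true ∉ A.hole i) ∧
      (q.sideFace false ∈ A.ring i ∨ q.sideFace true ∈ A.ring i) := by
  rw [perimeter, Finset.mem_filter, Finset.disjoint_left]
  refine and_congr Iff.rfl (and_congr ?_ ?_)
  · simp only [Qubit.mem_ends]
    constructor
    · exact fun h => ⟨h (.inl rfl), h (.inr rfl)⟩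
    · rintro ⟨h1, h2⟩ p (rfl | rfl)
      exacts [h1, h2]
  · simp only [mem_faceEdges]
    constructor
    · rintro ⟨w, h, rfl | rfl⟩
      exacts [.inl h, .inr h]
    · rintro (h | h)
      exacts [⟨_, h, .inl rfl⟩, ⟨_, h, .inr rfl⟩]

/-- The perimeter of a hole is the boundary of the set of faces that touch it. -/
lemma mem_perimeter_iff {i : Fin A.n} {q : Qubit} (hq : q ∈ idealQubits d) : q ∈ A.perimeter i ↔
    ¬ (q.sideFace false ∈ A.region .smooth i ↔ q.sideFace true ∈ A.region .smooth i) := by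
  have hs := A.one_le_side i
  rw [mem_perimeter, mem_ring, mem_ring, faceCorners_subset_hole_iff, faceCorners_subset_hole_iff]
  simp only [mem_region_smooth, mem_hole, hq, true_and]
  rcases q with p | p <;> simp only [Qubit.endPt, Qubit.sideFace] <;> omega

lemma mem_radial {i : Fin A.n} {q : Qubit} (hq : q ∈ idealQubits d) : q ∈ A.radial i ↔
    ¬ (q.endPt false ∈ A.hole i ↔ q.endPt true ∈ A.hole i) := by
  have he : q.ends = {q.endPt false, q.endPt true} := by
    ext p
    rw [Qubit.mem_ends, Finset.mem_insert, Finset.mem_singleton]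
  have hne := q.endPt_ne
  rw [radial, Finset.mem_filter, he]
  by_cases h1 : q.endPt false ∈ A.hole i <;> by_cases h2 : q.endPt true ∈ A.hole i <;>
    simp [hq, h1, h2, Finset.insert_inter_of_mem, Finset.insert_inter_of_notMem,
      Finset.singleton_inter_of_mem, Finset.singleton_inter_of_notMem, hne]

lemma mem_idealQubits_of_radial {i : Fin A.n} {q : Qubit} (hq : q ∈ A.radial i) :
    q ∈ idealQubits d := (Finset.mem_filter.1 hq).1

lemma enclosable_iff {i : Fin A.n} : A.Enclosable i ↔
    (2 ≤ (A.corner i).1 ∧ (A.corner i).1 + A.side i ≤ (d : ℤ) - 2) ∧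
      (1 ≤ (A.corner i).2 ∧ (A.corner i).2 + A.side i ≤ (d : ℤ) - 2) := by
  simp only [Enclosable, NearRough, NearSmooth]
  omega

/-- The perimeter of an enclosable hole belongs to the code in all rounds. -/
lemma perimeter_subset_active (hQ : 15 < Q) {i : Fin A.n} (hi : A.Enclosable i) (t : ℕ) :
    A.perimeter i ⊆ A.active t := by
  intro q hq
  have hq' := mem_perimeter.1 hq
  rw [enclosable_iff] at hi
  obtain ⟨w, hw, hqw⟩ : ∃ w ∈ A.region .smooth i, q ∈ faceEdges w := by
    rcases hq'.2.2 with h | h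
    · exact ⟨_, (mem_ring.1 h).1, mem_faceEdges.2 (.inl rfl)⟩
    · exact ⟨_, (mem_ring.1 h).1, mem_faceEdges.2 (.inr rfl)⟩
  have hout : ∀ p ∈ q.ends, ∀ k, p ∉ A.hole k := by
    intro p hp k hk
    have hc := mem_faceCorners.1 (mem_faceCorners_of_mem_ends hqw hp)
    obtain rfl : i = k := A.eq_of_near hQ hw (A.region_subset .rough k hk)
      (by rw [abs_le]; omega) (by rw [abs_le]; omega)
    rw [Qubit.mem_ends] at hp
    rcases hp with rfl | rfl
    · exact hq'.2.1.1 hk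
    · exact hq'.2.1.2 hk
  refine mem_active.2 ⟨hq'.1, fun h => ?_, fun p hp h => ?_⟩
  · have h1 := h (q.endPt false) (Qubit.mem_ends.2 (.inl rfl))
    have hp := mem_faceCorners.1 (mem_faceCorners_of_mem_ends hqw
      (Qubit.mem_ends.2 (.inl rfl : q.endPt false = q.endPt false ∨ _)))
    rw [mem_region_smooth] at hw
    rcases h1 with h1 | h1 | ⟨k, -, h1⟩
    · omega
    · omega
    · exact hout _ (Qubit.mem_ends.2 (.inl rfl)) k h1
  · obtain ⟨k, -, h1⟩ := h
    exact hout p hp k h1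

/-- All edges of a face inside a rough hole are removed. On active qubits the ring can therefore be
replaced by the full region, whose boundary is the perimeter. -/
lemma sideFace_mem_ring_iff {i : Fin A.n} {t : ℕ} (hm : A.mode i t = .rough) {q : Qubit}
    (hq : q ∈ A.active t) (c : Bool) :
    q.sideFace c ∈ A.ring i ↔ q.sideFace c ∈ A.region .smooth i := by
  rw [mem_ring, and_iff_left_of_imp]
  intro _ hsub
  refine (mem_active.1 hq).2.1 fun p hp => .inr (.inr ⟨i, hm, hsub ?_⟩)
  refine mem_faceCorners_of_mem_ends (mem_faceEdges.2 ?_) hp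
  cases c <;> simp

/-- The product of the ring plaquettes is supported on the perimeter. -/
lemma sum_ring_eq (hQ : 15 < Q) {i : Fin A.n} (hi : A.Enclosable i) {t : ℕ}
    (hm : A.mode i t = .rough) (F : Qubit → ZMod 2) :
    ∑ w ∈ A.ring i, ∑ q ∈ faceEdges w ∩ A.active t, F q = ∑ q ∈ A.perimeter i, F q := by
  have h1 : ∀ w, ∑ q ∈ faceEdges w ∩ A.active t, F q =
      ∑ q ∈ A.active t, if q ∈ faceEdges w then F q else 0 := fun w => by
    rw [Finset.sum_ite_mem, Finset.inter_comm]
  simp only [h1]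
  rw [Finset.sum_comm, ← Finset.inter_eq_right.2 (perimeter_subset_active hQ hi t),
    ← Finset.sum_ite_mem]
  refine Finset.sum_congr rfl fun q hq => ?_
  have h2 : ∀ w, (if q ∈ faceEdges w then F q else 0) =
      (if q.sideFace false = w then F q else 0) + (if q.sideFace true = w then F q else 0) := by
    intro w
    simp only [mem_faceEdges]
    by_cases h3 : q.sideFace false = w <;> by_cases h4 : q.sideFace true = w
    · exact absurd (h3.trans h4.symm) q.sideFace_ne
    all_goals simp [h3, h4]
  simp only [h2, Finset.sum_add_distrib, Finset.sum_ite_eq, sideFace_mem_ring_iff hm hq,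
    mem_perimeter_iff (mem_active.1 hq).1]
  by_cases h3 : q.sideFace false ∈ A.region .smooth i <;>
    by_cases h4 : q.sideFace true ∈ A.region .smooth i <;>
    simp [h3, h4, CharTwo.add_self_eq_zero]

/-- The errors on a qubit accumulated since its last preparation. -/
lemma frame_eq_sum {err : Qubit → ℕ → Fault} {E : Finset Fault} {q : Qubit} {a : ℕ}
    (ha : a = 0 ∨ q ∉ A.active (a - 1)) : ∀ {t : ℕ}, a ≤ t → (∀ t', a ≤ t' → t' < t → q ∈ A.active t') →
      A.frame err E q t = ∑ t' ∈ Finset.Ico a (t + 1), occurs E (err q t') := by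
  intro t
  induction t with
  | zero =>
    intro h _
    obtain rfl : a = 0 := by omega
    simp [frame]
  | succ t ih =>
    intro h hact
    rw [frame]
    rcases Nat.lt_or_ge t a with h' | h'
    · obtain rfl : a = t + 1 := by omega
      rw [if_neg (by simpa using ha)]
      simp
    · rw [if_pos (hact t h' (by omega)), ih h' fun t' h1 h2 => hact t' h1 (by omega),
        Finset.sum_Ico_succ_top (by omega : a ≤ t + 1)]

lemma shellEnd_cases (i : Fin A.n) (k : ℕ) :
    A.shellEnd i k = d ∨ A.shellEnd i k < d ∧ A.shellEnd i k = (k + 1) * Q ^ A.level i := by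
  rw [shellEnd]; omega

lemma mode_shellEnd_ne (hQ : 0 < Q) {i : Fin A.n} (hi : A.Enclosable i) {k : ℕ}
    (h : A.shellEnd i k < d) : A.mode i (A.shellEnd i k) ≠ A.mode i (k * Q ^ A.level i) := by
  rcases A.shellEnd_cases i k with h' | ⟨-, h'⟩
  · omega
  · rw [h'] at h ⊢
    exact (A.mode_succ_ne hQ hi h).symm

lemma mode_pred_ne (hQ : 0 < Q) {i : Fin A.n} (hi : A.Enclosable i) {k : ℕ} (hk : k ≠ 0)
    (h : k * Q ^ A.level i < d) :
    A.mode i (k * Q ^ A.level i - 1) ≠ A.mode i (k * Q ^ A.level i) := by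
  obtain ⟨k, rfl⟩ : ∃ k', k = k' + 1 := ⟨k - 1, by omega⟩
  have hpos : 0 < Q ^ A.level i := Nat.pow_pos hQ
  have h1 := A.mode_succ_ne hQ hi h
  have h2 : (k + 1) * Q ^ A.level i = k * Q ^ A.level i + Q ^ A.level i := by ring
  rwa [← A.mode_eq_of_div hi (t := (k + 1) * Q ^ A.level i - 1) (by omega) (by omega) (by omega)]
    at h1

lemma start_lt_shellEnd (hQ : 0 < Q) {i : Fin A.n} {k : ℕ} (h : k * Q ^ A.level i < d) :
    k * Q ^ A.level i < A.shellEnd i k := by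
  have hpos : 0 < Q ^ A.level i := Nat.pow_pos hQ
  rw [shellEnd, add_mul]
  omega

lemma mode_in_shell {i : Fin A.n} (hi : A.Enclosable i) {k t : ℕ} (h : k * Q ^ A.level i < d)
    (h1 : k * Q ^ A.level i ≤ t) (h2 : t < A.shellEnd i k) :
    A.mode i t = A.mode i (k * Q ^ A.level i) :=
  A.mode_eq_of_div hi h1 (lt_of_lt_of_le h2 (min_le_left _ _)) h

/-- Perimeter qubits are active in all rounds, so their frames are never reset and the two values of
the super-stabilizer differ by the flips in between. A value known from preparation or readout
carries no measurement error, hence the case distinctions. -/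
lemma smoothShellEvent_eq (hQ : 15 < Q) {E : Finset Fault} {i : Fin A.n} (hi : A.Enclosable i)
    {k : ℕ} (hk : k * Q ^ A.level i < d) (hm : A.mode i (k * Q ^ A.level i) = .smooth) :
    A.smoothShellEvent E i k =
      (if k = 0 then 0 else ∑ w ∈ A.ring i, occurs E (.plaq w (k * Q ^ A.level i - 1))) +
      ((if A.shellEnd i k < d then ∑ w ∈ A.ring i, occurs E (.plaq w (A.shellEnd i k)) else 0) +
      ∑ q ∈ A.perimeter i, ∑ t ∈ Finset.Ico (k * Q ^ A.level i) (A.shellEnd i k + 1),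
        occurs E (.bit q t)) := by
  have hrough : ∀ {b : Boundary}, b ≠ .smooth → b = .rough := by
    intro b; cases b <;> simp
  have hf : ∀ q ∈ A.perimeter i, ∀ t, A.frame .bit E q t =
      ∑ t' ∈ Finset.range (t + 1), occurs E (.bit q t') := by
    intro q hq t
    rw [frame_eq_sum (.inl rfl) (Nat.zero_le t) fun t' _ _ => perimeter_subset_active hQ hi t' hq,
      Finset.range_eq_Ico]
  have hend := start_lt_shellEnd (by omega : 0 < Q) hk
  have hr : ∀ t, A.mode i t = .rough → ∑ w ∈ A.ring i, A.plaqFlip E w t =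
      ∑ w ∈ A.ring i, occurs E (.plaq w t) + ∑ q ∈ A.perimeter i, A.frame .bit E q t := by
    intro t ht
    simp only [plaqFlip]
    rw [Finset.sum_add_distrib, sum_ring_eq hQ hi ht]
  have h2 : (if A.shellEnd i k < d then ∑ w ∈ A.ring i, A.plaqFlip E w (A.shellEnd i k)
      else ∑ q ∈ A.perimeter i, A.frame .bit E q d) =
      (if A.shellEnd i k < d then ∑ w ∈ A.ring i, occurs E (.plaq w (A.shellEnd i k)) else 0) +
      ∑ q ∈ A.perimeter i, A.frame .bit E q (A.shellEnd i k) := by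
    split_ifs with h
    · exact hr _ (hrough (hm ▸ mode_shellEnd_ne (by omega) hi h))
    · rw [zero_add, (A.shellEnd_cases i k).resolve_right fun h' => h h'.1]
  rw [smoothShellEvent, h2]
  by_cases hk0 : k = 0
  · subst hk0
    simp only [if_true, zero_mul, zero_add]
    congr 1
    exact Finset.sum_congr rfl fun q hq => by rw [hf q hq, Finset.range_eq_Ico]
  · have hpos : 0 < k * Q ^ A.level i := Nat.mul_pos (by omega) (Nat.pow_pos (by omega))
    rw [if_neg hk0, if_neg hk0, hr _ (hrough (hm ▸ mode_pred_ne (by omega) hi hk0 hk))]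
    have h3 : ∑ q ∈ A.perimeter i, A.frame .bit E q (k * Q ^ A.level i - 1) +
        ∑ q ∈ A.perimeter i, A.frame .bit E q (A.shellEnd i k) = ∑ q ∈ A.perimeter i,
        ∑ t ∈ Finset.Ico (k * Q ^ A.level i) (A.shellEnd i k + 1), occurs E (.bit q t) := by
      rw [← Finset.sum_add_distrib]
      refine Finset.sum_congr rfl fun q hq => ?_
      rw [hf q hq, hf q hq, Nat.sub_add_cancel hpos, ← Finset.sum_range_add_sum_Ico _
        (show k * Q ^ A.level i ≤ A.shellEnd i k + 1 by omega), ← add_assoc,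
        CharTwo.add_self_eq_zero, zero_add]
    rw [← h3]
    ring

/-- The radial qubits are prepared when the puncture turns rough, or belong to the code from the
start, and stay active until the shell ends. Their frames thus collect exactly the phase flips in
the closed time interval of the shell; noise precedes the final measurement, so its time is
included. -/
lemma roughShellEvent_eq (hQ : 15 < Q) {E : Finset Fault} {i : Fin A.n} (hi : A.Enclosable i)
    {k : ℕ} (hk : k * Q ^ A.level i < d) (hm : A.mode i (k * Q ^ A.level i) = .rough) :
    A.roughShellEvent E i k = ∑ q ∈ A.radial i, occurs E (.gauge q (A.shellEnd i k)) +
      ∑ q ∈ A.radial i, ∑ t ∈ Finset.Ico (k * Q ^ A.level i) (A.shellEnd i k + 1),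
        occurs E (.phase q t) := by
  rw [roughShellEvent]
  simp only [gaugeFlip]
  rw [Finset.sum_add_distrib]
  congr 1
  refine Finset.sum_congr rfl fun q hq => ?_
  have hid := mem_idealQubits_of_radial hq
  rw [mem_radial hid] at hq
  have hend := start_lt_shellEnd (by omega : 0 < Q) hk
  have hx : ∃ p p', p ∈ q.ends ∧ p' ∈ q.ends ∧ p ∈ A.hole i ∧ p' ∉ A.hole i := by
    have m1 : q.endPt false ∈ q.ends := Qubit.mem_ends.2 (.inl rfl)
    have m2 : q.endPt true ∈ q.ends := Qubit.mem_ends.2 (.inr rfl)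
    by_cases h1 : q.endPt false ∈ A.hole i
    · exact ⟨_, _, m1, m2, h1, by tauto⟩
    · exact ⟨_, _, m2, m1, by tauto, h1⟩
  obtain ⟨p, p', hp, hp', hpi, hpi'⟩ := hx
  refine frame_eq_sum ?_ hend.le fun t h1 h2 => ?_
  · by_cases hk0 : k = 0
    · left; simp [hk0]
    · right
      intro hact
      exact mode_pred_ne (by omega) hi hk0 hk ((mode_of_mem_active hact hp hpi).trans hm.symm)
  · have hmt := (mode_in_shell hi hk h1 h2).trans hm
    have hnear : ∀ x ∈ q.ends, |p.1 - x.1| ≤ 2 ∧ |p.2 - x.2| ≤ 2 := by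
      intro x hx
      rw [Qubit.mem_ends] at hx hp
      rcases q with y | y <;> simp only [Qubit.endPt] at hx hp <;> rcases hx with rfl | rfl <;>
        rcases hp with rfl | rfl <;> simp
    have hother : ∀ x ∈ q.ends, ∀ j, x ∈ A.hole j → j = i := fun x hx j hj =>
      (A.eq_of_near hQ (A.region_subset .rough i hpi) (A.region_subset .rough j hj)
        (hnear x hx).1 (hnear x hx).2).symm
    refine mem_active.2 ⟨hid, fun h => ?_, fun x hx ⟨j, hj, hxj⟩ => ?_⟩
    · rw [enclosable_iff] at hi
      have := A.mem_hole.1 hpi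
      have hb : 1 ≤ p'.1 ∧ p'.1 < d := by
        rw [Qubit.mem_ends] at hp hp'
        rcases q with y | y <;> simp only [Qubit.endPt] at hp hp' <;>
          rcases hp' with rfl | rfl <;> rcases hp with rfl | rfl <;> omega
      rcases h p' hp' with h' | h' | ⟨j, -, hj⟩
      · omega
      · omega
      · exact hpi' (hother p' hp' j hj ▸ hj)
    · rw [hother x hx j hxj, hmt] at hj
      cases hj

end DefectArray

namespace DefectArray

variable {Q d : ℕ} {A : DefectArray Q d}

lemma joins_eq_shell_iff (hQ : 15 < Q) {b : Boundary} {f : Fault} {c : Bool} {i : Fin A.n} {k : ℕ} :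
    A.joins b f c = .shell i k ↔ A.InShell b i k (f.ends c) := A.node_eq_shell_iff hQ

lemma inShell_iff {b : Boundary} {i : Fin A.n} {k : ℕ} (hi : A.Enclosable i)
    (hk : k * Q ^ A.level i < d) (hm : A.mode i (k * Q ^ A.level i) = b) (c : Cell) :
    A.InShell b i k c ↔ c.1 ∈ A.region b i ∧ k * Q ^ A.level i ≤ c.2 ∧ c.2 ≤ A.shellEnd i k := by
  simp [InShell, hi, hk, hm]

lemma not_iff_and_iff {p q r : Prop} : ¬ (p ↔ q) ∧ r ↔ ¬ (p ∧ r ↔ q ∧ r) := by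
  tauto

lemma or_of_mem_iff {p q r : Prop} (h : r ↔ ¬ (p ↔ q)) : (p ↔ q) ∧ ¬ r ∨ ¬ (p ↔ q) ∧ r := by
  tauto

/-- An error changes the parity exactly when one of its two cells lies in the shell. A bit flip then
lies on the perimeter, and a wrong plaquette outcome straddles an end of the time interval; these
are the errors listed in `smoothShellEvent_eq`. -/
theorem nodeDeg_smooth_shell (hQ : 15 < Q) {E : Finset Fault} (hE : E ⊆ A.faults) {i : Fin A.n}
    (hi : A.Enclosable i) {k : ℕ} (hk : k * Q ^ A.level i < d)
    (hm : A.mode i (k * Q ^ A.level i) = .smooth) :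
    nodeDeg (A.joins .smooth) (partOf .smooth E) (.shell i k) = A.smoothShellEvent E i k := by
  have hend := start_lt_shellEnd (by omega : 0 < Q) hk
  have hrough : ∀ {b : Boundary}, b ≠ .smooth → b = .rough := by
    intro b; cases b <;> simp
  rw [smoothShellEvent_eq hQ hi hk hm, nodeDeg_eq_sum_occurs (T :=
    (if k = 0 then ∅ else (A.ring i).image (Fault.plaq · (k * Q ^ A.level i - 1))) ∪
      ((if A.shellEnd i k < d then (A.ring i).image (Fault.plaq · (A.shellEnd i k)) else ∅) ∪
        (A.perimeter i ×ˢ Finset.Ico (k * Q ^ A.level i) (A.shellEnd i k + 1)).image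
          fun x => Fault.bit x.1 x.2))]
  · rw [Finset.sum_union, Finset.sum_union, Finset.sum_image, Finset.sum_product]
    · congr 1
      · split_ifs
        · rfl
        · rw [Finset.sum_image]
          intro a _ b _ h; simpa using h
      · congr 1
        split_ifs
        · rw [Finset.sum_image]
          intro a _ b _ h; simpa using h
        · rfl
    · intro a _ b _ h
      simpa [Prod.ext_iff] using h
    · split_ifs
      · rw [Finset.disjoint_left]
        intro f hf
        obtain ⟨q, -, rfl⟩ := Finset.mem_image.1 hf
        simp
      · simp
    · rw [Finset.disjoint_left]
      intro f hf hf'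
      obtain ⟨w, rfl⟩ : ∃ w, f = Fault.plaq w (k * Q ^ A.level i - 1) := by
        split_ifs at hf
        · simp at hf
        · obtain ⟨w, -, rfl⟩ := Finset.mem_image.1 hf
          exact ⟨w, rfl⟩
      rcases Finset.mem_union.1 hf' with h | h
      · split_ifs at h
        · obtain ⟨w', -, h'⟩ := Finset.mem_image.1 h
          have := (Fault.plaq.inj h').2
          omega
        · simp at h
      · obtain ⟨x, -, h'⟩ := Finset.mem_image.1 h
        cases h'
  · intro f hf
    simp only [Finset.mem_union, Finset.mem_image] at hf
    rcases hf with hf | hf | ⟨x, -, rfl⟩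
    · split_ifs at hf
      · simp at hf
      · obtain ⟨w, -, rfl⟩ := Finset.mem_image.1 hf; rfl
    · split_ifs at hf
      · obtain ⟨w, -, rfl⟩ := Finset.mem_image.1 hf; rfl
      · simp at hf
    · rfl
  · intro f hfE hkind
    refine or_of_mem_iff ?_
    rw [joins_eq_shell_iff hQ, joins_eq_shell_iff hQ, inShell_iff hi hk hm, inShell_iff hi hk hm]
    have hff := hE hfE
    cases f with
    | phase q t => cases hkind
    | star v t => cases hkind
    | gauge q t => cases hkind
    | bit q t =>
      rw [bit_mem_faults] at hff
      have hid := mem_idealQubits_of_present hff.2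
      have h1 : Fault.bit q t ∉
          (if k = 0 then ∅ else (A.ring i).image (Fault.plaq · (k * Q ^ A.level i - 1))) := by
        split_ifs <;> simp
      have h2 : Fault.bit q t ∉
          (if A.shellEnd i k < d then (A.ring i).image (Fault.plaq · (A.shellEnd i k)) else ∅) := by
        split_ifs <;> simp
      have h3 : (Fault.bit q t ∈
          (A.perimeter i ×ˢ Finset.Ico (k * Q ^ A.level i) (A.shellEnd i k + 1)).image
          fun x => Fault.bit x.1 x.2) ↔
          q ∈ A.perimeter i ∧ k * Q ^ A.level i ≤ t ∧ t ≤ A.shellEnd i k := by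
        simp
      rw [Finset.mem_union, Finset.mem_union, or_iff_right h1, or_iff_right h2, h3,
        mem_perimeter_iff hid]
      exact not_iff_and_iff
    | plaq w t =>
      rw [plaq_mem_faults] at hff
      have h1 : (Fault.plaq w t ∈
          (if k = 0 then ∅ else (A.ring i).image (Fault.plaq · (k * Q ^ A.level i - 1)))) ↔
          w ∈ A.ring i ∧ k ≠ 0 ∧ t = k * Q ^ A.level i - 1 := by
        split_ifs with h
        · simp [h]
        · simp only [Finset.mem_image, Fault.plaq.injEq]
          exact ⟨fun ⟨w', h1, h2, h3⟩ => ⟨h2 ▸ h1, h, h3.symm⟩,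
            fun ⟨h1, h2, h3⟩ => ⟨w, h1, rfl, h3.symm⟩⟩
      have h2 : (Fault.plaq w t ∈
          (if A.shellEnd i k < d then (A.ring i).image (Fault.plaq · (A.shellEnd i k)) else ∅)) ↔
          w ∈ A.ring i ∧ A.shellEnd i k < d ∧ t = A.shellEnd i k := by
        split_ifs with h
        · simp only [Finset.mem_image, Fault.plaq.injEq]
          exact ⟨fun ⟨w', h1, h2, h3⟩ => ⟨h2 ▸ h1, h, h3.symm⟩,
            fun ⟨h1, h2, h3⟩ => ⟨w, h1, rfl, h3.symm⟩⟩
        · simp [h]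
      have h3 : Fault.plaq w t ∉
          (A.perimeter i ×ˢ Finset.Ico (k * Q ^ A.level i) (A.shellEnd i k + 1)).image
          fun x => Fault.bit x.1 x.2 := by simp
      have hring : A.mode i t = .rough → (w ∈ A.ring i ↔ w ∈ A.region .smooth i) := by
        intro hmt
        rw [mem_ring, and_iff_left_of_imp]
        exact fun _ hsub => (mem_faces.1 hff.2).2.1 fun p hp => .inr (.inr ⟨i, hmt, hsub hp⟩)
      have hpos : 0 < Q ^ A.level i := Nat.pow_pos (by omega)
      have hk0 : k = 0 → k * Q ^ A.level i = 0 := fun h => by simp [h]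
      have hk1 : k ≠ 0 → 0 < k * Q ^ A.level i := fun h => Nat.mul_pos (by omega) hpos
      have hreg : w ∈ A.region .smooth i → A.mode i t = .rough := mode_of_mem_faces hff.2
      have hri : w ∈ A.ring i ↔ w ∈ A.region .smooth i :=
        ⟨fun h => (mem_ring.1 h).1, fun h => (hring (hreg h)).2 h⟩
      rw [Finset.mem_union, Finset.mem_union, h1, h2, hri]
      simp only [Fault.ends, cond_true, cond_false, h3, or_false]
      -- A plaquette error joins times `t` and `t + 1`, so it straddles the closed interval only
      -- when `t + 1` is its start or `t` is its end. In the latter case `shellEnd < d`, because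
      -- plaquette errors have `t < d`.
      by_cases hw : w ∈ A.region .smooth i
      · simp only [hw, true_and]
        by_cases hk' : k = 0
        · have := hk0 hk'
          omega
        · have := hk1 hk'
          omega
      · simp [hw]

theorem nodeDeg_rough_shell (hQ : 15 < Q) {E : Finset Fault} (hE : E ⊆ A.faults) {i : Fin A.n}
    (hi : A.Enclosable i) {k : ℕ} (hk : k * Q ^ A.level i < d)
    (hm : A.mode i (k * Q ^ A.level i) = .rough) :
    nodeDeg (A.joins .rough) (partOf .rough E) (.shell i k) = A.roughShellEvent E i k := by
  have hend := start_lt_shellEnd (by omega : 0 < Q) hk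
  rw [roughShellEvent_eq hQ hi hk hm, nodeDeg_eq_sum_occurs (T :=
    (A.radial i).image (Fault.gauge · (A.shellEnd i k)) ∪
      (A.radial i ×ˢ Finset.Ico (k * Q ^ A.level i) (A.shellEnd i k + 1)).image
          fun x => Fault.phase x.1 x.2)]
  · rw [Finset.sum_union, Finset.sum_image, Finset.sum_image, Finset.sum_product]
    · intro a _ b _ h
      simpa [Prod.ext_iff] using h
    · intro a _ b _ h; simpa using h
    · rw [Finset.disjoint_left]
      intro f hf
      obtain ⟨q, -, rfl⟩ := Finset.mem_image.1 hf
      simp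
  · intro f hf
    simp only [Finset.mem_union, Finset.mem_image] at hf
    rcases hf with ⟨x, -, rfl⟩ | ⟨x, -, rfl⟩ <;> rfl
  · intro f hfE hkind
    refine or_of_mem_iff ?_
    rw [joins_eq_shell_iff hQ, joins_eq_shell_iff hQ, inShell_iff hi hk hm, inShell_iff hi hk hm]
    have hff := hE hfE
    cases f with
    | bit q t => cases hkind
    | plaq w t => cases hkind
    | phase q t =>
      rw [phase_mem_faults] at hff
      have hid := mem_idealQubits_of_present hff.2
      have h3 : (Fault.phase q t ∈ (A.radial i).image (Fault.gauge · (A.shellEnd i k)) ∪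
          (A.radial i ×ˢ Finset.Ico (k * Q ^ A.level i) (A.shellEnd i k + 1)).image
          fun x => Fault.phase x.1 x.2) ↔
          q ∈ A.radial i ∧ k * Q ^ A.level i ≤ t ∧ t ≤ A.shellEnd i k := by
        simp
      rw [h3, mem_radial hid]
      exact not_iff_and_iff
    | star v t =>
      rw [star_mem_faults, mem_stars] at hff
      have := hff.2.2 i
      simp [Fault.ends, region, this]
    | gauge q t =>
      rw [gauge_mem_faults] at hff
      have hid : q ∈ idealQubits d := mem_idealQubits_of_present (Finset.mem_union_right _ hff.2)
      have h3 : (Fault.gauge q t ∈ (A.radial i).image (Fault.gauge · (A.shellEnd i k)) ∪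
          (A.radial i ×ˢ Finset.Ico (k * Q ^ A.level i) (A.shellEnd i k + 1)).image
          fun x => Fault.phase x.1 x.2) ↔ q ∈ A.radial i ∧ t = A.shellEnd i k := by
        simp [eq_comm]
      -- As long as the puncture stays rough, no edge that touches it is measured out, since no
      -- other puncture touches this edge. Gauge errors on radial edges within the shell therefore
      -- occur only at its final time.
      have htime : ∀ p ∈ q.ends, p ∈ A.hole i → k * Q ^ A.level i ≤ t → t ≤ A.shellEnd i k →
          t = A.shellEnd i k ∨ ∀ x ∈ q.ends, x ∈ A.hole i := by
        intro p hp hpi h1 h2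
        by_contra hcon
        push Not at hcon
        have hmt := (mode_in_shell hi hk h1 (by omega)).trans hm
        obtain ⟨hlt, x, hx, hxi⟩ := hcon
        rcases t with _ | t
        · simp [decoupled] at hff
        · rw [decoupled_succ, Finset.mem_sdiff] at hff
          refine hff.2.2 ((active_congr fun y hy j hyj => ?_).1 hff.2.1)
          have hji : i = j := by
            refine A.eq_of_near hQ (A.region_subset .rough i hpi) (A.region_subset .rough j hyj) ?_ ?_
            all_goals
              rw [Qubit.mem_ends] at hy hp
              rcases q with z | z <;> simp only [Qubit.endPt] at hy hp <;>
                rcases hy with rfl | rfl <;> rcases hp with rfl | rfl <;> simp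
          subst hji
          rw [mode_of_mem_active hff.2.1 hy hyj, hmt]
      have e1 := htime (q.endPt false) (Qubit.mem_ends.2 (.inl rfl))
      have e2 := htime (q.endPt true) (Qubit.mem_ends.2 (.inr rfl))
      simp only [Qubit.mem_ends, forall_eq_or_imp, forall_eq] at e1 e2
      rw [h3, mem_radial hid]
      simp only [Fault.ends, region]
      rw [← not_iff_and_iff]
      constructor
      · rintro ⟨h1, rfl⟩
        exact ⟨h1, hend.le, le_rfl⟩
      · rintro ⟨h1, h2, h3⟩
        refine ⟨h1, ?_⟩
        by_cases ha : q.endPt false ∈ A.hole i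
        · exact (e1 ha h2 h3).resolve_right fun h => h1 (iff_of_true h.1 h.2)
        · have hb : q.endPt true ∈ A.hole i := by
            by_contra hb
            exact h1 (iff_of_false ha hb)
          exact (e2 hb h2 h3).resolve_right fun h => h1 (iff_of_true h.1 h.2)

/-! ## Detection events are degrees in the decoding graphs -/

/-- If a puncture at this face were smooth in round `t` or `t - 1`, the cell would be absorbed by a
shell when the puncture alternates, and by a boundary node when it is permanent. -/
lemma mode_of_not_inShell (hQ : 15 < Q) {w : Site} {t : ℕ} (ht : t ≤ d) (hd : 0 < d)
    (h1 : ∀ i k, ¬ A.InShell .smooth i k (w, t)) (h2 : ¬ A.Low .smooth w)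
    (h3 : ¬ A.High .smooth w) {i : Fin A.n} (hw : w ∈ A.region .smooth i) :
    A.mode i t = .rough ∧ (t = 0 ∨ A.mode i (t - 1) = .rough) := by
  have hperm : ¬ A.Enclosable i → ∀ t', A.mode i t' = .smooth → False := by
    intro hi t' hm
    have hns := A.nearSmooth_of_mode hi hm
    have hm0 : A.mode i 0 = .smooth := (A.mode_of_not_enclosable hi 0 t').trans hm
    rcases hns with h | h
    · exact h2 (.inr ⟨i, hi, hm0, hw, h⟩)
    · exact h3 (.inr ⟨i, hi, hm0, hw, h⟩)
  constructor
  · cases hm : A.mode i t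
    · rfl
    · by_cases hi : A.Enclosable i
      · obtain ⟨k, hk⟩ := A.exists_inShell_of_mode (by omega) hd hi hw ht hm
        exact (h1 i k hk).elim
      · exact (hperm hi t hm).elim
  · rcases t with _ | t
    · exact .inl rfl
    · right
      cases hm : A.mode i t
      · exact hm
      · by_cases hi : A.Enclosable i
        · obtain ⟨k, hk⟩ := A.exists_inShell_of_mode_pred (by omega) hi hw ht hm
          exact (h1 i k hk).elim
        · exact (hperm hi t hm).elim

/-- An ordinary cell reached by a possible error carries a detector. So a vanishing syndrome
controls every cell whose degree could be non-zero, although many cells have no detector. -/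
lemma face_valid_of_fault (hQ : 15 < Q) {f : Fault} (hf : f ∈ A.faults) (hk : f.kind = .smooth)
    {e : Bool} {w : Site} {t : ℕ} (hc : A.joins .smooth f e = .cell (w, t)) :
    t ≤ d ∧ w ∈ A.faces t ∧ (t = 0 ∨ w ∈ A.faces (t - 1)) := by
  obtain ⟨h0, h1, h2, h3⟩ := A.node_eq_cell hc
  rw [h0] at h1 h2 h3
  simp only at h2 h3
  cases f with
  | phase q t => cases hk
  | star v t => cases hk
  | gauge q t => cases hk
  | bit q t' =>
    simp only [Fault.ends, Prod.mk.injEq] at h0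
    obtain ⟨h0, rfl⟩ := h0
    rw [bit_mem_faults] at hf
    have hid := mem_idealQubits_of_present hf.2
    have hqw : q ∈ faceEdges w := by
      rw [mem_faceEdges]
      cases e <;> simp [h0]
    have hwid : w ∈ idealFaces d := by
      simp only [Low, High, not_or] at h2 h3
      rw [mem_faceEdges] at hqw
      rw [mem_idealFaces]
      rcases q with p | p
      · rw [mem_idealQubits_hor] at hid
        rcases hqw with rfl | rfl <;> simp only [Qubit.sideFace] at h2 h3 ⊢ <;> omega
      · rw [mem_idealQubits_ver] at hid
        rcases hqw with rfl | rfl <;> simp only [Qubit.sideFace] at h2 h3 ⊢ <;> omega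
    have hd : 0 < d := by
      rw [mem_idealFaces] at hwid
      omega
    have hmode := fun i => mode_of_not_inShell hQ hf.1 hd h1 h2 h3 (i := i)
    have hface : ∀ t, (∀ i, w ∈ A.region .smooth i → A.mode i t = .rough) → q ∈ A.active t →
        w ∈ A.faces t := by
      intro t hm hq
      refine mem_faces.2 ⟨hwid, fun h => ?_, ?_⟩
      · exact (mem_active.1 hq).2.1 fun p hp => h p (mem_faceCorners_of_mem_ends hqw hp)
      · rintro p hp ⟨i, hs, hpi⟩
        rw [hm i (A.mem_region_iff_touch.2 ⟨p, hp, hpi⟩)] at hs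
        cases hs
    refine ⟨hf.1, ?_⟩
    rcases t' with _ | t
    · rw [present_zero] at hf
      exact ⟨hface 0 (fun i hi => (hmode i hi).1) hf.2, .inl rfl⟩
    · have hm1 : ∀ i, w ∈ A.region .smooth i → A.mode i (t + 1) = .rough :=
        fun i hi => (hmode i hi).1
      have hm2 : ∀ i, w ∈ A.region .smooth i → A.mode i t = .rough :=
        fun i hi => by simpa using (hmode i hi).2
      have hiff : w ∈ A.faces (t + 1) ↔ w ∈ A.faces t :=
        faces_congr fun i hi => (hm1 i hi).trans (hm2 i hi).symm
      rw [mem_present_succ] at hf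
      simp only [Nat.add_sub_cancel]
      rcases hf.2 with h | h
      · exact ⟨hface _ hm1 h, .inr (hiff.1 (hface _ hm1 h))⟩
      · exact ⟨hiff.2 (hface _ hm2 h), .inr (hface _ hm2 h)⟩
  | plaq w' t' =>
    rw [plaq_mem_faults] at hf
    have hd : 0 < d := by omega
    cases e
    · simp only [Fault.ends, cond_false, Prod.mk.injEq] at h0
      obtain ⟨rfl, rfl⟩ := h0
      have hmode := fun i => mode_of_not_inShell hQ hf.1.le hd h1 h2 h3 (i := i)
      refine ⟨hf.1.le, hf.2, ?_⟩
      rcases t' with _ | t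
      · exact .inl rfl
      · right
        refine (faces_congr fun i hi => ?_).1 hf.2
        rw [(hmode i hi).1, (hmode i hi).2.resolve_left (by omega)]
    · simp only [Fault.ends, cond_true, Prod.mk.injEq] at h0
      obtain ⟨rfl, rfl⟩ := h0
      have hmode := fun i => mode_of_not_inShell hQ hf.1 hd h1 h2 h3 (i := i)
      refine ⟨hf.1, (faces_congr fun i hi => ?_).1 hf.2, .inr hf.2⟩
      have e := (hmode i hi).2.resolve_left (by omega)
      simp only [Nat.succ_eq_add_one, Nat.add_sub_cancel] at e
      rw [e, (hmode i hi).1]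

/-- A data or gauge error needs a qubit active in round `t` or `t - 1`. If its end point were in a
hole, that hole would then be rough, and the cell would belong to a shell or to a boundary. -/
lemma vertex_valid_of_fault (hQ : 15 < Q) {f : Fault} (hf : f ∈ A.faults) (hk : f.kind = .rough)
    {e : Bool} {v : Site} {t : ℕ} (hc : A.joins .rough f e = .cell (v, t)) :
    t ≤ d ∧ v ∈ A.stars := by
  obtain ⟨h0, h1, h2, h3⟩ := A.node_eq_cell hc
  rw [h0] at h1 h2 h3
  simp only at h2 h3
  have key : ∀ q t, t ≤ d → q ∈ A.present t → (∀ i k, ¬ A.InShell .rough i k (v, t)) →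
      q.endPt e = v → v ∈ A.stars := by
    intro q t ht hq h1 hv
    have hid := mem_idealQubits_of_present hq
    have hmem : v ∈ q.ends := Qubit.mem_ends.2 (by cases e <;> simp [hv])
    have hvid : v ∈ idealVertices d := by
      simp only [Low, High, not_or] at h2 h3
      rw [mem_idealVertices]
      rw [Qubit.mem_ends] at hmem
      rcases q with p | p
      · rw [mem_idealQubits_hor] at hid
        rcases hmem with rfl | rfl <;> (try simp only [Qubit.endPt] at h2 h3 ⊢) <;> omega
      · rw [mem_idealQubits_ver] at hid
        rcases hmem with rfl | rfl <;> (try simp only [Qubit.endPt] at h2 h3 ⊢) <;> omega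
    have hd : 0 < d := by
      rw [mem_idealVertices] at hvid
      omega
    refine mem_stars.2 ⟨hvid, fun i hi => ?_⟩
    have hperm : ¬ A.Enclosable i → ∀ t', A.mode i t' = .rough → False := by
      intro hn t' hm
      have hm0 : A.mode i 0 = .rough := (A.mode_of_not_enclosable hn 0 t').trans hm
      rcases A.nearRough_of_mode hn hm with h | h
      · exact h2 (.inr ⟨i, hn, hm0, hi, h⟩)
      · exact h3 (.inr ⟨i, hn, hm0, hi, h⟩)
    have hact : ∀ t', t' = t ∨ t' + 1 = t → q ∈ A.active t' → False := by
      intro t' htt hq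
      have hm := mode_of_mem_active hq hmem hi
      by_cases hn : A.Enclosable i
      · rcases htt with rfl | rfl
        · obtain ⟨k, hk⟩ := A.exists_inShell_of_mode (by omega) hd hn (b := .rough) hi ht hm
          exact h1 i k hk
        · obtain ⟨k, hk⟩ := A.exists_inShell_of_mode_pred (by omega) hn (b := .rough) hi ht hm
          exact h1 i k hk
      · exact hperm hn t' hm
    rcases t with _ | t
    · rw [present_zero] at hq
      exact hact 0 (.inl rfl) hq
    · rw [mem_present_succ] at hq
      rcases hq with hq | hq
      · exact hact _ (.inl rfl) hq
      · exact hact _ (.inr rfl) hq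
  cases f with
  | bit q t => cases hk
  | plaq v t => cases hk
  | phase q t' =>
    simp only [Fault.ends, Prod.mk.injEq] at h0
    obtain ⟨h0, rfl⟩ := h0
    rw [phase_mem_faults] at hf
    exact ⟨hf.1, key q t' hf.1 hf.2 h1 h0⟩
  | gauge q t' =>
    simp only [Fault.ends, Prod.mk.injEq] at h0
    obtain ⟨h0, rfl⟩ := h0
    rw [gauge_mem_faults] at hf
    exact ⟨hf.1.le, key q t' hf.1.le (Finset.mem_union_right _ hf.2) h1 h0⟩
  | star v' t' =>
    rw [star_mem_faults] at hf
    cases e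
    · simp only [Fault.ends, cond_false, Prod.mk.injEq] at h0
      obtain ⟨rfl, rfl⟩ := h0
      exact ⟨hf.1.le, hf.2⟩
    · simp only [Fault.ends, cond_true, Prod.mk.injEq] at h0
      obtain ⟨rfl, rfl⟩ := h0
      exact ⟨hf.1, hf.2⟩

/-- Being measured in round `t` excludes the rounds of a smooth shell, and being measured in round
`t - 1` excludes its closing time slice. -/
lemma node_of_face_valid {w : Site} {t : ℕ} (h1 : w ∈ A.faces t)
    (h2 : t = 0 ∨ w ∈ A.faces (t - 1)) : A.node .smooth (w, t) = .cell (w, t) := by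
  have hid := mem_idealFaces.1 (mem_faces.1 h1).1
  have hshell : ¬ ∃ i k, A.InShell .smooth i k (w, t) := by
    rintro ⟨i, k, hw, hi, hk, hm, ha, hb⟩
    simp only at ha hb hw
    rcases Nat.lt_or_ge t (A.shellEnd i k) with h | h
    · have := (mode_in_shell hi hk ha h).trans hm
      rw [mode_of_mem_faces h1 hw] at this
      cases this
    · have hpos : 0 < Q ^ A.level i := by
        rcases Nat.eq_zero_or_pos (Q ^ A.level i) with h0 | h0
        · have := A.side_le i
          have := A.one_le_side i
          omega
        · exact h0
      have hlt : k * Q ^ A.level i < A.shellEnd i k := by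
        rw [shellEnd, add_mul]; omega
      have h3 := h2.resolve_left (by omega)
      have := (mode_in_shell hi hk (t := t - 1) (by omega) (by omega)).trans hm
      rw [mode_of_mem_faces h3 hw] at this
      cases this
  have hp : ∀ i, ¬ A.Enclosable i → A.mode i 0 = .smooth → w ∈ A.region .smooth i → False := by
    intro i hi hm hw
    have := (A.mode_of_not_enclosable hi t 0).trans hm
    rw [mode_of_mem_faces h1 hw] at this
    cases this
  have hlow : ¬ A.Low .smooth w := by
    rintro (h | ⟨i, hi, hm, hw, -⟩)
    · omega
    · exact hp i hi hm hw
  have hhigh : ¬ A.High .smooth w := by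
    rintro (h | ⟨i, hi, hm, hw, -⟩)
    · omega
    · exact hp i hi hm hw
  rw [node, dif_neg hshell, if_neg hlow, if_neg hhigh]

lemma node_of_vertex_valid {v : Site} (t : ℕ) (h : v ∈ A.stars) :
    A.node .rough (v, t) = .cell (v, t) := by
  rw [mem_stars, mem_idealVertices] at h
  have hshell : ¬ ∃ i k, A.InShell .rough i k (v, t) := fun ⟨i, k, hv, _⟩ => h.2 i hv
  have hlow : ¬ A.Low .rough v := by
    rintro (h' | ⟨i, hi, hm, hv, -⟩)
    · omega
    · exact h.2 i hv
  have hhigh : ¬ A.High .rough v := by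
    rintro (h' | ⟨i, hi, hm, hv, -⟩)
    · omega
    · exact h.2 i hv
  rw [node, dif_neg hshell, if_neg hlow, if_neg hhigh]

/-- Every detection event vanishes identically or is the degree of a node. -/
theorem syndrome_eq_nodeDeg (hQ : 15 < Q) (x : Detector A.n) :
    (∀ E ⊆ A.faults, A.syndrome E x = 0) ∨ ∃ b n, n ≠ .lo ∧ n ≠ .hi ∧
      ∀ E ⊆ A.faults, A.syndrome E x = nodeDeg (A.joins b) (partOf b E) n := by
  cases x with
  | face w t =>
    by_cases h : t ≤ d ∧ w ∈ A.faces t ∧ (t = 0 ∨ w ∈ A.faces (t - 1))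
    · refine .inr ⟨.smooth, .cell (w, t), by simp, by simp, fun E hE => ?_⟩
      rw [nodeDeg_cell (node_of_face_valid h.2.1 h.2.2), ← face_event_eq hE h.2.1 h.2.2]
      simp only [syndrome, if_pos h]
    · exact .inl fun E _ => by simp only [syndrome, if_neg h]
  | vertex v t =>
    by_cases h : t ≤ d ∧ v ∈ A.stars
    · refine .inr ⟨.rough, .cell (v, t), by simp, by simp, fun E hE => ?_⟩
      rw [nodeDeg_cell (node_of_vertex_valid t h.2), ← vertex_event_eq hE]
      simp only [syndrome, if_pos h]
    · exact .inl fun E _ => by simp only [syndrome, if_neg h]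
  | shell i k =>
    by_cases h : A.Enclosable i ∧ k * Q ^ A.level i < d
    · refine .inr ⟨A.mode i (k * Q ^ A.level i), .shell i k, by simp, by simp, fun E hE => ?_⟩
      simp only [syndrome, if_pos h]
      cases hm : A.mode i (k * Q ^ A.level i)
      · exact (nodeDeg_rough_shell hQ hE h.1 h.2 hm).symm
      · exact (nodeDeg_smooth_shell hQ hE h.1 h.2 hm).symm
    · exact .inl fun E _ => by simp only [syndrome, if_neg h]

/-- Errors without detection events have even degree at all nodes except the boundaries. -/
theorem nodeDeg_eq_zero_of_syndrome (hQ : 15 < Q) {E : Finset Fault} (hE : E ⊆ A.faults)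
    (hs : A.syndrome E = 0) (b : Boundary) {n : Node A.n} (h1 : n ≠ .lo) (h2 : n ≠ .hi) :
    nodeDeg (A.joins b) (partOf b E) n = 0 := by
  classical
  by_contra hne
  obtain ⟨f, hf, e, hfe⟩ : ∃ f ∈ partOf b E, ∃ e, A.joins b f e = n := by
    by_contra hcon
    push Not at hcon
    exact hne (Finset.sum_eq_zero fun f hf => by simp [hcon f hf])
  rw [partOf, Finset.mem_filter] at hf
  have hff := hE hf.1
  apply hne
  cases n with
  | lo => exact absurd rfl h1
  | hi => exact absurd rfl h2
  | cell c =>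
    obtain ⟨w, t⟩ := c
    cases b
    · have hv := vertex_valid_of_fault hQ hff hf.2 hfe
      rw [nodeDeg_cell (node_of_vertex_valid t hv.2), ← vertex_event_eq hE]
      have := congrFun hs (.vertex w t)
      simpa only [syndrome, if_pos hv, Pi.zero_apply] using this
    · have hv := face_valid_of_fault hQ hff hf.2 hfe
      rw [nodeDeg_cell (node_of_face_valid hv.2.1 hv.2.2), ← face_event_eq hE hv.2.1 hv.2.2]
      have := congrFun hs (.face w t)
      simpa only [syndrome, if_pos hv, Pi.zero_apply] using this
  | shell i k =>
    obtain ⟨-, hi, hk, hm, -⟩ := (joins_eq_shell_iff hQ).1 hfe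
    have := congrFun hs (.shell i k)
    simp only [syndrome, if_pos (And.intro hi hk), hm] at this
    cases b
    · rw [nodeDeg_rough_shell hQ hE hi hk hm]
      exact this
    · rw [nodeDeg_smooth_shell hQ hE hi hk hm]
      exact this

end DefectArray

/-! ## Potentials of logical operators -/

/-- The sum of `p` over the integers between `x` and `h`. -/
def fill (h : ℤ) (p : ℤ → ZMod 2) (x : ℤ) : ZMod 2 :=
  ∑ y ∈ Finset.Ico x h, p y + ∑ y ∈ Finset.Ico h x, p y

lemma fill_add_fill_succ (h : ℤ) (p : ℤ → ZMod 2) (x : ℤ) : fill h p x + fill h p (x + 1) = p x := by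
  have h2 : (2 : ZMod 2) = 0 := rfl
  rcases lt_or_ge x h with hx | hx
  · have e1 : Finset.Ico x h = insert x (Finset.Ico (x + 1) h) := by
      ext y; simp only [Finset.mem_Ico, Finset.mem_insert]; omega
    rw [fill, fill, e1, Finset.sum_insert (by simp), Finset.Ico_eq_empty (a := h) (b := x) (by omega),
      Finset.Ico_eq_empty (a := h) (b := x + 1) (by omega)]
    simp only [Finset.sum_empty]
    linear_combination (∑ y ∈ Finset.Ico (x + 1) h, p y) * h2
  · have e1 : Finset.Ico h (x + 1) = insert x (Finset.Ico h x) := by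
      ext y; simp only [Finset.mem_Ico, Finset.mem_insert]; omega
    rw [fill, fill, e1, Finset.sum_insert (by simp), Finset.Ico_eq_empty (a := x) (b := h) (by omega),
      Finset.Ico_eq_empty (a := x + 1) (b := h) (by omega)]
    simp only [Finset.sum_empty]
    linear_combination (∑ y ∈ Finset.Ico h x, p y) * h2

lemma fill_self (h : ℤ) (p : ℤ → ZMod 2) : fill h p h = 0 := by simp [fill]

lemma exists_of_fill_ne_zero {h : ℤ} {p : ℤ → ZMod 2} {x : ℤ} (hx : fill h p x ≠ 0) :
    ∃ y, p y ≠ 0 ∧ (x ≤ y ∧ y < h ∨ h ≤ y ∧ y < x) := by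
  by_contra hcon
  push Not at hcon
  apply hx
  rw [fill, Finset.sum_eq_zero, Finset.sum_eq_zero, add_zero]
  · intro y hy
    by_contra hne
    rw [Finset.mem_Ico] at hy
    have := (hcon y hne).2 hy.1
    omega
  · intro y hy
    by_contra hne
    rw [Finset.mem_Ico] at hy
    have := (hcon y hne).1 hy.1
    omega

/-- A one-cochain on the square lattice becomes exact when straight lines from the faces with
non-zero curl to far away are added to it. -/
lemma exists_potential (H V : ℤ → ℤ → ZMod 2) (h D : ℤ) (hV : ∀ y, V D y = 0) :
    ∃ φ ext : ℤ → ℤ → ZMod 2, (∀ x y, φ x y + φ (x + 1) y = H x y + ext x y) ∧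
      (∀ x y, x ≤ D → φ x y + φ x (y + 1) = V x y) ∧ (∀ y, φ D y = 0) ∧
      ∀ x y, ext x y ≠ 0 → ∃ y', H x y' + H x (y' + 1) + V x y' + V (x + 1) y' ≠ 0 ∧
        (y ≤ y' ∧ y' < h ∨ h ≤ y' ∧ y' < y) := by
  -- Here `p` is the curl. Summing it between `y` and `h` draws, from each face with curl, a line in
  -- its column away from the level `h`; `φ` then integrates the corrected horizontal part from `x =
  -- D`.
  let p : ℤ → ℤ → ZMod 2 := fun x y => H x y + H x (y + 1) + V x y + V (x + 1) y
  let ext : ℤ → ℤ → ZMod 2 := fun x y => fill h (p x) y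
  let φ : ℤ → ℤ → ZMod 2 := fun x y => fill D (fun x' => H x' y + ext x' y) x
  have hφ : ∀ x y, φ x y + φ (x + 1) y = H x y + ext x y := fun x y =>
    fill_add_fill_succ D (fun x' => H x' y + ext x' y) x
  have hφD : ∀ y, φ D y = 0 := fun y => fill_self D _
  refine ⟨φ, ext, hφ, ?_, hφD, fun x y hne => exists_of_fill_ne_zero hne⟩
  intro x y hx
  -- At `x = D` both sides vanish, and since the corrected curl is zero the vertical relation passes
  -- from each column to the one before it.
  induction x, hx using Int.leInductionDown with
  | base => rw [hφD, hφD, hV, add_zero]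
  | pred x hx ih =>
    have e1 := hφ (x - 1) y
    have e2 := hφ (x - 1) (y + 1)
    have e3 : ext (x - 1) y + ext (x - 1) (y + 1) = p (x - 1) y := fill_add_fill_succ h (p (x - 1)) y
    simp only [sub_add_cancel, p] at e1 e2 e3
    have h2 : (2 : ZMod 2) = 0 := rfl
    linear_combination e1 + e2 + e3 - ih +
      (H (x - 1) y + H (x - 1) (y + 1)) * h2

lemma eq_of_add_eq_zero {a b : ZMod 2} (h : a + b = 0) : a = b :=
  CharTwo.add_eq_zero.1 h

lemma const_of_steps {F : ℤ → ZMod 2} {a b : ℤ} (h : ∀ x, a ≤ x → x < b → F x + F (x + 1) = 0) :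
    ∀ x, a ≤ x → x ≤ b → F x = F a := by
  intro x hx
  induction x, hx using Int.leInduction with
  | base => intro _; rfl
  | succ x hx ih =>
    intro hb
    rw [← ih (by omega)]
    exact (eq_of_add_eq_zero (h x hx (by omega))).symm

/-! ### From logical operators to labellings of the decoding graphs -/

namespace DefectArray

variable {Q d : ℕ} {A : DefectArray Q d}

/-- The run reaches the second shell because `Q ^ level < d`, and the first two shells have opposite
types. Consequently a puncture of constant type is one that cannot be enclosed. -/
lemma exists_mode (hQ : 0 < Q) {i : Fin A.n} (hi : A.Enclosable i) (hd : Q ^ A.level i < d)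
    (b : Boundary) : ∃ t, A.mode i t = b := by
  have h := A.mode_succ_ne hQ hi (k := 0) (by simpa using hd)
  cases h1 : A.mode i (0 * Q ^ A.level i) <;> cases h2 : A.mode i ((0 + 1) * Q ^ A.level i) <;>
    cases b <;> first
    | exact ⟨_, h1⟩
    | exact ⟨_, h2⟩
    | exact absurd (h1.trans h2.symm) h

lemma mem_active_of_permanent {q : Qubit} (hq : q ∈ A.permanent) (t : ℕ) : q ∈ A.active t := by
  have h : q ∈ idealQubits d ∧ ∀ t, q ∈ A.active t := by simpa [permanent] using hq
  exact h.2 t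

/-- The data errors of one kind. -/
def dataErr : Boundary → Qubit → ℕ → Fault
  | .smooth => Fault.bit
  | .rough => Fault.phase

/-- The two faces or end points of an edge. -/
def sidesOf : Boundary → Qubit → Bool → Site
  | .smooth => Qubit.sideFace
  | .rough => Qubit.endPt

/-- If an operator on permanent qubits is the coboundary of a function that is constant on shells and
on the two boundaries, then the parity of the errors on it is a sum over the decoding graph. -/
theorem exists_labels (b : Boundary) {L : Finset Qubit} (hL : L ⊆ A.permanent) (F : Site → ZMod 2)
    (F₀ F₁ : ZMod 2)
    (h1 : ∀ t, ∀ q ∈ A.present t, F (sidesOf b q false) + F (sidesOf b q true) =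
      if q ∈ L then 1 else 0)
    (h2 : ∀ i, A.Enclosable i → ∀ w ∈ A.region b i, F w = F (A.corner i))
    (h3 : ∀ f ∈ A.faults, f.kind = b → ∀ c, A.Low b (f.ends c).1 → F (f.ends c).1 = F₀)
    (h4 : ∀ f ∈ A.faults, f.kind = b → ∀ c, A.High b (f.ends c).1 → F (f.ends c).1 = F₁)
    {C : Finset Fault} (hC : C ⊆ A.faults) (hne : ∑ q ∈ L, A.frame (dataErr b) C q d = 1) :
    ∃ u : Node A.n → ZMod 2,
      ∑ f ∈ partOf b C, (u (A.joins b f false) + u (A.joins b f true)) ≠ 0 := by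
  classical
  let u : Node A.n → ZMod 2 := fun n => match n with
    | .cell c => F c.1
    | .shell i _ => F (A.corner i)
    | .lo => F₀
    | .hi => F₁
  refine ⟨u, ?_⟩
  have hu : ∀ f ∈ A.faults, f.kind = b → ∀ c, u (A.joins b f c) = F (f.ends c).1 := by
    intro f hf hk c
    rw [joins, node]
    split_ifs with e1 e2 e3
    · have := e1.choose_spec.choose_spec
      exact (h2 _ this.2.1 _ this.1).symm
    · exact (h3 f hf hk c e2).symm
    · exact (h4 f hf hk c e3).symm
    · rfl
  let T : Finset Fault := (L ×ˢ Finset.range (d + 1)).image fun x => dataErr b x.1 x.2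
  have hT : ∀ q t, dataErr b q t ∈ T ↔ q ∈ L ∧ t ≤ d := by
    intro q t
    cases b <;> simp [T, dataErr]
  have hinj : ∀ x y : Qubit × ℕ, dataErr b x.1 x.2 = dataErr b y.1 y.2 → x = y := by
    intro x y
    cases b <;> simp [dataErr, Prod.ext_iff]
  have hterm : ∀ f ∈ partOf b C, u (A.joins b f false) + u (A.joins b f true) =
      if f ∈ T then 1 else 0 := by
    intro f hf
    rw [partOf, Finset.mem_filter] at hf
    obtain ⟨hfC, hk⟩ := hf
    have hff := hC hfC
    rw [hu f hff hk, hu f hff hk]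
    cases b
    · cases f with
      | bit q t => cases hk
      | plaq w t => cases hk
      | phase q t =>
        rw [phase_mem_faults] at hff
        have := hT q t
        simp only [dataErr] at this
        simp only [this, hff.1, and_true]
        exact h1 t q hff.2
      | gauge q t =>
        rw [gauge_mem_faults] at hff
        -- A qubit that is measured out is not permanent, so the label agrees at its two ends and
        -- gauge errors contribute nothing.
        have hq : q ∉ L := by
          intro hq
          rcases t with _ | t
          · simp [decoupled] at hff
          · rw [decoupled_succ, Finset.mem_sdiff] at hff
            exact hff.2.2 (mem_active_of_permanent (hL hq) _)
        have := h1 t q (Finset.mem_union_right _ hff.2)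
        rw [if_neg hq] at this
        rw [if_neg (by simp [T, dataErr])]
        exact this
      | star v t =>
        rw [if_neg (by simp [T, dataErr])]
        exact CharTwo.add_self_eq_zero _
    · cases f with
      | phase q t => cases hk
      | gauge q t => cases hk
      | star v t => cases hk
      | bit q t =>
        rw [bit_mem_faults] at hff
        have := hT q t
        simp only [dataErr] at this
        simp only [this, hff.1, and_true]
        exact h1 t q hff.2
      | plaq w t =>
        rw [if_neg (by simp [T, dataErr])]
        exact CharTwo.add_self_eq_zero _
  have hkT : ∀ f ∈ T, f.kind = b := by
    intro f hf
    obtain ⟨x, -, rfl⟩ := Finset.mem_image.1 hf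
    cases b <;> rfl
  have hsum : ∑ q ∈ L, A.frame (dataErr b) C q d = ∑ f ∈ T, occurs C f := by
    rw [Finset.sum_image (fun x _ y _ h => hinj x y h), Finset.sum_product]
    refine Finset.sum_congr rfl fun q hq => ?_
    rw [frame_eq_sum (.inl rfl) (Nat.zero_le d) fun t _ _ => mem_active_of_permanent (hL hq) t,
      Finset.range_eq_Ico]
  rw [Finset.sum_congr rfl hterm, Finset.sum_ite_mem]
  have : ∑ f ∈ T, occurs C f = ∑ f ∈ partOf b C ∩ T, 1 := by
    simp only [occurs]
    rw [Finset.sum_ite_mem]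
    congr 1
    ext f
    simp only [partOf, Finset.mem_inter, Finset.mem_filter]
    exact ⟨fun h => ⟨⟨h.2, hkT f h.1⟩, h.1⟩, fun h => ⟨h.2, h.1.1⟩⟩
  rw [← this, ← hsum, hne]
  exact one_ne_zero

lemma not_enclosable_of_mode (hQ : 0 < Q) (hlev : ∀ i, Q ^ A.level i < d) {i : Fin A.n}
    {b : Boundary} (h : ∀ t, A.mode i t = b) : ¬ A.Enclosable i := by
  intro hi
  obtain ⟨t, ht⟩ := exists_mode hQ hi (hlev i) b.flip
  rw [h t] at ht
  cases b <;> cases ht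

/-- Near the end points of an operator that commutes with all stars, the horizontal edges towards the
closest rough boundary are never used. -/
lemma hor_of_odd_star (hQ : 15 < Q) (hlev : ∀ i, Q ^ A.level i < d)
    (hside : ∀ i, 5 * A.side i + 15 ≤ d) {L : Finset Qubit} (hL : L ⊆ A.permanent)
    (hstar : ∀ v ∈ A.stars, Even (starEdges v ∩ L).card) {x y x' : ℤ} (hx : 0 ≤ x ∧ x < d)
    (hx' : x < x' ∧ x' ≤ (d : ℤ) / 2 ∨ (d : ℤ) / 2 < x' ∧ x' ≤ x)
    (hodd : ¬ Even (starEdges (x', y) ∩ L).card) :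
    (∀ t, Qubit.hor (x, y) ∉ A.active t) ∧
      ∃ p ∈ (Qubit.hor (x, y)).ends, ∃ i, p ∈ A.hole i ∧ ∀ t, A.mode i t = .rough := by
  obtain ⟨q, hq⟩ : (starEdges (x', y) ∩ L).Nonempty := by
    rw [Finset.nonempty_iff_ne_empty]
    intro h
    simp [h] at hodd
  rw [Finset.mem_inter, mem_starEdges] at hq
  have hmem : (x', y) ∈ q.ends := Qubit.mem_ends.2 (hq.1.imp Eq.symm Eq.symm)
  have hact := mem_active_of_permanent (hL hq.2)
  have hid := (mem_active.1 (hact 0)).1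
  have hv : (x', y) ∈ idealVertices d := by
    rw [mem_idealVertices]
    rcases q with p | p
    · rw [mem_idealQubits_hor] at hid
      rcases hq.1 with h | h <;> simp only [Qubit.endPt, Prod.ext_iff] at h <;> simp only <;> omega
    · rw [mem_idealQubits_ver] at hid
      rcases hq.1 with h | h <;> simp only [Qubit.endPt, Prod.ext_iff] at h <;> simp only <;> omega
  -- Stars outside the holes are measured and have even overlap with `L`. A permanent qubit touches
  -- the hole found here, so this hole is rough in all rounds, cannot be enclosed, and lies next to
  -- a rough boundary.
  obtain ⟨i, hi⟩ : ∃ i, (x', y) ∈ A.hole i := by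
    by_contra hcon
    push Not at hcon
    exact hodd (hstar _ (mem_stars.2 ⟨hv, hcon⟩))
  have hm : ∀ t, A.mode i t = .rough := fun t => mode_of_mem_active (hact t) hmem hi
  have hne := not_enclosable_of_mode (by omega) hlev hm
  have hnear := A.nearRough_of_mode hne (hm 0)
  have hs := hside i
  have hh := A.mem_hole.1 hi
  simp only at hh
  rw [NearRough] at hnear
  have hmem' : ∀ z : ℤ, (A.corner i).1 ≤ z → z ≤ (A.corner i).1 + A.side i → (z, y) ∈ A.hole i :=
    fun z h1 h2 => A.mem_hole.2 ⟨⟨h1, h2⟩, hh.2⟩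
  have m1 : (x, y) ∈ (Qubit.hor (x, y)).ends := by simp [Qubit.ends]
  have m2 : (x + 1, y) ∈ (Qubit.hor (x, y)).ends := by simp [Qubit.ends]
  -- By `hside` a hole at one side of the array stays away from the middle, so the position of `x'`
  -- relative to `d / 2` decides which boundary it is attached to. Between `x'` and that boundary,
  -- every end point is in the hole or missing beyond the array.
  have hrem : (x ≤ 0 ∨ (x, y) ∈ A.hole i) ∧ ((d : ℤ) ≤ x + 1 ∨ (x + 1, y) ∈ A.hole i) ∧
      ((x, y) ∈ A.hole i ∨ (x + 1, y) ∈ A.hole i) := by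
    rcases hx' with hx' | hx'
    · have h2 := hmem' (x + 1) (by omega) (by omega)
      refine ⟨?_, .inr h2, .inr h2⟩
      rcases le_or_gt x 0 with h | h
      · exact .inl h
      · exact .inr (hmem' x (by omega) (by omega))
    · have h2 := hmem' x (by omega) (by omega)
      refine ⟨.inr h2, ?_, .inl h2⟩
      rcases le_or_gt (d : ℤ) (x + 1) with h | h
      · exact .inl h
      · exact .inr (hmem' (x + 1) (by omega) (by omega))
  refine ⟨fun t ht => (mem_active.1 ht).2.1 fun p hp => ?_, ?_⟩
  · rw [Qubit.mem_ends] at hp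
    rcases hp with rfl | rfl
    · exact hrem.1.imp id fun h => .inr ⟨i, hm t, h⟩
    · exact .inr (hrem.2.1.imp id fun h => ⟨i, hm t, h⟩)
  · rcases hrem.2.2 with h | h
    · exact ⟨_, m1, i, h, hm⟩
    · exact ⟨_, m2, i, h, hm⟩

/-- Near the end points of an operator that commutes with all plaquettes, the horizontal edges on the
way to the closest smooth boundary are never used. -/
lemma hor_of_odd_face (hQ : 15 < Q) (hlev : ∀ i, Q ^ A.level i < d)
    (hside : ∀ i, 5 * A.side i + 15 ≤ d) {L : Finset Qubit} (hL : L ⊆ A.permanent)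
    (hface : ∀ t, ∀ w ∈ A.faces t, Even (faceEdges w ∩ L).card) {x y y' : ℤ}
    (hx : 0 ≤ x ∧ x < d) (hy : 0 ≤ y ∧ y < d)
    (hy' : y ≤ y' ∧ y' < (d : ℤ) / 2 ∨ (d : ℤ) / 2 ≤ y' ∧ y' < y)
    (hodd : ¬ Even (faceEdges (x, y') ∩ L).card) :
    (∀ t, Qubit.hor (x, y) ∉ A.active t) ∧
      ∃ p ∈ (Qubit.hor (x, y)).ends, ∃ i, p ∈ A.hole i ∧ ∀ t, A.mode i t = .smooth := by
  obtain ⟨q, hq⟩ : (faceEdges (x, y') ∩ L).Nonempty := by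
    rw [Finset.nonempty_iff_ne_empty]
    intro h
    simp [h] at hodd
  rw [Finset.mem_inter] at hq
  have hact := mem_active_of_permanent (hL hq.2)
  have hv : (x, y') ∈ idealFaces d := by
    rw [mem_idealFaces]
    simp only
    omega
  -- The face is measured in no round, since measured faces have even overlap with `L`. As it has an
  -- edge that is always active, the cause must be a smooth hole in each round, and by separation
  -- always the same one.
  have hsm : ∀ t, ∃ i, A.mode i t = .smooth ∧ (x, y') ∈ A.region .smooth i := by
    intro t
    by_contra hcon
    push Not at hcon
    refine hodd (hface t _ (mem_faces.2 ⟨hv, fun h => ?_, ?_⟩))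
    · exact (mem_active.1 (hact t)).2.1 fun p hp => h p (mem_faceCorners_of_mem_ends hq.1 hp)
    · rintro p hp ⟨i, hs, hpi⟩
      exact hcon i hs (A.mem_region_iff_touch.2 ⟨p, hp, hpi⟩)
  obtain ⟨i, -, hi⟩ := hsm 0
  have hm : ∀ t, A.mode i t = .smooth := by
    intro t
    obtain ⟨k, hk, hk'⟩ := hsm t
    rwa [A.eq_of_near hQ hi hk' (by simp) (by simp)]
  have hne := not_enclosable_of_mode (by omega) hlev hm
  have hnear := A.nearSmooth_of_mode hne (hm 0)
  have hs := hside i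
  have hh := A.mem_region_smooth.1 hi
  simp only at hh
  rw [NearSmooth] at hnear
  have hpt : ∃ p ∈ (Qubit.hor (x, y)).ends, p ∈ A.hole i := by
    rcases lt_or_ge x (A.corner i).1 with h | h
    · refine ⟨(x + 1, y), by simp [Qubit.ends], A.mem_hole.2 ?_⟩
      simp only
      omega
    · refine ⟨(x, y), by simp [Qubit.ends], A.mem_hole.2 ?_⟩
      simp only
      omega
  obtain ⟨p, hp, hpi⟩ := hpt
  exact ⟨fun t ht => (mem_active.1 ht).2.2 p hp ⟨i, hm t, hpi⟩, p, hp, i, hpi, hm⟩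

/-- Two holes that touch the same edge are equal. -/
lemma eq_of_touch_edge (hQ : 15 < Q) {q : Qubit} {p p' : Site} (hp : p ∈ q.ends) (hp' : p' ∈ q.ends)
    {i k : Fin A.n} (hi : p ∈ A.hole i) (hk : p' ∈ A.hole k) : i = k := by
  refine A.eq_of_near hQ (A.region_subset .rough i hi) (A.region_subset .rough k hk) ?_ ?_
  all_goals
    rw [Qubit.mem_ends] at hp hp'
    rcases q with z | z <;> simp only [Qubit.endPt] at hp hp' <;>
      rcases hp with rfl | rfl <;> rcases hp' with rfl | rfl <;> simp

end DefectArray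

/-- The four terms are the curl in `exists_potential` for the dual lattice; likewise for faces in
the next lemma. -/
lemma not_even_star_of_sum {L : Finset Qubit} {x y : ℤ}
    (h : (if Qubit.hor (x, y) ∈ L then (1 : ZMod 2) else 0) +
      (if Qubit.hor (x + 1, y) ∈ L then 1 else 0) +
      (if Qubit.ver (x + 1, y - 1) ∈ L then 1 else 0) +
      (if Qubit.ver (x + 1, y) ∈ L then 1 else 0) ≠ 0) :
    ¬ Even (starEdges (x + 1, y) ∩ L).card := by
  rw [← ZMod.natCast_eq_zero_iff_even, Finset.card_eq_sum_ones, Nat.cast_sum, ← Finset.sum_ite_mem]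
  contrapose! h
  rw [starEdges, Finset.sum_insert (by simp), Finset.sum_insert (by simp),
    Finset.sum_insert (by simp; omega), Finset.sum_singleton] at h
  simp only [add_sub_cancel_right, Nat.cast_one] at h
  linear_combination h

lemma not_even_face_of_sum {L : Finset Qubit} {x y : ℤ}
    (h : (if Qubit.hor (x, y) ∈ L then (1 : ZMod 2) else 0) +
      (if Qubit.hor (x, y + 1) ∈ L then 1 else 0) +
      (if Qubit.ver (x, y) ∈ L then 1 else 0) +
      (if Qubit.ver (x + 1, y) ∈ L then 1 else 0) ≠ 0) :
    ¬ Even (faceEdges (x, y) ∩ L).card := by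
  rw [← ZMod.natCast_eq_zero_iff_even, Finset.card_eq_sum_ones, Nat.cast_sum, ← Finset.sum_ite_mem]
  contrapose! h
  rw [faceEdges, Finset.sum_insert (by simp), Finset.sum_insert (by simp),
    Finset.sum_insert (by simp), Finset.sum_singleton] at h
  simp only [Nat.cast_one] at h
  linear_combination h

namespace DefectArray

variable {Q d : ℕ} {A : DefectArray Q d}

lemma sideFace_bounds {q : Qubit} (hq : q ∈ idealQubits d) (c : Bool) :
    (0 ≤ (q.sideFace c).1 ∧ (q.sideFace c).1 < d) ∧
      -1 ≤ (q.sideFace c).2 ∧ (q.sideFace c).2 ≤ (d : ℤ) - 1 := by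
  rcases q with p | p
  · rw [mem_idealQubits_hor] at hq
    cases c <;> simp only [Qubit.sideFace] <;> omega
  · rw [mem_idealQubits_ver] at hq
    cases c <;> simp only [Qubit.sideFace] <;> omega

lemma endPt_bounds {q : Qubit} (hq : q ∈ idealQubits d) (c : Bool) :
    (0 ≤ (q.endPt c).1 ∧ (q.endPt c).1 ≤ d) ∧ 0 ≤ (q.endPt c).2 ∧ (q.endPt c).2 < d := by
  rcases q with p | p
  · rw [mem_idealQubits_hor] at hq
    cases c <;> simp only [Qubit.endPt] <;> omega
  · rw [mem_idealQubits_ver] at hq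
    cases c <;> simp only [Qubit.endPt] <;> omega

lemma ends_bounds_smooth {f : Fault} (hf : f ∈ A.faults) (hk : f.kind = .smooth) (c : Bool) :
    (0 ≤ (f.ends c).1.1 ∧ (f.ends c).1.1 < d) ∧
      -1 ≤ (f.ends c).1.2 ∧ (f.ends c).1.2 ≤ (d : ℤ) - 1 := by
  cases f with
  | phase q t => cases hk
  | star v t => cases hk
  | gauge q t => cases hk
  | bit q t =>
    rw [bit_mem_faults] at hf
    exact sideFace_bounds (mem_idealQubits_of_present hf.2) c
  | plaq w t =>
    rw [plaq_mem_faults] at hf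
    have := mem_idealFaces.1 (mem_faces.1 hf.2).1
    simp only [Fault.ends]
    omega

lemma ends_bounds_rough {f : Fault} (hf : f ∈ A.faults) (hk : f.kind = .rough) (c : Bool) :
    (0 ≤ (f.ends c).1.1 ∧ (f.ends c).1.1 ≤ d) ∧ 0 ≤ (f.ends c).1.2 ∧ (f.ends c).1.2 < d := by
  cases f with
  | bit q t => cases hk
  | plaq w t => cases hk
  | phase q t =>
    rw [phase_mem_faults] at hf
    exact endPt_bounds (mem_idealQubits_of_present hf.2) c
  | gauge q t =>
    rw [gauge_mem_faults] at hf
    exact endPt_bounds (mem_idealQubits_of_present (Finset.mem_union_right _ hf.2)) c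
  | star v t =>
    rw [star_mem_faults, mem_stars] at hf
    have := mem_idealVertices.1 hf.2.1
    simp only [Fault.ends]
    omega

/-- As a cochain on the dual lattice, `L` has curl only at vertices in permanently rough holes. The
lines that remove it run to the nearest rough boundary through edges that are never used, so `L` is
a coboundary on all qubits in use. Neither `L` nor a line touches a hole that is ever smooth, so the
potential is constant around such holes. -/
theorem exists_labels_of_bitFlipFailure (hQ : 15 < Q) (hlev : ∀ i, Q ^ A.level i < d)
    (hside : ∀ i, 5 * A.side i + 15 ≤ d) {C : Finset Fault} (hC : C ⊆ A.faults)
    (h : A.BitFlipFailure C) : ∃ u : Node A.n → ZMod 2,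
      ∑ f ∈ partOf .smooth C, (u (A.joins .smooth f false) + u (A.joins .smooth f true)) ≠ 0 := by
  obtain ⟨L, hL, hstar, hne⟩ := h
  have hLid : ∀ q ∈ L, q ∈ idealQubits d := fun q hq =>
    (mem_active.1 (mem_active_of_permanent (hL hq) 0)).1
  -- The coordinates are exchanged and `y` is shifted by one: lines run horizontally away from the
  -- middle column, and the potential vanishes in the top row of faces `y = d - 1`.
  obtain ⟨φ, ext, h1, h2, h3, h4⟩ := exists_potential
    (fun a b => if Qubit.hor (b, a) ∈ L then 1 else 0)
    (fun a b => if Qubit.ver (b + 1, a - 1) ∈ L then 1 else 0) ((d : ℤ) / 2) d (fun y => by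
      rw [if_neg]
      intro hmem
      have := mem_idealQubits_ver.1 (hLid _ hmem)
      simp only at this
      omega)
  let F : Site → ZMod 2 := fun w => φ (w.2 + 1) w.1
  have fx : ∀ x y : ℤ, y + 1 ≤ d → F (x, y) + F (x + 1, y) =
      if Qubit.ver (x + 1, y) ∈ L then 1 else 0 := by
    intro x y hy
    have := h2 (y + 1) x hy
    rwa [add_sub_cancel_right] at this
  have fy : ∀ x y : ℤ, F (x, y) + F (x, y + 1) =
      (if Qubit.hor (x, y + 1) ∈ L then 1 else 0) + ext (y + 1) x := fun x y => h1 (y + 1) x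
  have hext : ∀ x y : ℤ, 0 ≤ x → x < d → ext y x ≠ 0 → (∀ t, Qubit.hor (x, y) ∉ A.active t) ∧
      ∃ p ∈ (Qubit.hor (x, y)).ends, ∃ i, p ∈ A.hole i ∧ ∀ t, A.mode i t = .rough := by
    intro x y hx0 hx1 hne
    obtain ⟨x', hodd, hx'⟩ := h4 y x hne
    simp only [add_sub_cancel_right] at hodd
    exact hor_of_odd_star hQ hlev hside hL hstar (x' := x' + 1) ⟨hx0, hx1⟩ (by omega)
      (not_even_star_of_sum hodd)
  have hLsm : ∀ q ∈ L, ∀ p ∈ q.ends, ∀ i, p ∈ A.hole i → ∀ t, A.mode i t = .rough :=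
    fun q hq p hp i hi t => mode_of_mem_active (mem_active_of_permanent (hL hq) t) hp hi
  have fxz : ∀ x y : ℤ, y + 1 ≤ d → ∀ p ∈ (Qubit.ver (x + 1, y)).ends, ∀ i, p ∈ A.hole i →
      (∃ t, A.mode i t = .smooth) → F (x, y) + F (x + 1, y) = 0 := by
    rintro x y hy p hp i hi ⟨t, ht⟩
    rw [fx x y hy, if_neg]
    intro hq
    rw [hLsm _ hq p hp i hi t] at ht
    cases ht
  have fyz : ∀ x y : ℤ, 0 ≤ x → x < d → ∀ p ∈ (Qubit.hor (x, y + 1)).ends, ∀ i, p ∈ A.hole i →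
      (∃ t, A.mode i t = .smooth) → F (x, y) + F (x, y + 1) = 0 := by
    rintro x y hx0 hx1 p hp i hi ⟨t, ht⟩
    rw [fy x y, if_neg, zero_add]
    · by_contra hne
      obtain ⟨-, p', hp', k, hk, hm⟩ := hext x (y + 1) hx0 hx1 hne
      rw [eq_of_touch_edge hQ hp hp' hi hk, hm t] at ht
      cases ht
    · intro hq
      rw [hLsm _ hq p hp i hi t] at ht
      cases ht
  have ends_ver : ∀ x y : ℤ, (x, y) ∈ (Qubit.ver (x, y)).ends ∧
      (x, y + 1) ∈ (Qubit.ver (x, y)).ends := fun x y => by simp [Qubit.ends]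
  have ends_hor : ∀ x y : ℤ, (x, y) ∈ (Qubit.hor (x, y)).ends ∧
      (x + 1, y) ∈ (Qubit.hor (x, y)).ends := fun x y => by simp [Qubit.ends]
  have hcol : ∀ i, (∃ t, A.mode i t = .smooth) → ∀ x y : ℤ, 0 ≤ x → x < d →
      (A.corner i).1 - 1 ≤ x → x ≤ (A.corner i).1 + A.side i → (A.corner i).2 - 1 ≤ y →
      y < (A.corner i).2 + A.side i → F (x, y) + F (x, y + 1) = 0 := by
    intro i hi x y hx0 hx1 a1 a2 a3 a4
    rcases lt_or_ge x (A.corner i).1 with hlt | hge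
    · exact fyz x y hx0 hx1 _ (ends_hor x (y + 1)).2 i (A.mem_hole.2 (by simp only; omega)) hi
    · exact fyz x y hx0 hx1 _ (ends_hor x (y + 1)).1 i (A.mem_hole.2 (by simp only; omega)) hi
  refine exists_labels .smooth hL F (F (0, -1)) 0 ?_ ?_ ?_ ?_ hC hne
  · intro t q hq
    have hid := mem_idealQubits_of_present hq
    rcases q with ⟨x, y⟩ | ⟨x, y⟩
    · have hb := mem_idealQubits_hor.1 hid
      simp only at hb
      have hz : ext y x = 0 := by
        by_contra hne
        have hact := (hext x y hb.1.1 hb.1.2 hne).1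
        rcases t with _ | t
        · rw [present_zero] at hq
          exact hact 0 hq
        · rw [mem_present_succ] at hq
          exact hq.elim (hact _) (hact _)
      have := fy x (y - 1)
      rw [sub_add_cancel, hz, add_zero, add_comm] at this
      exact this
    · have hb := mem_idealQubits_ver.1 hid
      simp only at hb
      have := fx (x - 1) y (by omega)
      rw [sub_add_cancel, add_comm] at this
      exact this
  · intro i hi w hw
    have hsm := exists_mode (by omega) hi (hlev i) .smooth
    rw [enclosable_iff] at hi
    have hw' := A.mem_region_smooth.1 hw
    have e1 := const_of_steps (F := fun x => F (x, w.2)) (a := (A.corner i).1 - 1)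
      (b := (A.corner i).1 + A.side i) (fun x hx0 hx1 => by
        rcases lt_or_ge w.2 (A.corner i).2 with hlt | hge
        · exact fxz x w.2 (by omega) _ (ends_ver (x + 1) w.2).2 i
            (A.mem_hole.2 (by simp only; omega)) hsm
        · exact fxz x w.2 (by omega) _ (ends_ver (x + 1) w.2).1 i
            (A.mem_hole.2 (by simp only; omega)) hsm)
    have e2 := const_of_steps (F := fun y => F ((A.corner i).1, y)) (a := (A.corner i).2 - 1)
      (b := (A.corner i).2 + A.side i) (fun y hy0 hy1 =>
        hcol i hsm _ y (by omega) (by omega) (by omega) (by omega) hy0 hy1)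
    have a1 := e1 w.1 hw'.1.1 hw'.1.2
    have a2 := e1 (A.corner i).1 (by omega) (by omega)
    have a3 := e2 w.2 hw'.2.1 hw'.2.2
    have a4 := e2 (A.corner i).2 (by omega) (by omega)
    exact a1.trans (a2.symm.trans (a3.trans a4.symm))
  · intro f hf hk c hlow
    have hb := ends_bounds_smooth hf hk c
    generalize (f.ends c).1 = w at hlow hb
    have hrow : ∀ x : ℤ, 0 ≤ x → x < d → F (x, -1) = F (0, -1) := fun x hx0 hx1 =>
      const_of_steps (F := fun x => F (x, -1)) (a := 0) (b := (d : ℤ) - 1) (fun x _ _ => by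
        rw [fx x (-1) (by omega), if_neg]
        intro hmem
        have := mem_idealQubits_ver.1 (hLid _ hmem)
        simp only at this
        omega) x hx0 (by omega)
    rw [← hrow w.1 hb.1.1 hb.1.2]
    rcases hlow with hlow | ⟨i, hi, hm, hw, hc⟩
    · rw [show (w.1, (-1 : ℤ)) = w from Prod.ext rfl (by simp only; omega)]
    · rw [mem_region_smooth] at hw
      have hcb := A.corner_bounds i
      exact const_of_steps (F := fun y => F (w.1, y)) (a := -1) (b := w.2) (fun y hy0 hy1 =>
        hcol i ⟨0, hm⟩ _ y hb.1.1 hb.1.2 (by omega) (by omega) (by omega) (by omega)) w.2 hb.2.1 le_rfl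
  · intro f hf hk c hhigh
    have hb := ends_bounds_smooth hf hk c
    generalize (f.ends c).1 = w at hhigh hb
    have htop : ∀ x, F (x, (d : ℤ) - 1) = 0 := fun x => by
      have := h3 x
      simpa only [F, sub_add_cancel] using this
    rcases hhigh with hhigh | ⟨i, hi, hm, hw, hc⟩
    · rw [← htop w.1, show (w.1, (d : ℤ) - 1) = w from Prod.ext rfl (by simp only; omega)]
    · rw [mem_region_smooth] at hw
      have := const_of_steps (F := fun y => F (w.1, y)) (a := w.2) (b := (d : ℤ) - 1)
        (fun y hy0 hy1 => hcol i ⟨0, hm⟩ _ y hb.1.1 hb.1.2 (by omega) (by omega) (by omega)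
          (by omega)) ((d : ℤ) - 1) hb.2.2 le_rfl
      exact this.symm.trans (htop w.1)

/-- The dual argument with labels on vertices: the curl is the parity at a face, and within the
array it can be odd only near permanently smooth holes. The lines cross the horizontal edges of one
column on the way to the nearest smooth boundary. -/
theorem exists_labels_of_phaseFlipFailure (hQ : 15 < Q) (hlev : ∀ i, Q ^ A.level i < d)
    (hside : ∀ i, 5 * A.side i + 15 ≤ d) {C : Finset Fault} (hC : C ⊆ A.faults)
    (h : A.PhaseFlipFailure C) : ∃ u : Node A.n → ZMod 2,
      ∑ f ∈ partOf .rough C, (u (A.joins .rough f false) + u (A.joins .rough f true)) ≠ 0 := by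
  obtain ⟨L, hL, hface, hne⟩ := h
  have hLid : ∀ q ∈ L, q ∈ idealQubits d := fun q hq =>
    (mem_active.1 (mem_active_of_permanent (hL hq) 0)).1
  obtain ⟨φ, ext, h1, h2, h3, h4⟩ := exists_potential
    (fun a b => if Qubit.hor (a, b) ∈ L then 1 else 0)
    (fun a b => if Qubit.ver (a, b) ∈ L then 1 else 0) ((d : ℤ) / 2) d (fun y => by
      rw [if_neg]
      intro hmem
      have := mem_idealQubits_ver.1 (hLid _ hmem)
      simp only at this
      omega)
  let F : Site → ZMod 2 := fun w => φ w.1 w.2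
  have fx : ∀ x y : ℤ, F (x, y) + F (x + 1, y) =
      (if Qubit.hor (x, y) ∈ L then 1 else 0) + ext x y := h1
  have fy : ∀ x y : ℤ, x ≤ d → F (x, y) + F (x, y + 1) = if Qubit.ver (x, y) ∈ L then 1 else 0 := h2
  have hext : ∀ x y : ℤ, 0 ≤ x → x < d → 0 ≤ y → y < d → ext x y ≠ 0 →
      (∀ t, Qubit.hor (x, y) ∉ A.active t) ∧
      ∃ p ∈ (Qubit.hor (x, y)).ends, ∃ i, p ∈ A.hole i ∧ ∀ t, A.mode i t = .smooth := by
    intro x y hx0 hx1 hy0 hy1 hne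
    obtain ⟨y', hodd, hy'⟩ := h4 x y hne
    exact hor_of_odd_face hQ hlev hside hL hface ⟨hx0, hx1⟩ ⟨hy0, hy1⟩ hy'
      (not_even_face_of_sum hodd)
  -- An edge that is inactive in some round is not in `L`. If it also touches a hole that is rough
  -- in some round, it is on no correcting line, because these touch permanently smooth holes.
  have fxz : ∀ x y : ℤ, 0 ≤ x → x < d → 0 ≤ y → y < d → (∃ t, Qubit.hor (x, y) ∉ A.active t) →
      ∀ p ∈ (Qubit.hor (x, y)).ends, ∀ i, p ∈ A.hole i → (∃ t, A.mode i t = .rough) →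
        F (x, y) + F (x + 1, y) = 0 := by
    rintro x y hx0 hx1 hy0 hy1 ⟨t', ht'⟩ p hp i hi ⟨t, ht⟩
    rw [fx x y, if_neg, zero_add]
    · by_contra hne
      obtain ⟨-, p', hp', k, hk, hm⟩ := hext x y hx0 hx1 hy0 hy1 hne
      rw [eq_of_touch_edge hQ hp hp' hi hk, hm t] at ht
      cases ht
    · exact fun hq => ht' (mem_active_of_permanent (hL hq) t')
  have ends_hor : ∀ x y : ℤ, (x, y) ∈ (Qubit.hor (x, y)).ends ∧
      (x + 1, y) ∈ (Qubit.hor (x, y)).ends := fun x y => by simp [Qubit.ends]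
  refine exists_labels .rough hL F (F (0, 0)) 0 ?_ ?_ ?_ ?_ hC hne
  · intro t q hq
    have hid := mem_idealQubits_of_present hq
    rcases q with ⟨x, y⟩ | ⟨x, y⟩
    · have hb := mem_idealQubits_hor.1 hid
      simp only at hb
      have hz : ext x y = 0 := by
        by_contra hne
        have hact := (hext x y hb.1.1 hb.1.2 hb.2.1 hb.2.2 hne).1
        rcases t with _ | t
        · rw [present_zero] at hq
          exact hact 0 hq
        · rw [mem_present_succ] at hq
          exact hq.elim (hact _) (hact _)
      have := fx x y
      rw [hz, add_zero] at this
      exact this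
    · have hb := mem_idealQubits_ver.1 hid
      simp only at hb
      exact fy x y (by omega)
  · intro i hi v hv
    obtain ⟨t, ht⟩ := exists_mode (by omega) hi (hlev i) .smooth
    have hro := exists_mode (by omega) hi (hlev i) .rough
    rw [enclosable_iff] at hi
    have hv' := A.mem_region_rough.1 hv
    have hact : ∀ q : Qubit, ∀ p ∈ q.ends, p ∈ A.hole i → q ∉ A.active t := by
      intro q p hp hpi hq
      rw [mode_of_mem_active hq hp hpi] at ht
      cases ht
    have e1 := const_of_steps (F := fun x => F (x, v.2)) (a := (A.corner i).1)
      (b := (A.corner i).1 + A.side i) (fun x hx0 hx1 => by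
        have hmem : (x, v.2) ∈ A.hole i := A.mem_hole.2 (by simp only; omega)
        exact fxz x v.2 (by omega) (by omega) (by omega) (by omega)
          ⟨t, hact _ _ (ends_hor x v.2).1 hmem⟩ _ (ends_hor x v.2).1 i hmem hro)
    have e2 := const_of_steps (F := fun y => F ((A.corner i).1, y)) (a := (A.corner i).2)
      (b := (A.corner i).2 + A.side i) (fun y hy0 hy1 => by
        rw [fy _ y (by omega), if_neg]
        intro hq
        exact hact _ ((A.corner i).1, y) (by simp [Qubit.ends])
          (A.mem_hole.2 (by simp only; omega)) (mem_active_of_permanent (hL hq) t))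
    exact (e1 v.1 hv'.1.1 hv'.1.2).trans (e2 v.2 hv'.2.1 hv'.2.2)
  · intro f hf hk c hlow
    have hb := ends_bounds_rough hf hk c
    generalize (f.ends c).1 = v at hlow hb
    have hcol : ∀ y : ℤ, 0 ≤ y → y < d → F (0, y) = F (0, 0) := fun y hy0 hy1 =>
      const_of_steps (F := fun y => F (0, y)) (a := 0) (b := (d : ℤ) - 1) (fun y _ _ => by
        rw [fy 0 y (by omega), if_neg]
        intro hmem
        have := mem_idealQubits_ver.1 (hLid _ hmem)
        simp only at this
        omega) y hy0 (by omega)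
    rw [← hcol v.2 hb.2.1 hb.2.2]
    rcases hlow with hlow | ⟨i, hi, hm, hv, hc⟩
    · rw [show ((0 : ℤ), v.2) = v from Prod.ext (by simp only; omega) rfl]
    · rw [mem_region_rough] at hv
      refine const_of_steps (F := fun x => F (x, v.2)) (a := 0) (b := v.1) (fun x hx0 hx1 => ?_)
        v.1 hb.1.1 le_rfl
      have hmem : (x + 1, v.2) ∈ A.hole i := A.mem_hole.2 (by simp only; omega)
      refine fxz x v.2 hx0 (by omega) hb.2.1 hb.2.2 ⟨0, fun hact => ?_⟩ _ (ends_hor x v.2).2 i hmem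
        ⟨0, hm⟩
      refine (mem_active.1 hact).2.1 fun p hp => ?_
      rw [Qubit.mem_ends] at hp
      rcases hp with rfl | rfl
      · rcases le_or_gt x 0 with h | h
        · exact .inl h
        · exact .inr (.inr ⟨i, hm, A.mem_hole.2 (by simp only [Qubit.endPt]; omega)⟩)
      · exact .inr (.inr ⟨i, hm, hmem⟩)
  · intro f hf hk c hhigh
    have hb := ends_bounds_rough hf hk c
    generalize (f.ends c).1 = v at hhigh hb
    have hright : ∀ y, F ((d : ℤ), y) = 0 := h3
    rcases hhigh with hhigh | ⟨i, hi, hm, hv, hc⟩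
    · rw [← hright v.2, show ((d : ℤ), v.2) = v from Prod.ext (by simp only; omega) rfl]
    · rw [mem_region_rough] at hv
      have := const_of_steps (F := fun x => F (x, v.2)) (a := v.1) (b := (d : ℤ))
        (fun x hx0 hx1 => by
          have hmem : (x, v.2) ∈ A.hole i := A.mem_hole.2 (by simp only; omega)
          refine fxz x v.2 (by omega) (by omega) hb.2.1 hb.2.2 ⟨0, fun hact => ?_⟩ _
            (ends_hor x v.2).1 i hmem ⟨0, hm⟩
          refine (mem_active.1 hact).2.1 fun p hp => ?_
          rw [Qubit.mem_ends] at hp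
          rcases hp with rfl | rfl
          · exact .inr (.inr ⟨i, hm, hmem⟩)
          · rcases le_or_gt (d : ℤ) (x + 1) with h | h
            · exact .inr (.inl h)
            · exact .inr (.inr ⟨i, hm, A.mem_hole.2 (by simp only [Qubit.endPt]; omega)⟩))
        (d : ℤ) hb.1.2 le_rfl
      exact this.symm.trans (hright v.2)

end DefectArray

/-! ### Additivity of degrees, and the total level along a walk -/

lemma sum_symmDiff_zmod {β : Type*} [DecidableEq β] (C D : Finset β) (g : β → ZMod 2) :
    ∑ f ∈ symmDiff C D, g f = ∑ f ∈ C, g f + ∑ f ∈ D, g f := by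
  have h : ∀ X ⊆ C ∪ D, ∑ f ∈ X, g f = ∑ f ∈ C ∪ D, if f ∈ X then g f else 0 := fun X hX => by
    rw [Finset.sum_ite_mem, Finset.inter_eq_right.2 hX]
  rw [h C Finset.subset_union_left, h D Finset.subset_union_right, h (symmDiff C D) (by
    intro f hf; rw [Finset.mem_symmDiff] at hf; rw [Finset.mem_union]; tauto),
    ← Finset.sum_add_distrib]
  refine Finset.sum_congr rfl fun f _ => ?_
  simp only [Finset.mem_symmDiff]
  by_cases h1 : f ∈ C <;> by_cases h2 : f ∈ D <;> simp [h1, h2, CharTwo.add_self_eq_zero]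

lemma nodeDeg_symmDiff {ν : Type*} (s : Fault → Bool → ν) (b : Boundary) (C D : Finset Fault)
    (n : ν) : nodeDeg s (partOf b (symmDiff C D)) n =
      nodeDeg s (partOf b C) n + nodeDeg s (partOf b D) n := by
  have h : partOf b (symmDiff C D) = symmDiff (partOf b C) (partOf b D) := by
    ext f
    simp only [partOf, Finset.mem_filter, Finset.mem_symmDiff]
    tauto
  rw [h, nodeDeg, sum_symmDiff_zmod]
  rfl

/-- Layer-cake formula; it reduces the total level to the counts bounded by `JumpWalk.countP_le`. -/
lemma sum_rank_pred {ν : Type*} (rank : ν → ℕ) (m : ℕ) (ns : List ν) (h : ∀ n ∈ ns, rank n ≤ m + 1) :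
    (ns.map fun n => rank n - 1).sum =
      ∑ j ∈ Finset.range m, ns.countP fun n => j + 1 + 1 ≤ rank n := by
  induction ns with
  | nil => simp
  | cons n ns ih =>
    rw [List.map_cons, List.sum_cons, ih fun x hx => h x (by simp [hx])]
    simp only [List.countP_cons, Finset.sum_add_distrib]
    have h1 := h n (by simp)
    have h2 : ∑ j ∈ Finset.range m, (if decide (j + 1 + 1 ≤ rank n) = true then 1 else 0) =
        rank n - 1 := by
      simp only [decide_eq_true_eq]
      rw [← Finset.card_filter, ← Finset.card_range (rank n - 1)]
      congr 1
      ext j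
      simp only [Finset.mem_filter, Finset.mem_range]
      omega
    omega

/-- The total level of the shells on a walk is a small multiple of its length. -/
lemma JumpWalk.sum_level_le {X ν : Type*} {dist : X → X → ℤ} {nd : X → ν} {Q : ℕ} {rank : ν → ℕ}
    {inner : ν → Prop} (hQ : 15 < Q) (G : ShellGeometry Q dist nd rank inner) {m : ℕ}
    {a b : X} {ns : List ν} {l : ℕ} (h : JumpWalk dist nd a b ns l)
    (hi : ∀ n ∈ ns, inner n) (hr : ∀ n ∈ ns, rank n ≤ m + 1) (hn : ns.Nodup) :
    (((ns.map fun n => rank n - 1).sum : ℕ) : ℝ) ≤ m + 6 / ((Q : ℝ) - 2) * l := by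
  have hQr : (16 : ℝ) ≤ Q := by exact_mod_cast hQ
  rw [sum_rank_pred rank m ns hr]
  push_cast
  -- The count at rank `j + 2` is at most `1 + 3^(j+1) * l / (Q^j * (Q - 2))`. Since `3 / Q ≤ 1 /
  -- 2`, these bounds are dominated by a geometric series.
  have key : ∀ j, ((ns.countP fun n => j + 1 + 1 ≤ rank n : ℕ) : ℝ) ≤
      1 + 3 / ((Q : ℝ) - 2) * l * (1 / 2) ^ j := by
    intro j
    have h1 := JumpWalk.countP_le hQ G (j + 1) h hi hn
    have h2 : (Q : ℤ) ^ (j + 1) - slack Q (j + 1) = (Q : ℤ) ^ j * (Q - 2) := by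
      simp only [slack]; ring
    rw [h2] at h1
    have h3 : ((ns.countP fun n => j + 1 + 1 ≤ rank n : ℕ) : ℝ) * ((Q : ℝ) ^ j * (Q - 2)) ≤
        3 ^ (j + 1) * l + (Q : ℝ) ^ j * (Q - 2) := by exact_mod_cast h1
    have h4 : (3 : ℝ) ^ j ≤ (Q : ℝ) ^ j * (1 / 2) ^ j := by
      rw [← mul_pow]
      exact pow_le_pow_left₀ (by norm_num) (by linarith) _
    have hpos : 0 < (Q : ℝ) ^ j * (Q - 2) := by
      have : (0 : ℝ) < Q - 2 := by linarith
      positivity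
    have h5 : (0 : ℝ) < Q - 2 := by linarith
    refine le_of_mul_le_mul_right (h3.trans ?_) hpos
    have h6 : (1 + 3 / ((Q : ℝ) - 2) * l * (1 / 2) ^ j) * ((Q : ℝ) ^ j * (Q - 2)) =
        3 * ((Q : ℝ) ^ j * (1 / 2) ^ j) * l + (Q : ℝ) ^ j * (Q - 2) := by
      field_simp
      ring
    rw [h6, pow_succ]
    have hl : (0 : ℝ) ≤ l := Nat.cast_nonneg l
    nlinarith [mul_le_mul_of_nonneg_right h4 hl]
  have hgeom : ∑ j ∈ Finset.range m, (1 / 2 : ℝ) ^ j ≤ 2 := by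
    rw [geom_sum_eq (by norm_num)]
    have : (0 : ℝ) ≤ (1 / 2) ^ m := by positivity
    rw [div_le_iff_of_neg (by norm_num)]
    linarith
  calc ∑ j ∈ Finset.range m, ((ns.countP fun n => j + 1 + 1 ≤ rank n : ℕ) : ℝ)
      ≤ ∑ j ∈ Finset.range m, (1 + 3 / ((Q : ℝ) - 2) * l * (1 / 2) ^ j) :=
        Finset.sum_le_sum fun j _ => key j
    _ = m + 3 / ((Q : ℝ) - 2) * l * ∑ j ∈ Finset.range m, (1 / 2 : ℝ) ^ j := by
        rw [Finset.sum_add_distrib, Finset.mul_sum]; simp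
    _ ≤ m + 3 / ((Q : ℝ) - 2) * l * 2 := by
        have : (0 : ℝ) < Q - 2 := by linarith
        gcongr
    _ = _ := by ring

/-! ### Branching bounds, and the trail forced by a failure -/

namespace DefectArray

variable {Q d : ℕ} {A : DefectArray Q d}

/-- A bound on the number of directed edges that leave a node. -/
def nodeWeight (A : DefectArray Q d) : Node A.n → ℝ
  | .cell _ => 20
  | .shell i _ => 360 * (Q : ℝ) ^ (3 * A.level i)
  | .lo => 2 * A.faults.card + 1
  | .hi => 2 * A.faults.card + 1

lemma nodeWeight_pos (hQ : 0 < Q) (n : Node A.n) : 0 < A.nodeWeight n := by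
  cases n <;> simp only [nodeWeight] <;> positivity

-- A cell has ten incident errors with two directions each. A shell of level `l` has at most `(3
-- Q^l)^2` sites and `2 Q^l` times, which gives `18 * 20 = 360`. The crude weight of a boundary is
-- harmless, since a simple trail from `lo` to `hi` leaves a boundary only once; the added 1 keeps
-- it positive.
open Classical in
lemma card_darts_le (hQ : 15 < Q) (b : Boundary) (n : Node A.n) :
    ((((partOf b A.faults ×ˢ Finset.univ).filter
      fun δ => dartSrc (A.joins b) δ = n).card : ℕ) : ℝ) ≤ A.nodeWeight n := by
  have hinc : ∀ (δ : Fault × Bool) c, δ.1.kind = b → δ.1.ends δ.2 = c → δ.1 ∈ incident b c := by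
    rintro ⟨f, e⟩ c hk he
    rw [mem_incident_iff hk]
    cases e
    · exact .inl he
    · exact .inr he
  have hbd : ((partOf b A.faults ×ˢ (Finset.univ : Finset Bool)).filter
      fun δ => dartSrc (A.joins b) δ = n).card ≤ 2 * A.faults.card := by
    refine (Finset.card_filter_le _ _).trans ?_
    rw [Finset.card_product, Finset.card_univ, Fintype.card_bool, mul_comm]
    exact Nat.mul_le_mul_left _ (Finset.card_filter_le _ _)
  cases n with
  | lo =>
    simp only [nodeWeight]
    have : (((_ : ℕ)) : ℝ) ≤ ((2 * A.faults.card : ℕ) : ℝ) := Nat.cast_le.2 hbd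
    push_cast at this ⊢
    linarith
  | hi =>
    simp only [nodeWeight]
    have : (((_ : ℕ)) : ℝ) ≤ ((2 * A.faults.card : ℕ) : ℝ) := Nat.cast_le.2 hbd
    push_cast at this ⊢
    linarith
  | cell c =>
    simp only [nodeWeight]
    have h : ((partOf b A.faults ×ˢ (Finset.univ : Finset Bool)).filter
        fun δ => dartSrc (A.joins b) δ = .cell c).card ≤ 20 := by
      calc _ ≤ (incident b c ×ˢ (Finset.univ : Finset Bool)).card := by
            refine Finset.card_le_card fun δ hδ => ?_
            simp only [Finset.mem_filter, Finset.mem_product, partOf, Finset.mem_univ, and_true]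
              at hδ ⊢
            exact hinc δ c hδ.1.2 (A.node_eq_cell hδ.2).1
        _ ≤ 20 := by
            rw [Finset.card_product, Finset.card_univ, Fintype.card_bool]
            have := card_incident_le b c
            omega
    exact_mod_cast h
  | shell i k =>
    simp only [nodeWeight]
    set T : Finset Cell := A.region b i ×ˢ
      Finset.Icc (k * Q ^ A.level i) (k * Q ^ A.level i + Q ^ A.level i) with hT
    have h : ((partOf b A.faults ×ˢ (Finset.univ : Finset Bool)).filter
        fun δ => dartSrc (A.joins b) δ = .shell i k).card ≤ T.card * 20 := by
      calc _ ≤ (T.biUnion fun c => incident b c ×ˢ (Finset.univ : Finset Bool)).card := by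
            refine Finset.card_le_card fun δ hδ => ?_
            simp only [Finset.mem_filter, Finset.mem_product, partOf, Finset.mem_univ, and_true,
              Finset.mem_biUnion] at hδ ⊢
            have hs := (joins_eq_shell_iff hQ).1 hδ.2
            refine ⟨_, ?_, hinc δ _ hδ.1.2 rfl⟩
            have := hs.2.2.2.2.2.trans (min_le_left _ _)
            rw [add_mul, one_mul] at this
            rw [hT, Finset.mem_product, Finset.mem_Icc]
            exact ⟨hs.1, hs.2.2.2.2.1, this⟩
        _ ≤ T.card * 20 := Finset.card_biUnion_le_card_mul _ _ _ fun c _ => by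
            rw [Finset.card_product, Finset.card_univ, Fintype.card_bool]
            have := card_incident_le b c
            omega
    have hpos : 1 ≤ Q ^ A.level i := Nat.pow_pos (by omega)
    have hTc : T.card ≤ 18 * Q ^ (3 * A.level i) := by
      rw [hT, Finset.card_product, Nat.card_Icc]
      have h1 := A.card_region_le b i
      have h2 := A.side_le i
      calc (A.region b i).card * (k * Q ^ A.level i + Q ^ A.level i + 1 - k * Q ^ A.level i)
          ≤ (3 * Q ^ A.level i) ^ 2 * (2 * Q ^ A.level i) := by
            refine Nat.mul_le_mul (h1.trans (Nat.pow_le_pow_left (by omega) 2)) (by omega)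
        _ = 18 * Q ^ (3 * A.level i) := by rw [mul_comm 3 (A.level i), pow_mul]; ring
    have : ((partOf b A.faults ×ˢ (Finset.univ : Finset Bool)).filter
        fun δ => dartSrc (A.joins b) δ = .shell i k).card ≤ 360 * Q ^ (3 * A.level i) := by omega
    exact_mod_cast this

lemma card_idealQubits_le (d : ℕ) : (idealQubits d).card ≤ 2 * (d + 1) ^ 2 := by
  refine (Finset.card_union_le _ _).trans ?_
  refine (Nat.add_le_add Finset.card_image_le Finset.card_image_le).trans ?_
  rw [Finset.card_product, Finset.card_product, Int.card_Ico, Int.card_Ico, Int.card_Ico]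
  have h1 : ((d : ℤ) - 0).toNat ≤ d + 1 := by omega
  have h2 : ((d : ℤ) - 1).toNat ≤ d + 1 := by omega
  have h3 : ((d : ℤ) - 1 - 0).toNat ≤ d + 1 := by omega
  have := Nat.mul_le_mul h1 h1
  have := Nat.mul_le_mul h2 h3
  rw [sq]
  omega

lemma card_faults_le : A.faults.card ≤ 8 * (d + 1) ^ 3 := by
  have hid := card_idealQubits_le d
  have hp : ∀ t, (A.present t).card ≤ 2 * (d + 1) ^ 2 := fun t =>
    (Finset.card_le_card fun q hq => mem_idealQubits_of_present hq).trans hid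
  have hdc : ∀ t, (A.decoupled t).card ≤ 2 * (d + 1) ^ 2 := fun t =>
    (Finset.card_le_card (Finset.subset_union_right (s₁ := A.active t))).trans (hp t)
  have hsq : (d + 1) ^ 2 = (d + 1) * (d + 1) := sq _
  have hf : ∀ t, (A.faces t).card ≤ (d + 1) ^ 2 := fun t => by
    refine (Finset.card_le_card fun w hw => (mem_faces.1 hw).1).trans ?_
    rw [idealFaces, Finset.card_product, Int.card_Ico, Int.card_Ico, hsq]
    exact Nat.mul_le_mul (by omega) (by omega)
  have hs : A.stars.card ≤ (d + 1) ^ 2 := by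
    refine (Finset.card_le_card fun w hw => (mem_stars.1 hw).1).trans ?_
    rw [idealVertices, Finset.card_product, Int.card_Ico, Int.card_Ico, hsq]
    exact Nat.mul_le_mul (by omega) (by omega)
  rw [faults]
  refine (Finset.card_union_le _ _).trans ?_
  have h1 := Finset.card_biUnion_le_card_mul (Finset.range (d + 1)) (fun t =>
    (A.present t).image (fun q => Fault.bit q t) ∪
    (A.present t).image (fun q => Fault.phase q t)) (4 * (d + 1) ^ 2) (fun t _ => by
      refine (Finset.card_union_le _ _).trans ?_
      have := Finset.card_image_le (s := A.present t) (f := fun q => Fault.bit q t)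
      have := Finset.card_image_le (s := A.present t) (f := fun q => Fault.phase q t)
      have := hp t
      omega)
  have h2 := Finset.card_biUnion_le_card_mul (Finset.range d) (fun t =>
    (A.faces t).image (fun w => Fault.plaq w t) ∪
    A.stars.image (fun v => Fault.star v t) ∪
    (A.decoupled t).image (fun q => Fault.gauge q t)) (4 * (d + 1) ^ 2) (fun t _ => by
      refine (Finset.card_union_le _ _).trans ?_
      have := Finset.card_union_le ((A.faces t).image (fun w => Fault.plaq w t))
        (A.stars.image (fun v => Fault.star v t))
      have := Finset.card_image_le (s := A.faces t) (f := fun w => Fault.plaq w t)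
      have := Finset.card_image_le (s := A.stars) (f := fun v => Fault.star v t)
      have := Finset.card_image_le (s := A.decoupled t) (f := fun q => Fault.gauge q t)
      have := hdc t
      have := hf t
      omega)
  rw [Finset.card_range] at h1 h2
  have h3 : (d + 1) * (4 * (d + 1) ^ 2) = 4 * (d + 1) ^ 3 := by ring
  have h4 : d * (4 * (d + 1) ^ 2) ≤ (d + 1) * (4 * (d + 1) ^ 2) :=
    Nat.mul_le_mul_right _ (Nat.le_succ d)
  omega

/-- The syndrome does not change when the errors on a simple trail between the two boundaries are
flipped. -/
lemma syndrome_symmDiff_trail (hQ : 15 < Q) {D : Finset Fault} (hD : D ⊆ A.faults) {b : Boundary}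
    {γ : List (Fault × Bool)} (h1 : IsTrail (A.joins b) .lo γ .hi)
    (h2 : (γ.map (dartSrc (A.joins b)) ++ [Node.hi]).Nodup) (h3 : ∀ δ ∈ γ, δ.1 ∈ partOf b A.faults) :
    A.syndrome (symmDiff D (γ.map Prod.fst).toFinset) = A.syndrome D := by
  set P := (γ.map Prod.fst).toFinset with hP
  have hPk : ∀ f ∈ P, f ∈ partOf b A.faults := by
    intro f hf
    simp only [hP, List.mem_toFinset, List.mem_map] at hf
    obtain ⟨δ, h', rfl⟩ := hf
    exact h3 δ h'
  have hPf : P ⊆ A.faults := fun f hf => (Finset.mem_filter.1 (hPk f hf)).1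
  have hDP : symmDiff D P ⊆ A.faults := fun f hf => by
    rw [Finset.mem_symmDiff] at hf
    exact hf.elim (fun h => hD h.1) (fun h => hPf h.1)
  funext x
  rcases syndrome_eq_nodeDeg hQ x with h | ⟨b', n, n1, n2, h⟩
  · rw [h _ hD, h _ hDP]
  · rw [h _ hD, h _ hDP, nodeDeg_symmDiff]
    have : nodeDeg (A.joins b') (partOf b' P) n = 0 := by
      by_cases hb : b' = b
      · subst hb
        have : partOf b' P = P := Finset.filter_true_of_mem fun f hf =>
          (Finset.mem_filter.1 (hPk f hf)).2
        rw [this]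
        exact h1.nodeDeg_eq_zero h2 n1 n2
      · have : partOf b' P = ∅ := Finset.filter_false_of_mem fun f hf h' =>
          hb (h'.symm.trans (Finset.mem_filter.1 (hPk f hf)).2)
        rw [this]
        rfl
    rw [this, add_zero]

/-- If error and correction of a minimum-weight decoder act non-trivially, then the error contains at
least half of a simple trail between opposite boundaries. -/
theorem exists_trail_of_failure (hQ : 15 < Q) {dec : (Detector A.n → ZMod 2) → Finset Fault}
    (hdec : A.IsMinWeightDecoder dec) {E : Finset Fault} (hE : E ⊆ A.faults) {b : Boundary}
    (hu : ∃ u : Node A.n → ZMod 2, ∑ f ∈ partOf b (symmDiff E (dec (A.syndrome E))),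
      (u (A.joins b f false) + u (A.joins b f true)) ≠ 0) :
    ∃ γ, IsTrail (A.joins b) .lo γ .hi ∧ (γ.map (dartSrc (A.joins b)) ++ [Node.hi]).Nodup ∧
      (∀ δ ∈ γ, δ.1 ∈ partOf b A.faults) ∧
      γ.length ≤ 2 * (E ∩ (γ.map Prod.fst).toFinset).card := by
  obtain ⟨hD, hsD, hmin⟩ := hdec E hE
  set D := dec (A.syndrome E) with hDdef
  obtain ⟨u, hu⟩ := hu
  have hC : symmDiff E D ⊆ A.faults := fun f hf => by
    rw [Finset.mem_symmDiff] at hf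
    exact hf.elim (fun h => hE h.1) (fun h => hD h.1)
  have hsC : A.syndrome (symmDiff E D) = 0 := by
    funext x
    rcases syndrome_eq_nodeDeg hQ x with h | ⟨b', n, -, -, h⟩
    · rw [h _ hC]; rfl
    · rw [h _ hC, nodeDeg_symmDiff, ← h _ hE, ← h _ hD, hsD]
      exact CharTwo.add_self_eq_zero _
  obtain ⟨γ, g1, g2, g3⟩ := exists_trail (s := A.joins b) (C := partOf b (symmDiff E D))
    (lo := Node.lo) (hi := Node.hi) (by simp)
    (fun n n1 n2 => nodeDeg_eq_zero_of_syndrome hQ hC hsC b n1 n2) u hu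
  have g4 : ∀ δ ∈ γ, δ.1 ∈ partOf b A.faults := fun δ hδ => by
    have := Finset.mem_filter.1 (g3 δ hδ)
    exact Finset.mem_filter.2 ⟨hC this.1, this.2⟩
  refine ⟨γ, g1, g2, g4, ?_⟩
  have hs := syndrome_symmDiff_trail hQ hD g1 g2 g4
  have hcard : (γ.map Prod.fst).toFinset.card = γ.length := by
    rw [List.toFinset_card_of_nodup (g1.nodup_fst g2), List.length_map]
  have hP : (γ.map Prod.fst).toFinset ⊆ symmDiff E D := by
    intro f hf
    simp only [List.mem_toFinset, List.mem_map] at hf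
    obtain ⟨δ, h', rfl⟩ := hf
    exact (Finset.mem_filter.1 (g3 δ h')).1
  set P := (γ.map Prod.fst).toFinset
  have hDP : symmDiff D P ⊆ A.faults := fun f hf => by
    rw [Finset.mem_symmDiff] at hf
    exact hf.elim (fun h => hD h.1) (fun h => hC (hP h.1))
  -- Toggling `P` gives another explanation of the same events, so it has at least the weight of
  -- `D`. Every edge of `P` lies in exactly one of `E` and `D`, and comparing cardinalities gives
  -- `|D ∩ P| ≤ |E ∩ P|`.
  have hle := hmin _ hDP (hs.trans hsD)
  have e1 : symmDiff D P = (D \ P) ∪ (E ∩ P) := by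
    ext f
    have := @hP f
    simp only [Finset.mem_symmDiff, Finset.mem_union, Finset.mem_sdiff, Finset.mem_inter] at this ⊢
    tauto
  have e2 : P = (D ∩ P) ∪ (E ∩ P) := by
    ext f
    have := @hP f
    simp only [Finset.mem_symmDiff, Finset.mem_union, Finset.mem_inter] at this ⊢
    tauto
  have e3 := Finset.card_union_le (D \ P) (E ∩ P)
  have e4 := Finset.card_union_le (D ∩ P) (E ∩ P)
  rw [← e1] at e3
  rw [← e2] at e4
  have e5 := Finset.card_sdiff_add_card_inter D P
  omega

/-- A simple trail between opposite boundaries is long, and the number of choices along it is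
bounded. -/
theorem trail_bounds (hQ : 15 < Q) {m : ℕ} (hm : ∀ i, A.level i ≤ m) (hd : 5 * Q ^ m + 15 ≤ d)
    {b : Boundary} {γ : List (Fault × Bool)} (h1 : IsTrail (A.joins b) .lo γ .hi)
    (h2 : (γ.map (dartSrc (A.joins b)) ++ [Node.hi]).Nodup) :
    d ≤ 5 * 3 ^ (m + 1) * γ.length ∧
      (γ.map fun δ => A.nodeWeight (dartSrc (A.joins b) δ)).prod ≤
        ((2 * A.faults.card + 1) * (Q : ℝ) ^ (3 * m)) *
          (360 * (Q : ℝ) ^ (18 / ((Q : ℝ) - 2))) ^ γ.length := by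
  have hQr : (16 : ℝ) ≤ Q := by exact_mod_cast hQ
  have G := A.shellGeometry hQ b
  cases γ with
  | nil => cases h1
  | cons δ γ =>
    obtain ⟨y, hy, hw⟩ := IsTrail.jumpWalk (nd := A.node b) (p := fun (f : Fault) c => f.ends c)
      (dist := cellSep) (fun _ _ => rfl) (fun (f : Fault) c => f.cellSep_ends c) h1
    have hsrc : dartSrc (A.joins b) δ = .lo := h1.1
    rw [List.map_cons, List.cons_append, List.nodup_cons, List.nodup_append] at h2
    obtain ⟨n1, n2, -, n3⟩ := h2
    rw [hsrc] at n1
    have hinner : ∀ n ∈ γ.map (dartSrc (A.joins b)), n.Inner := by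
      intro n hn
      refine ⟨?_, n3 n hn .hi (by simp)⟩
      rintro rfl
      exact n1 (List.mem_append_left _ hn)
    have hrank : ∀ n : Node A.n, A.rank n ≤ m + 1 := by
      intro n
      cases n with
      | shell i k => simp only [rank]; have := hm i; omega
      | _ => simp [rank]
    constructor
    · have hdist := JumpWalk.dist_le hQ G (m + 1) hw (fun n hn => ⟨hinner n hn, hrank n⟩) n2
      have hlow : A.Low b (δ.1.ends δ.2).1 := A.low_of_node_eq hsrc
      have hhigh : A.High b y.1 := A.high_of_node_eq hy
      -- The boundary distance `d - 2 - 2 Q^m` minus the slack `2 Q^m` is at least `d / 5`, because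
      -- `5 Q^m + 15 ≤ d`.
      have hfar := A.le_cellSep_of_low_high (by omega) hm hlow hhigh
      simp only [slack] at hdist
      have hdz : 5 * (Q : ℤ) ^ m + 15 ≤ d := by exact_mod_cast hd
      have : (d : ℤ) ≤ 5 * (3 ^ (m + 1) * ((γ.length + 1 : ℕ) : ℤ)) := by omega
      rw [List.length_cons, mul_assoc]
      exact_mod_cast this
    · rw [List.map_cons, List.prod_cons, hsrc]
      have hlev := JumpWalk.sum_level_le hQ G hw hinner (fun n _ => hrank n) n2
      have hprod : ∀ ns : List (Node A.n), (∀ n ∈ ns, n.Inner) → (ns.map A.nodeWeight).prod ≤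
          360 ^ ns.length * (Q : ℝ) ^ (3 * (ns.map fun n => A.rank n - 1).sum) := by
        intro ns
        induction ns with
        | nil => intro _; simp
        | cons n ns ih =>
          intro hns
          have ih' := ih fun x hx => hns x (by simp [hx])
          simp only [List.map_cons, List.prod_cons, List.sum_cons, List.length_cons]
          have hn : A.nodeWeight n ≤ 360 * (Q : ℝ) ^ (3 * (A.rank n - 1)) := by
            cases n with
            | lo => exact absurd rfl (hns _ (by simp)).1
            | hi => exact absurd rfl (hns _ (by simp)).2
            | cell c => simp [nodeWeight, rank]; norm_num
            | shell i k => simp [nodeWeight, rank]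
          calc A.nodeWeight n * (ns.map A.nodeWeight).prod
              ≤ (360 * (Q : ℝ) ^ (3 * (A.rank n - 1))) *
                (360 ^ ns.length * (Q : ℝ) ^ (3 * (ns.map fun n => A.rank n - 1).sum)) := by
                refine mul_le_mul hn ih' ?_ (by positivity)
                exact List.prod_nonneg fun a ha => by
                  obtain ⟨n, -, rfl⟩ := List.mem_map.1 ha
                  exact (nodeWeight_pos (by omega) n).le
            _ = _ := by rw [mul_add, pow_add, pow_succ]; ring
      have h3 := hprod _ hinner
      rw [List.map_map, List.length_map] at h3
      have hB : (0 : ℝ) ≤ 2 * A.faults.card + 1 := by positivity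
      have hQ2 : (0 : ℝ) < Q - 2 := by linarith
      -- Each unit of level contributes `Q^3`, and the total level is at most `m` plus `6 / (Q - 2)`
      -- times the length; this gives the exponent `18 / (Q - 2)`.
      have h4 : (Q : ℝ) ^ (3 * ((γ.map (dartSrc (A.joins b))).map fun n => A.rank n - 1).sum) ≤
          (Q : ℝ) ^ (3 * m) * ((Q : ℝ) ^ (18 / ((Q : ℝ) - 2))) ^ (γ.length + 1) := by
        rw [← Real.rpow_natCast, ← Real.rpow_natCast _ (3 * m), ← Real.rpow_natCast _ (γ.length + 1),
          ← Real.rpow_mul (by linarith), ← Real.rpow_add (by linarith)]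
        refine Real.rpow_le_rpow_of_exponent_le (by linarith) ?_
        push_cast at hlev ⊢
        calc _ ≤ 3 * ((m : ℝ) + 6 / ((Q : ℝ) - 2) * (γ.length + 1)) :=
              mul_le_mul_of_nonneg_left hlev (by norm_num)
          _ = _ := by ring
      calc A.nodeWeight .lo * (γ.map fun δ => A.nodeWeight (dartSrc (A.joins b) δ)).prod
          ≤ (2 * A.faults.card + 1) * (360 ^ γ.length *
            (Q : ℝ) ^ (3 * ((γ.map (dartSrc (A.joins b))).map fun n => A.rank n - 1).sum)) :=
            mul_le_mul_of_nonneg_left h3 hB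
        _ ≤ (2 * A.faults.card + 1) * (360 ^ (γ.length + 1) *
            ((Q : ℝ) ^ (3 * m) * ((Q : ℝ) ^ (18 / ((Q : ℝ) - 2))) ^ (γ.length + 1))) := by
            refine mul_le_mul_of_nonneg_left ?_ hB
            refine mul_le_mul ?_ h4 (by positivity) (by positivity)
            exact pow_le_pow_right₀ (by norm_num) (Nat.le_succ _)
        _ = _ := by rw [List.length_cons, mul_pow]; ring

end DefectArray

/-! ### Numerical constants and asymptotics -/

section Constants

variable {Q : ℕ}

/-- The left side is the growth constant `360 Q^(18/(Q-2))` of the trails times the 2 in `2√ε`.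
There is ample room: `40^(2Q/(Q-15)) ≥ 1600`, and the exponent of `Q` in `rho` is larger. -/
lemma rho_ge (hQ : 15 < Q) : 720 * (Q : ℝ) ^ (18 / ((Q : ℝ) - 2)) ≤ rho Q := by
  have hQr : (16 : ℝ) ≤ Q := by exact_mod_cast hQ
  have h15 : (0 : ℝ) < Q - 15 := by linarith
  have h2 : (0 : ℝ) < Q - 2 := by linarith
  have e1 : (2 : ℝ) ≤ 2 * Q / (Q - 15) := by rw [le_div_iff₀ h15]; linarith
  have e2 : 18 / ((Q : ℝ) - 2) ≤ 60 * Q / ((Q : ℝ) - 15) ^ 2 := by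
    rw [div_le_div_iff₀ h2 (by positivity)]
    nlinarith
  have f1 : (1600 : ℝ) ≤ 40 ^ (2 * (Q : ℝ) / (Q - 15)) := by
    calc (1600 : ℝ) = 40 ^ (2 : ℝ) := by norm_num
      _ ≤ _ := Real.rpow_le_rpow_of_exponent_le (by norm_num) e1
  have f2 := Real.rpow_le_rpow_of_exponent_le (x := (Q : ℝ)) (by linarith) e2
  rw [rho]
  exact mul_le_mul (by linarith) f2 (by positivity) (by positivity)

lemma one_lt_rho (hQ : 15 < Q) : 1 < rho Q := by
  have hQr : (16 : ℝ) ≤ Q := by exact_mod_cast hQ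
  have h := rho_ge hQ
  have : (1 : ℝ) ≤ (Q : ℝ) ^ (18 / ((Q : ℝ) - 2)) :=
    Real.one_le_rpow (by linarith) (div_nonneg (by norm_num) (by linarith))
  linarith

lemma eta_pos (hQ : 15 < Q) : 0 < eta Q := by
  have hQr : (15 : ℝ) < Q := by exact_mod_cast hQ
  rw [eta, sub_pos, Real.logb_lt_iff_lt_rpow (by linarith) (by norm_num), Real.rpow_one]
  exact hQr

lemma threshold_pos (hQ : 15 < Q) : 0 < threshold Q := by
  have := one_lt_rho hQ
  rw [threshold]
  positivity

/-- The length of the shortest chain of errors between opposite boundaries grows like `d ^ η`. -/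
lemma rpow_eta_le (hQ : 15 < Q) {d m : ℕ} (hd : 0 < d) (hm : Q ^ m ≤ d) :
    (d : ℝ) ^ eta Q ≤ d / 3 ^ m := by
  have hQr : (15 : ℝ) < Q := by exact_mod_cast hQ
  have hdr : (0 : ℝ) < d := by exact_mod_cast hd
  have hmr : (Q : ℝ) ^ m ≤ d := by exact_mod_cast hm
  have hlog : 0 ≤ Real.logb Q 15 := Real.logb_nonneg (by linarith) (by norm_num)
  rw [eta, Real.rpow_sub hdr, Real.rpow_one]
  refine div_le_div_of_nonneg_left hdr.le (by positivity) ?_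
  -- The length bound loses only a factor 3 per level; replacing it by `15 = Q^(log_Q 15)` gives the
  -- exponent in `eta`.
  calc (3 : ℝ) ^ m ≤ 15 ^ m := pow_le_pow_left₀ (by norm_num) (by norm_num) m
    _ = ((Q : ℝ) ^ m) ^ Real.logb Q 15 := by
        rw [← Real.rpow_natCast, ← Real.rpow_natCast, ← Real.rpow_mul (by linarith), mul_comm,
          Real.rpow_mul (by linarith),
          Real.rpow_logb (by linarith) (by linarith) (by norm_num)]
    _ ≤ _ := Real.rpow_le_rpow (by positivity) hmr hlog

/-- Powers of the size of the array are negligible against the stretched exponential. -/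
lemma exists_exp_bound (hQ : 15 < Q) {x : ℝ} (hx0 : 0 < x) (hx1 : x < 1) :
    ∃ c : ℝ, 0 < c ∧ ∃ d₀ : ℕ, ∀ d : ℕ, d₀ ≤ d → ∀ m N : ℕ, Q ^ m ≤ d → N ≤ 8 * (d + 1) ^ 3 →
      2 * (((N : ℝ) + 1) * (((2 * N + 1) * (Q : ℝ) ^ (3 * m)) *
        x ^ ⌈(d : ℝ) / (5 * 3 ^ (m + 1))⌉₊)) ≤ Real.exp (-(c * (d : ℝ) ^ eta Q)) := by
  have hη := eta_pos hQ
  have hlx : 0 < -Real.log x := neg_pos.2 (Real.log_neg hx0 hx1)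
  set κ : ℝ := -Real.log x / 15 with hκ
  have hκ0 : 0 < κ := by positivity
  -- The polynomial factor is at most `156672 * d^9`, with `156672 = 2 * (9 * 8) * (17 * 8) * 8`.
  -- For large `d` its logarithm is at most `(1/4 + 9/40) * κ * d^η`, which is less than half of the
  -- decay `κ * d^η`. The 15 in `κ` is `5 * 3` from the length bound.
  have hlim := (isLittleO_log_rpow_atTop hη).bound (c := κ / 40) (by positivity)
  have hlim2 := (tendsto_rpow_atTop hη).eventually_ge_atTop (4 * Real.log 156672 / κ)
  obtain ⟨d₀, h₀⟩ := Filter.eventually_atTop.1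
    (tendsto_natCast_atTop_atTop.eventually (hlim.and hlim2))
  refine ⟨κ / 2, by positivity, max d₀ 1, fun d hd m N hm hN => ?_⟩
  have hd1 : 1 ≤ d := (le_max_right _ _).trans hd
  obtain ⟨k1, k2⟩ := h₀ d ((le_max_left _ _).trans hd)
  have hdr : (1 : ℝ) ≤ d := by exact_mod_cast hd1
  have hlogd : 0 ≤ Real.log d := Real.log_nonneg hdr
  rw [Real.norm_of_nonneg hlogd, Real.norm_of_nonneg (by positivity)] at k1
  rw [div_le_iff₀ hκ0] at k2
  have hmr : (Q : ℝ) ^ m ≤ d := by exact_mod_cast hm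
  have hNr : (N : ℝ) ≤ 8 * (d + 1) ^ 3 := by exact_mod_cast hN
  have hpoly : 2 * (((N : ℝ) + 1) * ((2 * N + 1) * (Q : ℝ) ^ (3 * m))) ≤
      Real.exp (Real.log 156672 + 9 * Real.log d) := by
    have a0 : ((d : ℝ) + 1) ^ 3 ≤ (2 * d) ^ 3 := pow_le_pow_left₀ (by positivity) (by linarith) 3
    have a1 : (1 : ℝ) ≤ (d + 1) ^ 3 := one_le_pow₀ (by linarith)
    have a2 : (N : ℝ) + 1 ≤ 9 * (2 * d) ^ 3 := by linarith
    have a3 : 2 * (N : ℝ) + 1 ≤ 17 * (2 * d) ^ 3 := by linarith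
    have a4 : (Q : ℝ) ^ (3 * m) ≤ (2 * d) ^ 3 := by
      rw [mul_comm, pow_mul]
      exact pow_le_pow_left₀ (by positivity) (by linarith) 3
    have e : Real.exp (Real.log 156672 + 9 * Real.log d) = 156672 * (d : ℝ) ^ 9 := by
      rw [Real.exp_add, Real.exp_log (by norm_num), ← Real.exp_log (show (0 : ℝ) < (d : ℝ) ^ 9 by
        positivity), Real.log_pow]
      norm_num
    rw [e]
    calc 2 * (((N : ℝ) + 1) * ((2 * N + 1) * (Q : ℝ) ^ (3 * m)))
        ≤ 2 * ((9 * (2 * d) ^ 3) * ((17 * (2 * d) ^ 3) * (2 * d) ^ 3)) := by gcongr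
      _ = _ := by ring
  have hpow : x ^ ⌈(d : ℝ) / (5 * 3 ^ (m + 1))⌉₊ ≤ Real.exp (-(κ * (d : ℝ) ^ eta Q)) := by
    have h1 := Nat.le_ceil ((d : ℝ) / (5 * 3 ^ (m + 1)))
    have h2 := rpow_eta_le hQ hd1 hm
    have h3 : (d : ℝ) / (5 * 3 ^ (m + 1)) = d / 3 ^ m / 15 := by
      rw [pow_succ]; field_simp; norm_num
    rw [← Real.exp_log (pow_pos hx0 _), Real.exp_le_exp, Real.log_pow]
    rw [h3] at h1 ⊢
    have h4 : (d : ℝ) ^ eta Q / 15 ≤ ⌈(d : ℝ) / 3 ^ m / 15⌉₊ := by linarith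
    have h5 := mul_le_mul_of_nonneg_right h4 hlx.le
    rw [hκ]
    linarith
  calc _ = (2 * (((N : ℝ) + 1) * ((2 * N + 1) * (Q : ℝ) ^ (3 * m)))) *
        x ^ ⌈(d : ℝ) / (5 * 3 ^ (m + 1))⌉₊ := by ring
    _ ≤ Real.exp (Real.log 156672 + 9 * Real.log d) * Real.exp (-(κ * (d : ℝ) ^ eta Q)) := by
        gcongr
    _ ≤ _ := by
        rw [← Real.exp_add, Real.exp_le_exp]
        have : 0 < (d : ℝ) ^ eta Q := by positivity
        nlinarith

end Constants

/-! ### Union bound over both kinds of failure -/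

namespace DefectArray

variable {Q d : ℕ} {A : DefectArray Q d}

lemma Operable.exists_level (hA : A.Operable) (hd : 20 ≤ d) :
    ∃ m, (∀ i, A.level i ≤ m) ∧ 5 * Q ^ m + 15 ≤ d := by
  have hop : ∀ i, 5 * Q ^ A.level i + 15 ≤ d := fun i => by
    have := hA i
    have h : 5 * (Q : ℝ) ^ A.level i + 15 ≤ d := by linarith
    exact_mod_cast h
  cases isEmpty_or_nonempty (Fin A.n) with
  | inl _ => exact ⟨0, fun i => isEmptyElim i, by simpa using hd⟩
  | inr _ =>
    obtain ⟨i, hi⟩ := Finite.exists_max A.level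
    exact ⟨A.level i, hi, hop i⟩

/-- The failure probability of a minimum-weight decoder on an operable array. -/
theorem failureProb_le (hQ : 15 < Q) (hA : A.Operable) (hd : 20 ≤ d)
    {dec : (Detector A.n → ZMod 2) → Finset Fault} (hdec : A.IsMinWeightDecoder dec) {ε x : ℝ}
    (h0 : 0 ≤ ε) (h1 : ε ≤ 1) (hx : 360 * (Q : ℝ) ^ (18 / ((Q : ℝ) - 2)) * (2 * √ε) ≤ x)
    (hx1 : x ≤ 1) :
    ∃ m, Q ^ m ≤ d ∧ A.failureProb dec ε ≤ 2 * (((A.faults.card : ℝ) + 1) *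
      (((2 * A.faults.card + 1) * (Q : ℝ) ^ (3 * m)) *
        x ^ ⌈(d : ℝ) / (5 * 3 ^ (m + 1))⌉₊)) := by
  classical
  obtain ⟨m, hm, hmd⟩ := hA.exists_level hd
  have hpow : ∀ i, Q ^ A.level i ≤ Q ^ m := fun i => Nat.pow_le_pow_right (by omega) (hm i)
  have hlev : ∀ i, Q ^ A.level i < d := fun i => by have := hpow i; omega
  have hside : ∀ i, 5 * A.side i + 15 ≤ d := fun i => by
    have := hpow i
    have := A.side_le i
    omega
  refine ⟨m, by omega, ?_⟩
  have hdiff : ∀ E ⊆ A.faults, symmDiff E (dec (A.syndrome E)) ⊆ A.faults := fun E hE f hf => by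
    rw [Finset.mem_symmDiff] at hf
    exact hf.elim (fun h => hE h.1) (fun h => (hdec E hE).1 h.1)
  have key : ∀ (b : Boundary) (p : Finset Fault → Prop),
      (∀ C ⊆ A.faults, p C → ∃ u : Node A.n → ZMod 2,
        ∑ f ∈ partOf b C, (u (A.joins b f false) + u (A.joins b f true)) ≠ 0) →
      ∑ E ∈ A.faults.powerset.filter (fun E => p (symmDiff E (dec (A.syndrome E)))),
        patternProb ε A.faults.card E ≤ ((A.faults.card : ℝ) + 1) *
          (((2 * A.faults.card + 1) * (Q : ℝ) ^ (3 * m)) *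
            x ^ ⌈(d : ℝ) / (5 * 3 ^ (m + 1))⌉₊) := by
    intro b p hp
    refine sum_patternProb_le_of_trails (s := A.joins b) (C := partOf b A.faults)
      (w := A.nodeWeight) h0 h1 (Finset.filter_subset _ _) (Finset.filter_subset _ _)
      (nodeWeight_pos (by omega)) (fun n => ?_) (by positivity) (by positivity) hx hx1
      (lo := .lo) (hi := .hi) ?_
    · convert card_darts_le hQ b n
    · intro E hE
      obtain ⟨hE, hpE⟩ := Finset.mem_filter.1 hE
      rw [Finset.mem_powerset] at hE
      obtain ⟨γ, g1, g2, g3, g4⟩ := exists_trail_of_failure hQ hdec hE (hp _ (hdiff E hE) hpE)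
      obtain ⟨t1, t2⟩ := trail_bounds hQ hm hmd g1 g2
      refine ⟨γ, g1, g2, g3, g4, ?_, t2⟩
      rw [Nat.ceil_le, div_le_iff₀ (by positivity), mul_comm]
      exact_mod_cast t1
  have k1 := key .smooth A.BitFlipFailure fun C hC h =>
    exists_labels_of_bitFlipFailure hQ hlev hside hC h
  have k2 := key .rough A.PhaseFlipFailure fun C hC h =>
    exists_labels_of_phaseFlipFailure hQ hlev hside hC h
  rw [two_mul]
  refine le_trans ?_ (add_le_add k1 k2)
  have hF : A.failureProb dec ε = ∑ E ∈ A.faults.powerset.filter (fun E =>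
      A.BitFlipFailure (symmDiff E (dec (A.syndrome E))) ∨
        A.PhaseFlipFailure (symmDiff E (dec (A.syndrome E)))), patternProb ε A.faults.card E := by
    rw [failureProb]
    refine Finset.sum_congr ?_ fun _ _ => rfl
    ext E
    rw [Finset.mem_filter, Finset.mem_filter]
    rfl
  rw [hF, Finset.filter_or, ← Finset.sum_union_inter]
  exact le_add_of_nonneg_right (Finset.sum_nonneg fun E _ => patternProb_nonneg h0 h1 _ E)

end DefectArray

end ShellMemory

end

theorem mainTheorem1 (Q : ℕ) (hQ : 15 < Q) :
    0 < ShellMemory.threshold Q ∧ 0 < ShellMemory.eta Q ∧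
    ∀ ε : ℝ, 0 ≤ ε → ε < ShellMemory.threshold Q →
      ∃ c : ℝ, 0 < c ∧ ∃ d₀ : ℕ, ∀ d : ℕ, d₀ ≤ d →
        ∀ A : ShellMemory.DefectArray Q d, A.Operable →
          ∀ dec : (ShellMemory.Detector A.n → ZMod 2) → Finset ShellMemory.Fault,
            A.IsMinWeightDecoder dec →
              A.failureProb dec ε ≤ Real.exp (-(c * (d : ℝ) ^ ShellMemory.eta Q)) := by
  open ShellMemory in
  refine ⟨threshold_pos hQ, eta_pos hQ, fun ε h0 hε => ?_⟩
  have hρ := one_lt_rho hQ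
  have hρ0 : 0 < rho Q := by linarith
  have hsq : √ε < 1 / rho Q := by
    rw [Real.sqrt_lt' (by positivity), div_pow, one_pow]
    exact hε
  have hx1 : rho Q * √ε < 1 := by
    rw [lt_div_iff₀ hρ0] at hsq
    linarith
  have h1 : ε ≤ 1 := by
    have : √ε ≤ 1 := hsq.le.trans (by rw [div_le_one hρ0]; exact hρ.le)
    exact Real.sqrt_le_one.1 this
  -- The maximum with `1 / 2` keeps the base positive when `ε = 0`, so that its logarithm can be
  -- used, and still less than one.
  have hx : 360 * (Q : ℝ) ^ (18 / ((Q : ℝ) - 2)) * (2 * √ε) ≤ max (rho Q * √ε) (1 / 2) := by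
    refine le_trans ?_ (le_max_left _ _)
    have := mul_le_mul_of_nonneg_right (rho_ge hQ) (Real.sqrt_nonneg ε)
    linarith
  have hxlt : max (rho Q * √ε) (1 / 2) < 1 := max_lt hx1 (by norm_num)
  obtain ⟨c, hc, d₀, h⟩ := exists_exp_bound hQ
    (lt_of_lt_of_le (by norm_num) (le_max_right (rho Q * √ε) (1 / 2))) hxlt
  refine ⟨c, hc, max d₀ 20, fun d hd A hA dec hdec => ?_⟩
  obtain ⟨m, hm, hle⟩ := DefectArray.failureProb_le hQ hA ((le_max_right _ _).trans hd) hdec h0 h1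
    hx hxlt.le
  exact hle.trans (h d ((le_max_left _ _).trans hd) m _ hm DefectArray.card_faults_le)
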